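/- Let $M$ be a connected oriented smooth manifold of dimension $6$ and $H\subset TM$ a smooth subbundle of rank $4$; put $Q=TM/H$, and let $\mathcal L:H\wedge H\to Q$ be the bundle map induced by the Lie bracket, $\mathcal L(\xi,\eta)=[\xi,\eta]\bmod H$ for $\xi,\eta\in\Gamma(H)$. Then $\mathcal L\wedge\mathcal L\in\Gamma(\Lambda^4H^*\otimes\bigodot^2Q)$ is, at each point, a quadratic form $\psi\mapsto(\psi\circ\mathcal L)\wedge(\psi\circ\mathcal L)$ on $Q^*$, defined up to scale. Suppose that $(M,H)$ is hyperbolic, i.e. that this form is non-degenerate and indefinite at every point. (Sections below may be local.) **Theorem (The Hyperbolic Case).** 1. There is a unique ordered pair $(H_+,H_-)$ of smooth rank $2$ subbundles with $H=H_+\oplus H_-$ such that (a) $[\xi,\eta]\in\Gamma(H)$ for all $\xi\in\Gamma(H_+)$ and $\eta\in\Gamma(H_-)$, and (b) for $\xi_1,\xi_2\in\Gamma(H_+)$ linearly independent and $\eta_1,\eta_2\in\Gamma(H_-)$ linearly independent, $\xi_1\wedge\xi_2\wedge[\xi_1,\xi_2]\wedge\eta_1\wedge\eta_2\wedge[\eta_1,\eta_2]$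 is non-zero and induces the given orientation of $M$. 2. Let $Q_\pm\subset Q$ be the range of $\mathcal L|_{\Lambda^2H_\pm}$. Then $Q=Q_+\oplus Q_-$. 3. Let $T_\pm M=[H_\pm,H_\pm]$, whose fibre at a point is the span of the values there of the brackets of sections of $H_\pm$. Then $T_+M$ and $T_-M$ are smooth rank $3$ subbundles of $TM$ containing $H_+$ and $H_-$ respectively, $TM=T_+M\oplus T_-M$, and the inclusions $T_\pm M\subset TM$ induce isomorphisms $T_\pm M/H_\pm\cong Q_\pm$. 4. There are unique tensors $S_+:Q_+\otimes H_+\to Q_-$ and $S_-:Q_-\otimes H_-\to Q_+$ such that $$S_\pm(\xi \bmod H,\eta)\equiv[\xi,\eta]\bmod (T_\pm M\oplus H_\mp)\quad\text{for }\xi\in\Gamma(T_\pm M),\ \eta\in\Gamma(H_\pm),$$ they are smooth, and they are the respective obstructions to Frobenius integrability: $T_+M$ is involutive (brackets of sections of $T_+M$ are sections of $T_+M$) if and only if $S_+=0$, and $T_-M$ is involutive if and only if $S_-=0$. -/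

import Mathlib

open scoped Manifold ContDiff Topology

noncomputable section

namespace CodimTwo

open VectorField Module

variable {n k l : ℕ} {M : Type*} [TopologicalSpace M]
  [ChartedSpace (EuclideanSpace ℝ (Fin n)) M]

/-- (Not necessarily continuous) vector fields on an `n`-dimensional manifold. -/
abbrev VField (n : ℕ) (M : Type*) [TopologicalSpace M]
    [ChartedSpace (EuclideanSpace ℝ (Fin n)) M] : Type _ :=
  (x : M) → TangentSpace (𝓡 n) x

/-- The vector field `ξ` is smooth on the set `U`. -/
def SmoothOn [IsManifold (𝓡 n) ∞ M] (ξ : VField n M) (U : Set M) : Prop :=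
  ContMDiffOn (𝓡 n) (𝓡 n).tangent ∞ (fun y => (⟨y, ξ y⟩ : TangentBundle (𝓡 n) M)) U

/-- A smooth rank `k` subbundle of the tangent bundle of an `n`-dimensional manifold `M`. -/
@[ext] structure Subbundle (n k : ℕ) (M : Type*) [TopologicalSpace M]
    [ChartedSpace (EuclideanSpace ℝ (Fin n)) M] [IsManifold (𝓡 n) ∞ M] where
  /-- the fibre at a point -/
  fiber : (x : M) → Submodule ℝ (TangentSpace (𝓡 n) x)
  /-- the fibres are locally framed by `k` smooth vector fields -/
  exists_frame : ∀ x : M, ∃ U : Set M, IsOpen U ∧ x ∈ U ∧ ∃ s : Fin k → VField n M,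
    (∀ i, SmoothOn (s i) U) ∧ ∀ y ∈ U, LinearIndependent ℝ (fun i => s i y) ∧
      Submodule.span ℝ (Set.range fun i => s i y) = fiber y

/-- An ordered tuple of vectors is a positively oriented basis. -/
def IsPositive {V : Type*} [AddCommGroup V] [Module ℝ V] (o : Orientation ℝ V (Fin n))
    (v : Fin n → V) : Prop :=
  ∃ b : Basis (Fin n) ℝ V, ⇑b = v ∧ b.orientation = o

/-- An orientation of an `n`-dimensional manifold: an orientation of every tangent space
such that there are positively oriented smooth local frames around every point. -/
structure MfdOrientation (n : ℕ) (M : Type*) [TopologicalSpace M]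
    [ChartedSpace (EuclideanSpace ℝ (Fin n)) M] [IsManifold (𝓡 n) ∞ M] where
  /-- the orientation of the tangent space at a point -/
  orient : (x : M) → Orientation ℝ (TangentSpace (𝓡 n) x) (Fin n)
  /-- local compatibility -/
  exists_frame : ∀ x : M, ∃ U : Set M, IsOpen U ∧ x ∈ U ∧ ∃ s : Fin n → VField n M,
    (∀ i, SmoothOn (s i) U) ∧ ∀ y ∈ U, IsPositive (orient y) (fun i => s i y)

variable [IsManifold (𝓡 n) ∞ M]

/-- `ξ ∈ Γ(U, D)`: `ξ` restricts to a smooth section of `D` over `U`. -/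
structure IsSection (D : Subbundle n k M) (U : Set M) (ξ : VField n M) : Prop where
  smooth : SmoothOn ξ U
  mem : ∀ y ∈ U, ξ y ∈ D.fiber y

/-- Involutivity (Frobenius integrability): brackets of local smooth sections are sections. -/
def Involutive (D : Subbundle n k M) : Prop :=
  ∀ U : Set M, IsOpen U → ∀ ξ η : VField n M, IsSection D U ξ → IsSection D U η →
    ∀ x ∈ U, mlieBracket (𝓡 n) ξ η x ∈ D.fiber x

/-- The fibre at `x` of `Q = TM / H`. -/
abbrev QFiber (H : Subbundle n k M) (x : M) : Type _ :=
  TangentSpace (𝓡 n) x ⧸ H.fiber x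

/-! ### The Levi form -/

/-- A neighbourhood of `x` on which `H` has a smooth frame. -/
def frameNhd (H : Subbundle n k M) (x : M) : Set M := (H.exists_frame x).choose

/-- A smooth frame of `H` around `x`. -/
def frame (H : Subbundle n k M) (x : M) : Fin k → VField n M :=
  (H.exists_frame x).choose_spec.2.2.choose

theorem isOpen_frameNhd (H : Subbundle n k M) (x : M) : IsOpen (frameNhd H x) :=
  (H.exists_frame x).choose_spec.1

theorem mem_frameNhd (H : Subbundle n k M) (x : M) : x ∈ frameNhd H x :=
  (H.exists_frame x).choose_spec.2.1

theorem frame_smooth (H : Subbundle n k M) (x : M) (i : Fin k) :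
    SmoothOn (frame H x i) (frameNhd H x) :=
  (H.exists_frame x).choose_spec.2.2.choose_spec.1 i

theorem frame_spec (H : Subbundle n k M) (x : M) : ∀ y ∈ frameNhd H x,
    LinearIndependent ℝ (fun i => frame H x i y) ∧
      Submodule.span ℝ (Set.range fun i => frame H x i y) = H.fiber y :=
  (H.exists_frame x).choose_spec.2.2.choose_spec.2

/-- The basis of the fibre `H_x` given by a local frame around `x`. -/
def fiberBasis (H : Subbundle n k M) (x : M) : Basis (Fin k) ℝ (H.fiber x) :=
  (Basis.span (frame_spec H x x (mem_frameNhd H x)).1).map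
    (LinearEquiv.ofEq _ _ (frame_spec H x x (mem_frameNhd H x)).2)

theorem coe_fiberBasis (H : Subbundle n k M) (x : M) (i : Fin k) :
    ((fiberBasis H x i : H.fiber x) : TangentSpace (𝓡 n) x) = frame H x i x := by
  simp [fiberBasis, Basis.span_apply]

/-- The Levi form `L : H × H → Q` at `x`, `L(ξ, η) = [ξ, η] mod H`. It is built from a local
frame; `leviForm_apply` shows that it is induced by the bracket of arbitrary sections. -/
def leviForm (H : Subbundle n k M) (x : M) : H.fiber x →ₗ[ℝ] H.fiber x →ₗ[ℝ] QFiber H x :=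
  (fiberBasis H x).constr ℝ fun i => (fiberBasis H x).constr ℝ fun j =>
    (H.fiber x).mkQ (mlieBracket (𝓡 n) (frame H x i) (frame H x j) x)

theorem SmoothOn.mdifferentiableAt {ξ : VField n M} {U : Set M} (h : SmoothOn ξ U)
    (hU : IsOpen U) {x : M} (hx : x ∈ U) :
    MDifferentiableAt (𝓡 n) (𝓡 n).tangent
      (fun y => (⟨y, ξ y⟩ : TangentBundle (𝓡 n) M)) x :=
  (h.contMDiffAt (hU.mem_nhds hx)).mdifferentiableAt (by simp)

/-- A smooth section of `H` is a combination of the frame with differentiable coefficients. -/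
theorem exists_coeff (H : Subbundle n k M) (x : M) {U : Set M} (hU : IsOpen U) (hx : x ∈ U)
    {ξ : VField n M} (hξ : IsSection H U ξ) :
    ∃ f : Fin k → M → ℝ, (∀ i, MDifferentiableAt (𝓡 n) 𝓘(ℝ, ℝ) (f i) x) ∧
      ∀ᶠ y in 𝓝 x, ξ y = (∑ i, f i • frame H x i) y := by
  classical
  let W := (Fin k → EuclideanSpace ℝ (Fin n)) × EuclideanSpace ℝ (Fin n)
  set e := trivializationAt (EuclideanSpace ℝ (Fin n)) (TangentSpace (𝓡 n) (M := M)) x with he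
  have hxe : x ∈ e.baseSet := FiberBundle.mem_baseSet_trivializationAt' x
  have hsm : ∀ (η : VField n M) (V : Set M), IsOpen V → x ∈ V → SmoothOn η V →
      ContMDiffAt (𝓡 n) 𝓘(ℝ, EuclideanSpace ℝ (Fin n)) ∞
        (fun y => (e (⟨y, η y⟩ : TangentBundle (𝓡 n) M)).2) x := by
    intro η V hV hxV hη
    exact (e.contMDiffAt_section_iff (n := ∞) (IB := 𝓡 n) hxe).1
      (hη.contMDiffAt (hV.mem_nhds hxV))
  set σ : Fin k → M → EuclideanSpace ℝ (Fin n) :=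
    fun j y => (e (⟨y, frame H x j y⟩ : TangentBundle (𝓡 n) M)).2 with hσ
  set τ : M → EuclideanSpace ℝ (Fin n) :=
    fun y => (e (⟨y, ξ y⟩ : TangentBundle (𝓡 n) M)).2 with hτ
  have hσs : ∀ j, ContMDiffAt (𝓡 n) 𝓘(ℝ, EuclideanSpace ℝ (Fin n)) ∞ (σ j) x := fun j =>
    hsm _ _ (isOpen_frameNhd H x) (mem_frameNhd H x) (frame_smooth H x j)
  have hτs := hsm ξ U hU hx hξ.smooth
  have hlin : ∀ y (hy : y ∈ e.baseSet) (v : TangentSpace (𝓡 n) y),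
      (e (⟨y, v⟩ : TangentBundle (𝓡 n) M)).2 = e.linearEquivAt ℝ y hy v := fun y hy v => rfl
  -- a left inverse of the frame at `x`
  have hind : LinearIndependent ℝ (fun j => σ j x) := by
    have h := (frame_spec H x x (mem_frameNhd H x)).1.map'
      (e.linearEquivAt ℝ x hxe).toLinearMap (LinearEquiv.ker _)
    exact h
  obtain ⟨P, hP⟩ : ∃ P : EuclideanSpace ℝ (Fin n) →ₗ[ℝ] (Fin k → ℝ),
      ∀ j, P (σ j x) = Pi.single j 1 := by
    obtain ⟨P, hP⟩ := (Fintype.linearCombination ℝ (fun j => σ j x)).exists_leftInverse_of_injective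
      (by
        rw [LinearMap.ker_eq_bot]
        exact hind.fintypeLinearCombination_injective)
    refine ⟨P, fun j => ?_⟩
    have := LinearMap.congr_fun hP (Pi.single j 1)
    simpa [Fintype.linearCombination_apply_single] using this
  let B : W → Matrix (Fin k) (Fin k) ℝ := fun w => Matrix.of fun i j => P (w.1 j) i
  let G : M → W := fun y => (fun j => σ j y, τ y)
  have hG : ContMDiffAt (𝓡 n) 𝓘(ℝ, W) ∞ G x :=
    (contMDiffAt_pi_space.2 hσs).prodMk_space hτs
  let F : Fin k → W → ℝ := fun i w => ((B w).det)⁻¹ * ((B w).adjugate.mulVec (P w.2)) i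
  have hPc : ∀ i, ContDiff ℝ ∞ (fun v => P v i) := fun i =>
    ((LinearMap.proj i ∘ₗ P).toContinuousLinearMap).contDiff
  have hB : ∀ i j, ContDiff ℝ ∞ (fun w : W => B w i j) := by
    intro i j
    have : ContDiff ℝ ∞ (fun w : (Fin k → EuclideanSpace ℝ (Fin n)) × EuclideanSpace ℝ (Fin n) =>
        w.1 j) := by fun_prop
    exact (hPc i).comp this
  have hdet : ∀ A : W → Matrix (Fin k) (Fin k) ℝ, (∀ i j, ContDiff ℝ ∞ (fun w => A w i j)) →
      ContDiff ℝ ∞ (fun w => (A w).det) := by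
    intro A hA
    simp only [Matrix.det_apply]
    refine ContDiff.sum fun σ _ => ContDiff.const_smul _ ?_
    exact contDiff_prod fun i _ => hA _ _
  have hadj : ∀ i j, ContDiff ℝ ∞ (fun w : W => (B w).adjugate i j) := by
    intro i j
    simp only [Matrix.adjugate_apply]
    apply hdet
    intro a b
    by_cases h : a = j
    · subst h
      simpa using contDiff_const
    · simpa [Matrix.updateRow_ne h] using hB a b
  have hB1 : B (G x) = 1 := by
    ext i j
    simp [B, G, hP, Matrix.one_apply, Pi.single_apply]
  have hF : ∀ i, ContDiffAt ℝ ∞ (F i) (G x) := by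
    intro i
    refine ContDiffAt.mul ?_ ?_
    · refine ContDiffAt.inv (hdet B hB).contDiffAt ?_
      simp [hB1]
    · simp only [Matrix.mulVec, dotProduct]
      refine ContDiffAt.sum fun j _ => ((hadj i j).contDiffAt).mul ?_
      exact ((hPc j).comp contDiff_snd).contDiffAt
  refine ⟨fun i y => F i (G y), fun i => ?_, ?_⟩
  · have h1 : ContMDiffAt 𝓘(ℝ, W) 𝓘(ℝ, ℝ) ∞ (F i) (G x) := (hF i).contMDiffAt
    exact (h1.comp x hG).mdifferentiableAt (by simp)
  · have hne : ∀ᶠ y in 𝓝 x, (B (G y)).det ≠ 0 := by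
      have hc : ContinuousAt (fun y => (B (G y)).det) x :=
        (hdet B hB).continuous.continuousAt.comp hG.continuousAt
      exact hc.eventually_ne (by simp [hB1])
    filter_upwards [hne, hU.mem_nhds hx, (isOpen_frameNhd H x).mem_nhds (mem_frameNhd H x),
      e.open_baseSet.mem_nhds hxe] with y hy hyU hyV hye
    have hmem : ξ y ∈ Submodule.span ℝ (Set.range fun i => frame H x i y) := by
      rw [(frame_spec H x y hyV).2]; exact hξ.mem y hyU
    obtain ⟨c, hc⟩ := (Submodule.mem_span_range_iff_exists_fun ℝ).1 hmem
    have hτc : τ y = ∑ j, c j • σ j y := by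
      simp only [hτ, hσ, hlin y hye]
      rw [← hc, map_sum]
      simp
    have hPτ : P (τ y) = (B (G y)).mulVec c := by
      rw [hτc, map_sum]
      ext i
      simp [Matrix.mulVec, dotProduct, B, G, mul_comm]
    have hFc : ∀ i, F i (G y) = c i := by
      intro i
      have : (B (G y)).adjugate.mulVec (P (τ y)) = (B (G y)).det • c := by
        rw [hPτ, Matrix.mulVec_mulVec, Matrix.adjugate_mul, Matrix.smul_mulVec,
          Matrix.one_mulVec]
      show ((B (G y)).det)⁻¹ * ((B (G y)).adjugate.mulVec (P (τ y))) i = c i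
      rw [this]
      simp [hy]
    rw [← hc, Finset.sum_apply]
    exact Finset.sum_congr rfl fun i _ => by
      show c i • frame H x i y = F i (G y) • frame H x i y
      rw [hFc]

theorem mkQ_bracket_left (H : Subbundle n k M) (x : M) {U : Set M} (hU : IsOpen U) (hx : x ∈ U)
    {ξ : VField n M} (hξ : IsSection H U ξ) (η : VField n M) :
    (H.fiber x).mkQ (mlieBracket (𝓡 n) ξ η x) =
      ∑ i, (fiberBasis H x).repr ⟨ξ x, hξ.mem x hx⟩ i •
        (H.fiber x).mkQ (mlieBracket (𝓡 n) (frame H x i) η x) := by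
  obtain ⟨f, hf, hξf⟩ := exists_coeff H x hU hx hξ
  have hfr : ∀ i, MDifferentiableAt (𝓡 n) (𝓡 n).tangent
      (fun y => (⟨y, frame H x i y⟩ : TangentBundle (𝓡 n) M)) x := fun i =>
    (frame_smooth H x i).mdifferentiableAt (isOpen_frameNhd H x) (mem_frameNhd H x)
  have hrepr : ∀ i, (fiberBasis H x).repr ⟨ξ x, hξ.mem x hx⟩ i = f i x := by
    have h1 : (⟨ξ x, hξ.mem x hx⟩ : H.fiber x) = ∑ i, f i x • fiberBasis H x i := by
      apply Subtype.ext
      simp [coe_fiberBasis, hξf.self_of_nhds]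
    intro i
    rw [h1, map_sum]
    simp [Finsupp.single_apply]
  have key : ∀ S : Finset (Fin k),
      MDifferentiableAt (𝓡 n) (𝓡 n).tangent
        (fun y => (⟨y, (∑ i ∈ S, f i • frame H x i) y⟩ : TangentBundle (𝓡 n) M)) x ∧
      (H.fiber x).mkQ (mlieBracket (𝓡 n) (∑ i ∈ S, f i • frame H x i) η x) =
        ∑ i ∈ S, f i x • (H.fiber x).mkQ (mlieBracket (𝓡 n) (frame H x i) η x) := by
    classical
    intro S
    induction S using Finset.induction_on with
    | empty =>
      refine ⟨?_, by simp⟩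
      have h0 := (Bundle.contMDiff_zeroSection (IB := 𝓡 n) (n := 1) (F := EuclideanSpace ℝ (Fin n)) ℝ
        (TangentSpace (𝓡 n) (M := M))).contMDiffAt (x := x)
      simpa using! h0.mdifferentiableAt (by simp)
    | insert a S ha ih =>
      have h1 : MDifferentiableAt (𝓡 n) (𝓡 n).tangent
          (fun y => (⟨y, (f a • frame H x a) y⟩ : TangentBundle (𝓡 n) M)) x :=
        (hf a).smul_section (hfr a)
      simp only [Finset.sum_insert ha]
      refine ⟨mdifferentiableAt_add_section h1 ih.1, ?_⟩
      rw [mlieBracket_add_left h1 ih.1, map_add, ih.2, mlieBracket_smul_left (hf a) (hfr a)]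
      congr 1
      rw [map_add, map_smul, map_smul]
      have h2 : (H.fiber x).mkQ (frame H x a x) = 0 := by
        rw [← coe_fiberBasis]; simp
      rw [h2, smul_zero, zero_add]
  have hb : mlieBracket (𝓡 n) ξ η x = mlieBracket (𝓡 n) (∑ i, f i • frame H x i) η x :=
    Filter.EventuallyEq.mlieBracket_vectorField_eq hξf Filter.EventuallyEq.rfl
  rw [hb, (key Finset.univ).2]
  exact Finset.sum_congr rfl fun i _ => by rw [hrepr]

/-- The Levi form is induced by the Lie bracket of arbitrary local sections. -/
theorem leviForm_apply (H : Subbundle n k M) {U : Set M} (hU : IsOpen U) {ξ η : VField n M}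
    (hξ : IsSection H U ξ) (hη : IsSection H U η) {x : M} (hx : x ∈ U) :
    leviForm H x ⟨ξ x, hξ.mem x hx⟩ ⟨η x, hη.mem x hx⟩ =
      (H.fiber x).mkQ (mlieBracket (𝓡 n) ξ η x) := by
  rw [mkQ_bracket_left H x hU hx hξ η]
  simp only [leviForm, Basis.constr_apply_fintype, LinearMap.sum_apply, LinearMap.smul_apply,
    Basis.equivFun_apply]
  refine Finset.sum_congr rfl fun i _ => ?_
  congr 1
  rw [mlieBracket_swap_apply, map_neg, mkQ_bracket_left H x hU hx hη (frame H x i),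
    ← Finset.sum_neg_distrib]
  refine Finset.sum_congr rfl fun j _ => ?_
  rw [mlieBracket_swap_apply (V := frame H x j), map_neg, smul_neg, neg_neg]

/-! ### Hyperbolicity -/

/-- `L ∧ L` at `x` as a quadratic form on `Q_x^*`, evaluated on vectors `v₀, v₁, v₂, v₃ ∈ H_x`:
`ψ ↦ ((ψ ∘ L) ∧ (ψ ∘ L))(v₀, v₁, v₂, v₃)`, where for a 2-form `ω` one has
`(ω ∧ ω)(v₀, v₁, v₂, v₃) = 2 (ω(v₀,v₁) ω(v₂,v₃) - ω(v₀,v₂) ω(v₁,v₃) + ω(v₀,v₃) ω(v₁,v₂))`. -/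
def leviWedge (H : Subbundle n k M) (x : M) (v : Fin 4 → H.fiber x) :
    QuadraticForm ℝ (Dual ℝ (QFiber H x)) :=
  let ev (i j : Fin 4) : Dual ℝ (QFiber H x) →ₗ[ℝ] ℝ :=
    Dual.eval ℝ (QFiber H x) (leviForm H x (v i) (v j))
  (2 : ℝ) • (QuadraticMap.linMulLin (ev 0 1) (ev 2 3) - QuadraticMap.linMulLin (ev 0 2) (ev 1 3)
    + QuadraticMap.linMulLin (ev 0 3) (ev 1 2))

/-- `(M, H)` is hyperbolic: at every point the quadratic form `L ∧ L` on `Q_x^*` (well defined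
up to scale, the scale being fixed by a basis of `H_x`) is non-degenerate and indefinite. -/
def IsHyperbolic (H : Subbundle n 4 M) : Prop :=
  ∀ x : M, ∃ b : Basis (Fin 4) ℝ (H.fiber x),
    (leviWedge H x b).Nondegenerate ∧
    (∃ ψ, 0 < leviWedge H x b ψ) ∧ (∃ ψ, leviWedge H x b ψ < 0)

/-! ### The splitting and the tensors -/

/-- `H = H₊ ⊕ H₋`, with the two characterising properties: `[H₊, H₋] ⊆ H`, and whenever
`ξ₁, ξ₂` and `η₁, η₂` are local sections of `H₊` and `H₋` that are pointwise independent at `x`,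
`ξ₁ ∧ ξ₂ ∧ [ξ₁, ξ₂] ∧ η₁ ∧ η₂ ∧ [η₁, η₂]` is positive at `x`. -/
structure IsCanonicalSplitting {M' : Type*} [TopologicalSpace M']
    [ChartedSpace (EuclideanSpace ℝ (Fin 6)) M'] [IsManifold (𝓡 6) ∞ M']
    (o : MfdOrientation 6 M') (H : Subbundle 6 4 M')
    (Hp Hm : Subbundle 6 2 M') : Prop where
  sup_eq : ∀ x, Hp.fiber x ⊔ Hm.fiber x = H.fiber x
  disjoint : ∀ x, Disjoint (Hp.fiber x) (Hm.fiber x)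
  bracket_mem : ∀ U : Set M', IsOpen U → ∀ ξ η : VField 6 M', IsSection Hp U ξ →
    IsSection Hm U η → ∀ x ∈ U, mlieBracket (𝓡 6) ξ η x ∈ H.fiber x
  positive : ∀ U : Set M', IsOpen U → ∀ ξ₁ ξ₂ η₁ η₂ : VField 6 M',
    IsSection Hp U ξ₁ → IsSection Hp U ξ₂ → IsSection Hm U η₁ → IsSection Hm U η₂ →
    ∀ x ∈ U, LinearIndependent ℝ ![ξ₁ x, ξ₂ x] → LinearIndependent ℝ ![η₁ x, η₂ x] →
      IsPositive (o.orient x) ![ξ₁ x, ξ₂ x, mlieBracket (𝓡 6) ξ₁ ξ₂ x,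
        η₁ x, η₂ x, mlieBracket (𝓡 6) η₁ η₂ x]

/-- The range of the restriction of `L` to `Λ²D`, as a subspace of `Q_x`. -/
def leviRange (H : Subbundle n k M) (D : Subbundle n l M) (x : M) : Submodule ℝ (QFiber H x) :=
  Submodule.span ℝ {q | ∃ v w : H.fiber x, (v : TangentSpace (𝓡 n) x) ∈ D.fiber x ∧
    (w : TangentSpace (𝓡 n) x) ∈ D.fiber x ∧ leviForm H x v w = q}

/-- The fibre at `x` of `[D, D]`: the span of the values at `x` of brackets of local sections. -/
def bracketFiber (D : Subbundle n k M) (x : M) : Submodule ℝ (TangentSpace (𝓡 n) x) :=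
  Submodule.span ℝ {v | ∃ U : Set M, IsOpen U ∧ x ∈ U ∧ ∃ ξ η : VField n M,
    IsSection D U ξ ∧ IsSection D U η ∧ mlieBracket (𝓡 n) ξ η x = v}

/-- The inclusion `T → TM` induces an isomorphism from `T_x / D_x` to the subspace `Q'` of
`Q_x = T_x M / H_x`. -/
def IsQuotientAt (H : Subbundle n k M) {r s : ℕ} (T : Subbundle n r M) (D : Subbundle n s M)
    (x : M) (Q' : Submodule ℝ (QFiber H x)) : Prop :=
  ∃ e : (T.fiber x ⧸ (D.fiber x).submoduleOf (T.fiber x)) ≃ₗ[ℝ] Q',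
    ∀ v : T.fiber x, (e (Submodule.Quotient.mk v) : QFiber H x) = (H.fiber x).mkQ v

/-- A family of bilinear maps `Q₁ × D₁ → Q₂`, where `Qᵢ` is the range of `L` on `Λ²Dᵢ`. -/
abbrev TensorFamily (H : Subbundle n k M) (D₁ D₂ : Subbundle n l M) : Type _ :=
  (x : M) → leviRange H D₁ x →ₗ[ℝ] D₁.fiber x →ₗ[ℝ] leviRange H D₂ x

/-- `S : Q₁ ⊗ D₁ → Q₂` is induced by the bracket, where `T₁` is the subbundle with
`Q₁ = T₁ / D₁`: `S(ξ, η) ≡ [ξ, η] mod (T₁ ⊕ D₂)` for `ξ ∈ Γ(T₁)`, `η ∈ Γ(D₁)`. The congruence is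
written in `TM / H`, which is legitimate because `H = D₁ ⊕ D₂` is contained in `T₁ ⊕ D₂`. -/
def IsInduced (H : Subbundle n k M) {r : ℕ} (T₁ : Subbundle n r M) (D₁ D₂ : Subbundle n l M)
    (S : TensorFamily H D₁ D₂) : Prop :=
  ∀ U : Set M, IsOpen U → ∀ ξ η : VField n M, IsSection T₁ U ξ → IsSection D₁ U η →
    ∀ x ∈ U, ∀ (q : leviRange H D₁ x) (h : D₁.fiber x),
      (q : QFiber H x) = (H.fiber x).mkQ (ξ x) → (h : TangentSpace (𝓡 n) x) = η x →
      (H.fiber x).mkQ (mlieBracket (𝓡 n) ξ η x) - (S x q h : QFiber H x) ∈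
        (T₁.fiber x ⊔ D₂.fiber x).map (H.fiber x).mkQ

/-- `S : Q₁ ⊗ D₁ → Q₂` is smooth, where `Qᵢ = Tᵢ / Dᵢ`: for `ξ ∈ Γ(T₁)` and `η ∈ Γ(D₁)` the
section `S(ξ mod H, η)` of `Q₂` is locally the class of a smooth section `ζ` of `T₂`. -/
def IsSmoothTensor (H : Subbundle n k M) {r : ℕ} (T₁ T₂ : Subbundle n r M)
    (D₁ D₂ : Subbundle n l M) (S : TensorFamily H D₁ D₂) : Prop :=
  ∀ U : Set M, IsOpen U → ∀ ξ η : VField n M, IsSection T₁ U ξ → IsSection D₁ U η →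
    ∀ x ∈ U, ∃ V : Set M, IsOpen V ∧ x ∈ V ∧ V ⊆ U ∧ ∃ ζ : VField n M, IsSection T₂ V ζ ∧
      ∀ y ∈ V, ∀ (q : leviRange H D₁ y) (h : D₁.fiber y),
        (q : QFiber H y) = (H.fiber y).mkQ (ξ y) → (h : TangentSpace (𝓡 n) y) = η y →
        (S y q h : QFiber H y) = (H.fiber y).mkQ (ζ y)

end CodimTwo

end

open CodimTwo

/-! The Levi form of a hyperbolic distribution singles out a pair of lines in `Q*`: the quadratic form
`ψ ↦ (ψ ∘ L) ∧ (ψ ∘ L)` on the two-dimensional space `Q*` is indefinite, so it has exactly two null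
lines, spanned by `ψ₊` and `ψ₋`. The two-forms `ω± = ψ± ∘ L` on `H` are decomposable and
`ω₊ ∧ ω₋ ≠ 0`, so their kernels are complementary planes, `H₊ = ker ω₋` and `H₋ = ker ω₊`.
Then `L(H₊, H₋) = 0`, and `L` maps `Λ²H₊` and `Λ²H₋` onto complementary lines in `Q`.

Smoothness is obtained in a local frame of `H`, where two components of the bracket are skew-symmetric
`4 × 4` matrices of smooth functions, and a quadratic form on `Q*` is the Pfaffian of a pencil
of such matrices. Choosing the frame of `Q*` at one point so that the leading coefficient is positive,
the roots are given by the quadratic formula (`isotropic`), and the kernels are spanned by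
columns of Pfaffian adjugates (`pfAdj`); see `IsHyperbolic.exists_isAdapted`. This gives fields
`p₀, p₁` and `m₀, m₁` with `[pᵢ, mⱼ] ∈ Γ(H)` such that `p₀, p₁, [p₀, p₁], m₀, m₁, [m₀, m₁]` is a frame
of `TM` (`IsAdapted`).

The unordered pair of planes is unique (`IsLeviFrame.unique`): for `v` in `H₊` or `H₋` the space
`L(v, H)` is at most a line, and for all other `v` it is `Q`. Exchanging the planes exchanges two
blocks of three vectors in the frame and thus reverses the orientation, whereas a change of bases
within the planes multiplies its determinant by a square (`IsPositive.change`). Hence the orientation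
orders the pair, and the local planes agree on overlaps.

The bundles `T±` are locally spanned by thirds of the frame, `H₊` being contained in `[H₊, H₊]` by the
Leibniz rule. The bracket `T₊ × H₊ → TM / (T₊ ⊕ H₋) ≅ Q₋` is bilinear over functions and vanishes on
`H₊ × H₊`, which yields `S₊`. If `S₊ = 0`, then `[T₊, H₊] ⊆ T₊ ⊕ H₋`, and the Jacobi identity improves
this to `[T₊, H₊] ⊆ T₊` (`IsSplitting.involutive_of_mem`). Everything after the choice of the order
is symmetric in `H₊` and `H₋`, so it is proved for one sign and a pair satisfying
`IsSplitting`. -/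

noncomputable section

namespace CodimTwo

open VectorField Module

/-! ### Calculus of smooth vector fields -/

section Calculus

variable {n k l : ℕ} {M : Type*} [TopologicalSpace M]
  [ChartedSpace (EuclideanSpace ℝ (Fin n)) M] [IsManifold (𝓡 n) ∞ M]
  {U V : Set M} {x : M} {ξ η : VField n M}

theorem SmoothOn.mono (h : SmoothOn ξ U) (hV : V ⊆ U) : SmoothOn ξ V :=
  ContMDiffOn.mono h hV

theorem SmoothOn.add (h : SmoothOn ξ U) (h' : SmoothOn η U) : SmoothOn (ξ + η) U :=
  ContMDiffOn.add_section h h'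

theorem SmoothOn.smul {f : M → ℝ} (hf : ContMDiffOn (𝓡 n) 𝓘(ℝ, ℝ) ∞ f U) (h : SmoothOn ξ U) :
    SmoothOn (f • ξ) U :=
  ContMDiffOn.smul_section hf h

theorem smoothOn_zero : SmoothOn (0 : VField n M) U :=
  (Bundle.contMDiff_zeroSection (IB := 𝓡 n) (F := EuclideanSpace ℝ (Fin n)) ℝ
    (TangentSpace (𝓡 n) (M := M))).contMDiffOn

theorem SmoothOn.sum {ι : Type*} {s : Finset ι} {ξ : ι → VField n M}
    (h : ∀ i ∈ s, SmoothOn (ξ i) U) : SmoothOn (∑ i ∈ s, ξ i) U := by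
  classical
  induction s using Finset.induction_on with
  | empty => simpa using smoothOn_zero
  | insert a s ha ih =>
    rw [Finset.sum_insert ha]
    exact (h a (Finset.mem_insert_self _ _)).add
      (ih fun i hi => h i (Finset.mem_insert_of_mem hi))

theorem SmoothOn.const_smul (c : ℝ) (h : SmoothOn ξ U) : SmoothOn (c • ξ) U :=
  SmoothOn.smul (f := fun _ => c) contMDiffOn_const h

theorem SmoothOn.contMDiffAt (h : SmoothOn ξ U) (hU : IsOpen U) (hx : x ∈ U) :
    ContMDiffAt (𝓡 n) (𝓡 n).tangent ∞
      (fun y => (⟨y, ξ y⟩ : TangentBundle (𝓡 n) M)) x :=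
  ContMDiffOn.contMDiffAt h (hU.mem_nhds hx)

theorem SmoothOn.mlieBracket (hU : IsOpen U) (h : SmoothOn ξ U) (h' : SmoothOn η U) :
    SmoothOn (mlieBracket (𝓡 n) ξ η) U := fun x hx =>
  have : IsManifold (𝓡 n) (minSmoothness ℝ 2) M := IsManifold.of_le (n := ∞)
    (by simpa using (WithTop.coe_le_coe.2 (le_top : (2 : ℕ∞) ≤ ⊤) : (2 : WithTop ℕ∞) ≤ ∞))
  have : IsManifold (𝓡 n) (((⊤ : ℕ∞) : WithTop ℕ∞) + 1) M := ‹IsManifold (𝓡 n) ∞ M›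
  (ContMDiffAt.mlieBracket_vectorField (m := ⊤) (n := ⊤) (I := 𝓡 n) (h.contMDiffAt hU hx)
    (h'.contMDiffAt hU hx) (by simp)).contMDiffWithinAt

/-- The Jacobi identity on an open set. -/
theorem leibniz_mlieBracket {ζ : VField n M} (hU : IsOpen U) (hx : x ∈ U) (h₁ : SmoothOn ξ U)
    (h₂ : SmoothOn η U) (h₃ : SmoothOn ζ U) :
    mlieBracket (𝓡 n) ξ (mlieBracket (𝓡 n) η ζ) x =
      mlieBracket (𝓡 n) (mlieBracket (𝓡 n) ξ η) ζ x +
        mlieBracket (𝓡 n) η (mlieBracket (𝓡 n) ξ ζ) x := by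
  have h23 : (2 : WithTop ℕ∞) ≤ ∞ ∧ (3 : WithTop ℕ∞) ≤ ∞ := 
    ⟨WithTop.coe_le_coe.2 (le_top : (2 : ℕ∞) ≤ ⊤), WithTop.coe_le_coe.2 (le_top : (3 : ℕ∞) ≤ ⊤)⟩
  have : IsManifold (𝓡 n) (minSmoothness ℝ 3) M := IsManifold.of_le (n := ∞) (by simpa using h23.2)
  exact leibniz_identity_mlieBracket_apply ((h₁.contMDiffAt hU hx).of_le (by simpa using h23.1))
    ((h₂.contMDiffAt hU hx).of_le (by simpa using h23.1)) ((h₃.contMDiffAt hU hx).of_le (by simpa using h23.1))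

omit [IsManifold (𝓡 n) ∞ M] in
theorem mlieBracket_congr_of_eqOn {ξ' η' : VField n M} (hU : IsOpen U) (hx : x ∈ U)
    (h : ∀ y ∈ U, ξ y = ξ' y) (h' : ∀ y ∈ U, η y = η' y) :
    mlieBracket (𝓡 n) ξ η x = mlieBracket (𝓡 n) ξ' η' x :=
  Filter.EventuallyEq.mlieBracket_vectorField_eq
    (Filter.eventuallyEq_of_mem (hU.mem_nhds hx) h)
    (Filter.eventuallyEq_of_mem (hU.mem_nhds hx) h')

/-- Modulo any subspace containing the values of the fields `a i`, the bracket is linear over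
smooth functions in a combination of the `a i`. The subspace is encoded as the kernel of `φ`. -/
theorem map_mlieBracket_sum_left {W : Type*} [AddCommGroup W] [Module ℝ W]
    (hU : IsOpen U) (hx : x ∈ U) (φ : TangentSpace (𝓡 n) x →ₗ[ℝ] W) {ι : Type*} {s : Finset ι}
    {f : ι → M → ℝ} {a : ι → VField n M} (hf : ∀ i ∈ s, ContMDiffOn (𝓡 n) 𝓘(ℝ, ℝ) ∞ (f i) U)
    (ha : ∀ i ∈ s, SmoothOn (a i) U) (hφ : ∀ i ∈ s, φ (a i x) = 0) (η : VField n M) :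
    φ (mlieBracket (𝓡 n) (∑ i ∈ s, f i • a i) η x) =
      ∑ i ∈ s, f i x • φ (mlieBracket (𝓡 n) (a i) η x) := by
  classical
  induction s using Finset.induction_on with
  | empty => simp
  | insert i s hi ih =>
    have hi' := Finset.mem_insert_self i s
    have hs : ∀ j ∈ s, j ∈ insert i s := fun j hj => Finset.mem_insert_of_mem hj
    rw [Finset.sum_insert hi, Finset.sum_insert hi, mlieBracket_add_left, map_add,
      ih (fun j hj => hf j (hs j hj)) (fun j hj => ha j (hs j hj)) (fun j hj => hφ j (hs j hj)),
      mlieBracket_smul_left, map_add, map_smul, map_smul, hφ i hi', smul_zero, zero_add]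
    · exact ((hf i hi').contMDiffAt (hU.mem_nhds hx)).mdifferentiableAt (by simp)
    · exact (ha i hi').mdifferentiableAt hU hx
    · exact ((ha i hi').smul (hf i hi')).mdifferentiableAt hU hx
    · exact (SmoothOn.sum fun j hj =>
        (ha j (hs j hj)).smul (hf j (hs j hj))).mdifferentiableAt hU hx

theorem map_mlieBracket_sum_right {W : Type*} [AddCommGroup W] [Module ℝ W]
    (hU : IsOpen U) (hx : x ∈ U) (φ : TangentSpace (𝓡 n) x →ₗ[ℝ] W) {ι : Type*} {s : Finset ι}
    {f : ι → M → ℝ} {a : ι → VField n M} (hf : ∀ i ∈ s, ContMDiffOn (𝓡 n) 𝓘(ℝ, ℝ) ∞ (f i) U)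
    (ha : ∀ i ∈ s, SmoothOn (a i) U) (hφ : ∀ i ∈ s, φ (a i x) = 0) (η : VField n M) :
    φ (mlieBracket (𝓡 n) η (∑ i ∈ s, f i • a i) x) =
      ∑ i ∈ s, f i x • φ (mlieBracket (𝓡 n) η (a i) x) := by
  rw [mlieBracket_swap_apply, map_neg, map_mlieBracket_sum_left hU hx φ hf ha hφ,
    ← Finset.sum_neg_distrib]
  refine Finset.sum_congr rfl fun i _ => ?_
  rw [mlieBracket_swap_apply, map_neg, smul_neg, neg_neg]

/-! ### Local frames of the tangent bundle -/

/-- A smooth frame of the tangent bundle over `U`. -/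
abbrev IsFrame {ι : Type*} (f : ι → VField n M) (U : Set M) : Prop :=
  IsLocalFrameOn (𝓡 n) (EuclideanSpace ℝ (Fin n)) ∞ f U

/-- Around every point there is a smooth frame for which the coefficients of smooth fields are
known to be smooth, namely the one given by a trivialization. -/
theorem exists_frame_coeff (x : M) : ∃ U : Set M, IsOpen U ∧ x ∈ U ∧
    ∃ (e : Fin n → VField n M) (he : IsFrame e U), ∀ (V : Set M), IsOpen V → V ⊆ U →
      ∀ ξ : VField n M, SmoothOn ξ V → ∀ i,
        ContMDiffOn (𝓡 n) 𝓘(ℝ, ℝ) ∞ (fun y => he.coeff i y (ξ y)) V := by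
  set e := trivializationAt (EuclideanSpace ℝ (Fin n)) (TangentSpace (𝓡 n) (M := M)) x with he
  let b := (EuclideanSpace.basisFun (Fin n) ℝ).toBasis
  refine ⟨e.baseSet, e.open_baseSet, FiberBundle.mem_baseSet_trivializationAt' x,
    e.localFrame b, e.isLocalFrameOn_localFrame_baseSet (𝓡 n) ∞ b, ?_⟩
  intro V hV hVU ξ hξ i
  exact contMDiffOn_localFrameCoeff (I := 𝓡 n) b hV hVU hξ i

omit [IsManifold (𝓡 n) ∞ M] in
theorem contMDiffOn_det {ι : Type*} [Fintype ι] [DecidableEq ι] {A : M → Matrix ι ι ℝ}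
    (hA : ∀ i j, ContMDiffOn (𝓡 n) 𝓘(ℝ, ℝ) ∞ (fun y => A y i j) U) :
    ContMDiffOn (𝓡 n) 𝓘(ℝ, ℝ) ∞ (fun y => (A y).det) U := by
  simp only [Matrix.det_apply']
  exact contMDiffOn_finsetSum fun σ _ =>
    contMDiffOn_const.mul (contMDiffOn_finsetProd fun i _ => hA _ _)

/-- The coefficients of a smooth field in a smooth frame are smooth: by Cramer's rule this reduces
to the frame of a trivialization. -/
theorem IsFrame.contMDiffOn_coeff {f : Fin n → VField n M} (hU : IsOpen U) (hf : IsFrame f U)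
    (hξ : SmoothOn ξ U) (i : Fin n) :
    ContMDiffOn (𝓡 n) 𝓘(ℝ, ℝ) ∞ (fun y => hf.coeff i y (ξ y)) U := by
  intro x hx
  obtain ⟨W, hW, hxW, e, he, hes⟩ := exists_frame_coeff (n := n) x
  have hV : IsOpen (U ∩ W) := hU.inter hW
  let A : M → Matrix (Fin n) (Fin n) ℝ := fun y => Matrix.of fun i j => he.coeff i y (f j y)
  let τ : M → Fin n → ℝ := fun y i => he.coeff i y (ξ y)
  have hA : ∀ i j, ContMDiffOn (𝓡 n) 𝓘(ℝ, ℝ) ∞ (fun y => A y i j) (U ∩ W) := fun i j =>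
    hes _ hV Set.inter_subset_right _ (SmoothOn.mono (hf.contMDiffOn j) Set.inter_subset_left) i
  have hτ : ∀ i, ContMDiffOn (𝓡 n) 𝓘(ℝ, ℝ) ∞ (fun y => τ y i) (U ∩ W) := fun i =>
    hes _ hV Set.inter_subset_right _ (hξ.mono Set.inter_subset_left) i
  have hdet : ∀ y ∈ U ∩ W, (A y).det ≠ 0 := by
    intro y hy
    have h : A y = (he.toBasisAt hy.2).toMatrix fun j => f j y := by
      ext i j
      exact he.coeff_apply_of_mem hy.2 (f j) i
    rw [h]
    have := ((he.toBasisAt hy.2).is_basis_iff_det (v := fun j => f j y)).1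
      ⟨hf.linearIndependent hy.1, top_le_iff.1 (hf.generating hy.1)⟩
    exact this.ne_zero
  have hc : ∀ y ∈ U ∩ W, hf.coeff i y (ξ y) = (A y).det⁻¹ * ((A y).updateCol i (τ y)).det := by
    intro y hy
    have h : τ y = (A y).mulVec fun j => hf.coeff j y (ξ y) := by
      ext l
      simp only [τ, A, Matrix.mulVec, dotProduct, Matrix.of_apply]
      conv_lhs => rw [hf.coeff_sum_eq ξ hy.1]
      simp [mul_comm]
    rw [← Matrix.cramer_apply, h, Matrix.cramer_eq_adjugate_mulVec, Matrix.mulVec_mulVec,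
      Matrix.adjugate_mul, Matrix.smul_mulVec, Matrix.one_mulVec, Pi.smul_apply, smul_eq_mul,
      inv_mul_cancel_left₀ (hdet y hy)]
  have : ContMDiffOn (𝓡 n) 𝓘(ℝ, ℝ) ∞ (fun y => hf.coeff i y (ξ y)) (U ∩ W) := by
    refine ContMDiffOn.congr (ContMDiffOn.mul (ContMDiffOn.inv₀ (contMDiffOn_det hA) hdet)
      (contMDiffOn_det ?_)) hc
    intro a b
    by_cases h : b = i
    · subst h
      simpa using hτ a
    · simpa [Matrix.updateCol_ne h] using hA a b
  exact (this.contMDiffAt (hV.mem_nhds ⟨hx, hxW⟩)).contMDiffWithinAt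

theorem IsFrame.sum_coeff {f : Fin n → VField n M} (hf : IsFrame f U) (hx : x ∈ U)
    (t : TangentSpace (𝓡 n) x) : ∑ i, hf.coeff i x t • f i x = t := by
  have h := (hf.toBasisAt hx).sum_repr t
  simp only [hf.toBasisAt_coe] at h
  simpa [IsLocalFrameOn.coeff, hx] using h

/-- Near every point, the determinant of `n` smooth fields with respect to suitable reference bases
is a smooth function. -/
theorem exists_contMDiffOn_det (x : M) : ∃ W : Set M, IsOpen W ∧ x ∈ W ∧
    ∃ e : (y : M) → y ∈ W → Basis (Fin n) ℝ (TangentSpace (𝓡 n) y),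
      ∀ (V : Set M), IsOpen V → V ⊆ W → ∀ f : Fin n → VField n M, (∀ i, SmoothOn (f i) V) →
        ∃ d : M → ℝ, ContMDiffOn (𝓡 n) 𝓘(ℝ, ℝ) ∞ d V ∧
          ∀ y (hy : y ∈ W), d y = (e y hy).det fun i => f i y := by
  obtain ⟨W, hW, hxW, e, he, hes⟩ := exists_frame_coeff (n := n) x
  refine ⟨W, hW, hxW, fun y hy => he.toBasisAt hy, fun V hV hVW f hf => ?_⟩
  refine ⟨fun y => (Matrix.of fun i j => he.coeff i y (f j y) : Matrix (Fin n) (Fin n) ℝ).det,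
    contMDiffOn_det fun i j => hes V hV hVW _ (hf j) i, fun y hy => ?_⟩
  rw [Basis.det_apply]
  exact congrArg Matrix.det (Matrix.ext fun i j => he.coeff_apply_of_mem hy (f j) i)

/-- Smooth fields that form a basis at a point form a frame nearby. -/
theorem exists_isFrame {f : Fin n → VField n M} (hU : IsOpen U) (hx : x ∈ U)
    (hf : ∀ i, SmoothOn (f i) U) (hind : LinearIndependent ℝ fun i => f i x) :
    ∃ V ⊆ U, IsOpen V ∧ x ∈ V ∧ IsFrame f V := by
  obtain ⟨W, hW, hxW, e, he⟩ := exists_contMDiffOn_det (n := n) x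
  obtain ⟨d, hd, hde⟩ := he (U ∩ W) (hU.inter hW) Set.inter_subset_right f
    fun i => (hf i).mono Set.inter_subset_left
  have hx0 : d x ≠ 0 := by
    rw [hde x hxW]
    refine (((e x hxW).is_basis_iff_det (v := fun i => f i x)).1 ⟨hind, ?_⟩).ne_zero
    have : FiniteDimensional ℝ (TangentSpace (𝓡 n) x) :=
      Module.Basis.finiteDimensional_of_finite (e x hxW)
    exact hind.span_eq_top_of_card_eq_finrank' (by
      rw [Fintype.card_fin, Module.finrank_eq_card_basis (e x hxW), Fintype.card_fin])
  refine ⟨U ∩ W ∩ d ⁻¹' {0}ᶜ, fun y hy => hy.1.1,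
    hd.continuousOn.isOpen_inter_preimage (hU.inter hW) isOpen_compl_singleton,
    ⟨⟨hx, hxW⟩, hx0⟩, ?_⟩
  have hb : ∀ y ∈ U ∩ W ∩ d ⁻¹' {0}ᶜ, LinearIndependent ℝ (fun i => f i y) ∧
      Submodule.span ℝ (Set.range fun i => f i y) = ⊤ := by
    intro y hy
    have h := hde y hy.1.2
    exact ((e y hy.1.2).is_basis_iff_det).2 (isUnit_iff_ne_zero.2 (h ▸ hy.2))
  exact ⟨fun hy => (hb _ hy).1, fun hy => (hb _ hy).2.ge, fun i =>
    (hf i).mono fun y hy => hy.1.1⟩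

/-- Orientation read off from determinants with respect to an arbitrary, not necessarily positive,
basis `b`. -/
theorem isPositive_iff_det {W : Type*} [AddCommGroup W] [Module ℝ W]
    {o : Orientation ℝ W (Fin n)} {e : Fin n → W} (he : IsPositive o e) (b : Basis (Fin n) ℝ W)
    (v : Fin n → W) : IsPositive o v ↔ 0 < b.det e * b.det v := by
  obtain ⟨c, rfl, rfl⟩ := he
  have h : b.det v = b.det c * c.det v := by
    conv_lhs => rw [AlternatingMap.eq_smul_basis_det c b.det]
    rfl
  have h0 : b.det c ≠ 0 := (b.isUnit_det c).ne_zero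
  rw [h, ← mul_assoc, mul_pos_iff_of_pos_left (mul_self_pos.2 h0)]
  constructor
  · rintro ⟨d, rfl, hd⟩
    exact (c.orientation_eq_iff_det_pos d).1 hd.symm
  · intro hd
    obtain ⟨h1, h2⟩ := (c.is_basis_iff_det (v := v)).2 (isUnit_iff_ne_zero.2 hd.ne')
    refine ⟨Basis.mk h1 h2.ge, Basis.coe_mk _ _, ?_⟩
    rw [eq_comm, c.orientation_eq_iff_det_pos, Basis.coe_mk]
    exact hd

/-- Positivity of smooth fields is an open condition. -/
theorem exists_isPositive (o : MfdOrientation n M) {f : Fin n → VField n M} (hU : IsOpen U)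
    (hx : x ∈ U) (hf : ∀ i, SmoothOn (f i) U) (hpos : IsPositive (o.orient x) fun i => f i x) :
    ∃ V ⊆ U, IsOpen V ∧ x ∈ V ∧ ∀ y ∈ V, IsPositive (o.orient y) fun i => f i y := by
  obtain ⟨W, hW, hxW, e, he⟩ := exists_contMDiffOn_det (n := n) x
  obtain ⟨X, hX, hxX, s, hs, hso⟩ := o.exists_frame x
  have hO : IsOpen (U ∩ (W ∩ X)) := hU.inter (hW.inter hX)
  obtain ⟨d, hd, hde⟩ := he _ hO (fun y hy => hy.2.1) f fun i => (hf i).mono fun y hy => hy.1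
  obtain ⟨c, hc, hce⟩ := he _ hO (fun y hy => hy.2.1) s fun i => (hs i).mono fun y hy => hy.2.2
  refine ⟨U ∩ (W ∩ X) ∩ (fun y => c y * d y) ⁻¹' Set.Ioi 0, fun y hy => hy.1.1,
    (hc.mul hd).continuousOn.isOpen_inter_preimage hO isOpen_Ioi, ⟨⟨hx, hxW, hxX⟩, ?_⟩, ?_⟩
  · simpa [hde x hxW, hce x hxW] using (isPositive_iff_det (hso x hxX) (e x hxW) _).1 hpos
  · intro y hy
    refine (isPositive_iff_det (hso y hy.1.2.2) (e y hy.1.2.1) _).2 ?_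
    simpa [hde y hy.1.2.1, hce y hy.1.2.1] using hy.2

/-- Every tangent vector extends to a smooth field. -/
theorem exists_smoothOn_eq (v : TangentSpace (𝓡 n) x) :
    ∃ U : Set M, IsOpen U ∧ x ∈ U ∧ ∃ ξ : VField n M, SmoothOn ξ U ∧ ξ x = v := by
  obtain ⟨W, hW, hxW, e, he, -⟩ := exists_frame_coeff (n := n) x
  refine ⟨W, hW, hxW, ∑ i, (he.toBasisAt hxW).repr v i • e i,
    SmoothOn.sum fun i _ => SmoothOn.const_smul _ (he.contMDiffOn i), ?_⟩
  conv_rhs => rw [← (he.toBasisAt hxW).sum_repr v]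
  simp

end Calculus

/-! ### Skew forms on a four-dimensional space -/

section Pfaffian

/-- The Pfaffian of a skew-symmetric `4 × 4` matrix. Only entries above the diagonal occur. -/
def pfaffian (w : Matrix (Fin 4) (Fin 4) ℝ) : ℝ :=
  w 0 1 * w 2 3 - w 0 2 * w 1 3 + w 0 3 * w 1 2

/-- The polarization of the Pfaffian, so that `pfPolar w w = 2 * pfaffian w`. -/
def pfPolar (w w' : Matrix (Fin 4) (Fin 4) ℝ) : ℝ :=
  w 0 1 * w' 2 3 - w 0 2 * w' 1 3 + w 0 3 * w' 1 2 +
    (w' 0 1 * w 2 3 - w' 0 2 * w 1 3 + w' 0 3 * w 1 2)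

/-- The Pfaffian adjugate of a skew-symmetric `4 × 4` matrix: the inverse up to the factor
`-pfaffian w`. If `pfaffian w = 0 ≠ w`, its columns span the kernel of `w`. -/
def pfAdj (w : Matrix (Fin 4) (Fin 4) ℝ) : Matrix (Fin 4) (Fin 4) ℝ :=
  !![0, w 2 3, -w 1 3, w 1 2;
    -w 2 3, 0, w 0 3, -w 0 2;
    w 1 3, -w 0 3, 0, w 0 1;
    -w 1 2, w 0 2, -w 0 1, 0]

variable {w w' : Matrix (Fin 4) (Fin 4) ℝ}

theorem eq_of_skew (hw : ∀ i j, w i j = -w j i) :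
    w = !![0, w 0 1, w 0 2, w 0 3;
      -w 0 1, 0, w 1 2, w 1 3;
      -w 0 2, -w 1 2, 0, w 2 3;
      -w 0 3, -w 1 3, -w 2 3, 0] := by
  have hd : ∀ i, w i i = 0 := fun i => by linarith [hw i i]
  ext i j
  fin_cases i <;> fin_cases j <;> simp [hd, ← hw]

theorem pfAdj_transpose (w : Matrix (Fin 4) (Fin 4) ℝ) : (pfAdj w).transpose = -pfAdj w := by
  ext i j
  fin_cases i <;> fin_cases j <;> simp [pfAdj]

theorem pfAdj_mul (hw : ∀ i j, w i j = -w j i) : pfAdj w * w = -pfaffian w • 1 := by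
  rw [eq_of_skew hw]
  ext i j
  fin_cases i <;> fin_cases j <;>
    simp [pfAdj, pfaffian] <;> ring

theorem mul_pfAdj_add (hw : ∀ i j, w i j = -w j i) (hw' : ∀ i j, w' i j = -w' j i) :
    w * pfAdj w' + w' * pfAdj w = -pfPolar w w' • 1 := by
  rw [eq_of_skew hw, eq_of_skew hw']
  ext i j
  fin_cases i <;> fin_cases j <;>
    simp [pfAdj, pfPolar] <;> ring

theorem transpose_pfAdj_mul (hw : ∀ i j, w i j = -w j i) (h : pfaffian w = 0) :
    (pfAdj w).transpose * w = 0 := by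
  rw [pfAdj_transpose, neg_mul, pfAdj_mul hw, h]
  simp

theorem mul_pfAdj (hw : ∀ i j, w i j = -w j i)
    (h : pfaffian w = 0) : w * pfAdj w = 0 := by
  have h1 := mul_pfAdj_add hw hw
  have h2 : pfPolar w w = 0 := by
    have : pfPolar w w = 2 * pfaffian w := by unfold pfPolar pfaffian; ring
    rw [this, h, mul_zero]
  rw [h2, neg_zero, zero_smul, ← two_smul ℝ, smul_eq_zero] at h1
  exact h1.resolve_left two_ne_zero

/-- The restriction of `w'` to the kernel of a degenerate `w`, in terms of the spanning vectors
of that kernel given by the columns of `pfAdj w`. -/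
theorem transpose_pfAdj_mul_mul (hw : ∀ i j, w i j = -w j i) (hw' : ∀ i j, w' i j = -w' j i)
    (h : pfaffian w = 0) : (pfAdj w).transpose * w' * pfAdj w = pfPolar w' w • pfAdj w := by
  have h1 : w' * pfAdj w = -pfPolar w' w • 1 - w * pfAdj w' := by
    rw [← mul_pfAdj_add hw' hw, add_sub_cancel_right]
  rw [mul_assoc, h1, mul_sub, ← mul_assoc, transpose_pfAdj_mul hw h, zero_mul, sub_zero,
    pfAdj_transpose]
  simp

theorem exists_pfAdj_ne_zero (h : pfPolar w w' ≠ 0) : ∃ i j, pfAdj w i j ≠ 0 := by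
  by_contra! h0
  have h1 := h0 0 1
  have h2 := h0 0 2
  have h3 := h0 0 3
  have h4 := h0 1 2
  have h5 := h0 1 3
  have h6 := h0 2 3
  simp [pfAdj] at h1 h2 h3 h4 h5 h6
  exact h (by simp [pfPolar, h1, h2, h3, h4, h5, h6])

theorem pfPolar_comm (w w' : Matrix (Fin 4) (Fin 4) ℝ) : pfPolar w w' = pfPolar w' w := by
  unfold pfPolar; ring

/-- The two roots of the Pfaffian on the pencil spanned by `w` and `w'`, up to scale. -/
def isotropic (ε : ℝ) (w w' : Matrix (Fin 4) (Fin 4) ℝ) : Matrix (Fin 4) (Fin 4) ℝ :=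
  (-pfPolar w w' + ε * √(pfPolar w w' ^ 2 - 4 * pfaffian w * pfaffian w')) • w +
    (2 * pfaffian w) • w'

theorem pfaffian_isotropic {ε : ℝ} (hε : ε ^ 2 = 1)
    (h : 0 ≤ pfPolar w w' ^ 2 - 4 * pfaffian w * pfaffian w') :
    pfaffian (isotropic ε w w') = 0 := by
  have key : ∀ t u : ℝ, pfaffian (t • w + u • w') =
      pfaffian w * t ^ 2 + pfPolar w w' * t * u + pfaffian w' * u ^ 2 := by
    intro t u
    simp [pfaffian, pfPolar]
    ring
  have hr := Real.sq_sqrt h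
  rw [isotropic, key]
  linear_combination pfaffian w * ε ^ 2 * hr +
    pfaffian w * (pfPolar w w' ^ 2 - 4 * pfaffian w * pfaffian w') * hε

theorem pfPolar_isotropic (h : 0 ≤ pfPolar w w' ^ 2 - 4 * pfaffian w * pfaffian w') :
    pfPolar (isotropic 1 w w') (isotropic (-1) w w') =
      -4 * pfaffian w * (pfPolar w w' ^ 2 - 4 * pfaffian w * pfaffian w') := by
  have key : ∀ t u t' u' : ℝ, pfPolar (t • w + u • w') (t' • w + u' • w') =
      2 * pfaffian w * t * t' + pfPolar w w' * (t * u' + t' * u) + 2 * pfaffian w' * u * u' := by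
    intro t u t' u'
    simp [pfaffian, pfPolar]
    ring
  have hr := Real.sq_sqrt h
  rw [isotropic, isotropic, key]
  linear_combination (-2) * pfaffian w * hr

theorem isotropic_skew (ε : ℝ) (hw : ∀ i j, w i j = -w j i) (hw' : ∀ i j, w' i j = -w' j i)
    (i j : Fin 4) : isotropic ε w w' i j = -isotropic ε w w' j i := by
  simp only [isotropic, Matrix.add_apply, Matrix.smul_apply, hw i j, hw' i j]
  simp only [smul_eq_mul]
  ring

end Pfaffian

section SmoothPfaffian

variable {n : ℕ} {M : Type*} [TopologicalSpace M] [ChartedSpace (EuclideanSpace ℝ (Fin n)) M]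
  {U : Set M} {w w' : M → Matrix (Fin 4) (Fin 4) ℝ}

theorem contMDiffOn_pfaffian (hw : ∀ i j, ContMDiffOn (𝓡 n) 𝓘(ℝ, ℝ) ∞ (fun y => w y i j) U) :
    ContMDiffOn (𝓡 n) 𝓘(ℝ, ℝ) ∞ (fun y => pfaffian (w y)) U :=
  (((hw _ _).mul (hw _ _)).sub ((hw _ _).mul (hw _ _))).add ((hw _ _).mul (hw _ _))

theorem contMDiffOn_pfPolar (hw : ∀ i j, ContMDiffOn (𝓡 n) 𝓘(ℝ, ℝ) ∞ (fun y => w y i j) U)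
    (hw' : ∀ i j, ContMDiffOn (𝓡 n) 𝓘(ℝ, ℝ) ∞ (fun y => w' y i j) U) :
    ContMDiffOn (𝓡 n) 𝓘(ℝ, ℝ) ∞ (fun y => pfPolar (w y) (w' y)) U :=
  ((((hw _ _).mul (hw' _ _)).sub ((hw _ _).mul (hw' _ _))).add ((hw _ _).mul (hw' _ _))).add
    ((((hw' _ _).mul (hw _ _)).sub ((hw' _ _).mul (hw _ _))).add ((hw' _ _).mul (hw _ _)))

theorem contMDiffOn_pfAdj (hw : ∀ i j, ContMDiffOn (𝓡 n) 𝓘(ℝ, ℝ) ∞ (fun y => w y i j) U)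
    (i j : Fin 4) : ContMDiffOn (𝓡 n) 𝓘(ℝ, ℝ) ∞ (fun y => pfAdj (w y) i j) U := by
  have hneg : ∀ i j, ContMDiffOn (𝓡 n) 𝓘(ℝ, ℝ) ∞ (fun y => -w y i j) U := fun i j =>
    (contMDiff_neg 𝓘(ℝ, ℝ) ∞).comp_contMDiffOn (hw i j)
  fin_cases i <;> fin_cases j <;>
    first | exact contMDiffOn_const | exact hw _ _ | exact hneg _ _

theorem contMDiffOn_isotropic (ε : ℝ)
    (hw : ∀ i j, ContMDiffOn (𝓡 n) 𝓘(ℝ, ℝ) ∞ (fun y => w y i j) U)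
    (hw' : ∀ i j, ContMDiffOn (𝓡 n) 𝓘(ℝ, ℝ) ∞ (fun y => w' y i j) U)
    (h : ∀ y ∈ U, 0 < pfPolar (w y) (w' y) ^ 2 - 4 * pfaffian (w y) * pfaffian (w' y))
    (i j : Fin 4) : ContMDiffOn (𝓡 n) 𝓘(ℝ, ℝ) ∞ (fun y => isotropic ε (w y) (w' y) i j) U := by
  have hB := contMDiffOn_pfPolar hw hw'
  have ha := contMDiffOn_pfaffian hw
  have hc := contMDiffOn_pfaffian hw'
  have hD : ContMDiffOn (𝓡 n) 𝓘(ℝ, ℝ) ∞ (fun y =>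
      pfPolar (w y) (w' y) ^ 2 - 4 * pfaffian (w y) * pfaffian (w' y)) U :=
    (hB.pow 2).sub ((contMDiffOn_const.mul ha).mul hc)
  have hr : ContMDiffOn (𝓡 n) 𝓘(ℝ, ℝ) ∞ (fun y =>
      √(pfPolar (w y) (w' y) ^ 2 - 4 * pfaffian (w y) * pfaffian (w' y))) U := fun y hy =>
    (Real.contDiffAt_sqrt (h y hy).ne').contMDiffAt.comp_contMDiffWithinAt y (hD y hy)
  exact ((((contMDiff_neg 𝓘(ℝ, ℝ) ∞).comp_contMDiffOn hB).add (contMDiffOn_const.mul hr)).mul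
    (hw i j)).add ((contMDiffOn_const.mul ha).mul (hw' i j))

end SmoothPfaffian

/-! ### Adapted local frames -/

section Adapted

/-- A functional that is not a multiple of `φ` is nonzero on the kernel of `φ`. -/
theorem exists_dual_pair {W : Type*} [AddCommGroup W] [Module ℝ W] {φ ψ : Dual ℝ W}
    (h : ∀ c : ℝ, ψ ≠ c • φ) : ∃ u : W, φ u = 0 ∧ ψ u = 1 := by
  by_contra! h0
  have hker : ⨅ _ : Unit, LinearMap.ker φ ≤ LinearMap.ker ψ := by
    intro u hu
    have hu' : φ u = 0 := by simpa using hu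
    by_contra hne
    exact h0 ((ψ u)⁻¹ • u) (by simp [hu']) (by simp [inv_mul_cancel₀ (show ψ u ≠ 0 from hne)])
  have := mem_span_of_iInf_ker_le_ker (L := fun _ : Unit => φ) hker
  rw [Set.range_const, Submodule.mem_span_singleton] at this
  obtain ⟨c, hc⟩ := this
  exact h c hc.symm

variable {n k : ℕ} {M : Type*} [TopologicalSpace M]
  [ChartedSpace (EuclideanSpace ℝ (Fin n)) M] [IsManifold (𝓡 n) ∞ M]

theorem leviWedge_apply (H : Subbundle n k M) (x : M) (v : Fin 4 → H.fiber x)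
    (ψ : Dual ℝ (QFiber H x)) :
    leviWedge H x v ψ = 2 * pfaffian (Matrix.of fun i j => ψ (leviForm H x (v i) (v j))) := by
  simp [leviWedge, pfaffian]
  ring

/-- Functionals on `Q` on which `L ∧ L` is positive and negative, respectively, are independent. They
come with the dual basis of `Q`. -/
theorem IsHyperbolic.exists_basis {H : Subbundle n 4 M} (hH : IsHyperbolic H) (x : M) :
    ∃ (v : Basis (Fin 4) ℝ (H.fiber x)) (ψ₁ ψ₂ : Dual ℝ (QFiber H x)) (u₁ u₂ : QFiber H x),
      ψ₁ u₁ = 1 ∧ ψ₁ u₂ = 0 ∧ ψ₂ u₁ = 0 ∧ ψ₂ u₂ = 1 ∧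
      0 < pfaffian (Matrix.of fun i j => ψ₁ (leviForm H x (v i) (v j))) ∧
      pfaffian (Matrix.of fun i j => ψ₂ (leviForm H x (v i) (v j))) < 0 := by
  obtain ⟨b, -, ⟨ψ₁, h₁⟩, ⟨ψ₂, h₂⟩⟩ := hH x
  obtain ⟨u₂, hu₂, hu₂'⟩ : ∃ u, ψ₁ u = 0 ∧ ψ₂ u = 1 := by
    refine exists_dual_pair fun c hc => ?_
    rw [hc, QuadraticMap.map_smul, smul_eq_mul] at h₂
    nlinarith [mul_nonneg (mul_self_nonneg c) h₁.le]
  obtain ⟨u₁, hu₁, hu₁'⟩ : ∃ u, ψ₂ u = 0 ∧ ψ₁ u = 1 := by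
    refine exists_dual_pair fun c hc => ?_
    rw [hc, QuadraticMap.map_smul, smul_eq_mul] at h₁
    nlinarith [mul_nonneg (mul_self_nonneg c) (neg_nonneg.2 h₂.le)]
  rw [leviWedge_apply] at h₁ h₂
  exact ⟨b, ψ₁, ψ₂, u₁, u₂, hu₁', hu₂, hu₁, hu₂', by linarith, by linarith⟩

/-- Every vector of a subbundle extends to a local section, defined over a fixed neighbourhood. -/
theorem exists_isSection_eq (D : Subbundle n k M) (x : M) (v : D.fiber x) :
    ∃ ξ : VField n M, IsSection D (frameNhd D x) ξ ∧ ξ x = v := by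
  refine ⟨∑ i, (fiberBasis D x).repr v i • frame D x i,
    ⟨SmoothOn.sum fun i _ => SmoothOn.const_smul _ (frame_smooth D x i), fun y hy => ?_⟩, ?_⟩
  · rw [Finset.sum_apply, ← (frame_spec D x y hy).2]
    exact Submodule.sum_mem _ fun i _ =>
      Submodule.smul_mem _ _ (Submodule.subset_span ⟨i, rfl⟩)
  · have h := congrArg Subtype.val ((fiberBasis D x).sum_repr v)
    simp only [Submodule.coe_sum, Submodule.coe_smul, coe_fiberBasis] at h
    rw [Finset.sum_apply]
    exact h

theorem IsSection.mono {D : Subbundle n k M} {U V : Set M} {ξ : VField n M}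
    (h : IsSection D U ξ) (hV : V ⊆ U) : IsSection D V ξ :=
  ⟨h.smooth.mono hV, fun y hy => h.mem y (hV hy)⟩

end Adapted

section Six

variable {M : Type*} [TopologicalSpace M]
  [ChartedSpace (EuclideanSpace ℝ (Fin 6)) M] [IsManifold (𝓡 6) ∞ M]

/-- The fields `p₀, p₁, [p₀, p₁], m₀, m₁, [m₀, m₁]`. -/
def bracketFrame (p m : Fin 2 → VField 6 M) : Fin 6 → VField 6 M :=
  ![p 0, p 1, mlieBracket (𝓡 6) (p 0) (p 1), m 0, m 1, mlieBracket (𝓡 6) (m 0) (m 1)]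

/-- Local frames `p` and `m` of two complementary rank two subbundles of `H` with
`[p i, m j] ∈ Γ(H)` that, together with `[p 0, p 1]` and `[m 0, m 1]`, frame the tangent bundle. -/
structure IsAdapted (H : Subbundle 6 4 M) (p m : Fin 2 → VField 6 M) (U : Set M) : Prop where
  isOpen : IsOpen U
  left : ∀ i, IsSection H U (p i)
  right : ∀ i, IsSection H U (m i)
  bracket_mem : ∀ i j, ∀ y ∈ U, mlieBracket (𝓡 6) (p i) (m j) y ∈ H.fiber y
  isFrame : IsFrame (bracketFrame p m) U

/-- Around `x` there is a frame of `TM` extending a frame of `H` such that the last two components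
of the Levi form have Pfaffians of opposite signs at `x`. -/
theorem IsHyperbolic.exists_frame {H : Subbundle 6 4 M} (hH : IsHyperbolic H) (x : M) :
    ∃ (U : Set M) (s : Fin 4 → VField 6 M) (f : Fin 6 → VField 6 M) (hf : IsFrame f U),
      IsOpen U ∧ x ∈ U ∧ (∀ i, IsSection H U (s i)) ∧ (∀ i : Fin 4, f (Fin.castAdd 2 i) = s i) ∧
      0 < pfaffian (Matrix.of fun i j => hf.coeff 4 x (mlieBracket (𝓡 6) (s i) (s j) x)) ∧
      pfaffian (Matrix.of fun i j => hf.coeff 5 x (mlieBracket (𝓡 6) (s i) (s j) x)) < 0 := by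
  obtain ⟨v, ψ₁, ψ₂, q₁, q₂, h11, h12, h21, h22, ha, hc⟩ := hH.exists_basis x
  choose s hs hsv using fun i => exists_isSection_eq H x (v i)
  obtain ⟨t₁, rfl⟩ := (H.fiber x).mkQ_surjective q₁
  obtain ⟨t₂, rfl⟩ := (H.fiber x).mkQ_surjective q₂
  obtain ⟨U₁, hU₁, hx₁, u₁, hu₁, rfl⟩ := exists_smoothOn_eq t₁
  obtain ⟨U₂, hU₂, hx₂, u₂, hu₂, rfl⟩ := exists_smoothOn_eq t₂
  let O := frameNhd H x ∩ (U₁ ∩ U₂)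
  have hO : IsOpen O := (isOpen_frameNhd H x).inter (hU₁.inter hU₂)
  have hxO : x ∈ O := ⟨mem_frameNhd H x, hx₁, hx₂⟩
  have hsO : ∀ i, IsSection H O (s i) := fun i => (hs i).mono fun y hy => hy.1
  let f : Fin 6 → VField 6 M := ![s 0, s 1, s 2, s 3, u₁, u₂]
  have hfs : ∀ i : Fin 4, f (Fin.castAdd 2 i) = s i := by
    intro i; fin_cases i <;> rfl
  have hfO : ∀ i, SmoothOn (f i) O := by
    have h1 := hu₁.mono (V := O) fun y hy => hy.2.1
    have h2 := hu₂.mono (V := O) fun y hy => hy.2.2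
    intro i
    fin_cases i
    exacts [(hsO 0).smooth, (hsO 1).smooth, (hsO 2).smooth, (hsO 3).smooth, h1, h2]
  have hz : ∀ i, (H.fiber x).mkQ (s i x) = 0 := fun i => by rw [hsv]; simp
  have hind : LinearIndependent ℝ fun i => f i x := by
    rw [Fintype.linearIndependent_iff]
    intro g hg
    rw [Fin.sum_univ_six] at hg
    change g 0 • s 0 x + g 1 • s 1 x + g 2 • s 2 x + g 3 • s 3 x + g 4 • u₁ x + g 5 • u₂ x = 0 at hg
    have h4 : g 4 = 0 := by
      have := congrArg (fun t => ψ₁ ((H.fiber x).mkQ t)) hg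
      simpa only [map_add, map_smul, hz, smul_zero, h11, h12, smul_eq_mul, mul_one, mul_zero,
        add_zero, zero_add, map_zero] using this
    have h5 : g 5 = 0 := by
      have := congrArg (fun t => ψ₂ ((H.fiber x).mkQ t)) hg
      simpa only [map_add, map_smul, hz, smul_zero, h21, h22, smul_eq_mul, mul_one, mul_zero,
        add_zero, zero_add, map_zero] using this
    have h3 : ∑ i : Fin 4, g (Fin.castAdd 2 i) • v i = 0 := by
      apply Subtype.ext
      simp only [Submodule.coe_sum, Submodule.coe_smul, ← hsv, ZeroMemClass.coe_zero]
      rw [h4, h5, zero_smul, zero_smul, add_zero, add_zero] at hg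
      rw [Fin.sum_univ_four]
      exact hg
    have h3' := Fintype.linearIndependent_iff.1 v.linearIndependent _ h3
    intro i
    fin_cases i
    exacts [h3' 0, h3' 1, h3' 2, h3' 3, h4, h5]
  obtain ⟨V, hVO, hV, hxV, hf⟩ := exists_isFrame hO hxO hfO hind
  have hcoeff : ∀ (i : Fin 6) (ψ : Dual ℝ (QFiber H x)),
      (∀ j, ψ ((H.fiber x).mkQ (f j x)) = if j = i then 1 else 0) →
      ∀ t, hf.coeff i x t = ψ ((H.fiber x).mkQ t) := by
    intro i ψ hψ t
    have : (hf.toBasisAt hxV).coord i = ψ ∘ₗ (H.fiber x).mkQ := by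
      refine (hf.toBasisAt hxV).ext fun j => ?_
      rw [LinearMap.comp_apply, hf.toBasisAt_coe, hψ, ← hf.toBasisAt_coe hxV, Basis.coord_apply,
        Basis.repr_self, Finsupp.single_apply]
    rw [← LinearMap.comp_apply, ← this]
    simp [IsLocalFrameOn.coeff, hxV]
  have hL : ∀ i j, (H.fiber x).mkQ (mlieBracket (𝓡 6) (s i) (s j) x) =
      leviForm H x (v i) (v j) := by
    intro i j
    rw [← leviForm_apply H hO (hsO i) (hsO j) hxO]
    simp only [hsv]
  have hzψ : ∀ (ψ : Dual ℝ (QFiber H x)) i, ψ ((H.fiber x).mkQ (s i x)) = 0 := fun ψ i => by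
    rw [hz, map_zero]
  have hψ₁ : ∀ j, ψ₁ ((H.fiber x).mkQ (f j x)) = if j = 4 then 1 else 0 := by
    intro j
    fin_cases j
    exacts [hzψ _ 0, hzψ _ 1, hzψ _ 2, hzψ _ 3, h11, h12]
  have hψ₂ : ∀ j, ψ₂ ((H.fiber x).mkQ (f j x)) = if j = 5 then 1 else 0 := by
    intro j
    fin_cases j
    exacts [hzψ _ 0, hzψ _ 1, hzψ _ 2, hzψ _ 3, h21, h22]
  refine ⟨V, s, f, hf, hV, hxV, fun i => (hsO i).mono hVO, hfs, ?_, ?_⟩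
  · simp only [hcoeff 4 ψ₁ hψ₁, hL]
    exact ha
  · simp only [hcoeff 5 ψ₂ hψ₂, hL]
    exact hc

end Six

/-- Lie brackets of combinations of `s`, seen by a functional that vanishes on `s`. -/
theorem map_mlieBracket_sum_sum {n : ℕ} {M : Type*} [TopologicalSpace M]
    [ChartedSpace (EuclideanSpace ℝ (Fin n)) M] [IsManifold (𝓡 n) ∞ M]
    {U : Set M} {y : M} (hU : IsOpen U) (hy : y ∈ U)
    (φ : TangentSpace (𝓡 n) y →ₗ[ℝ] ℝ) {s : Fin 4 → VField n M} (hs : ∀ i, SmoothOn (s i) U)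
    (hφ : ∀ i, φ (s i y) = 0) {A B : M → Matrix (Fin 4) (Fin 4) ℝ}
    (hA : ∀ i j, ContMDiffOn (𝓡 n) 𝓘(ℝ, ℝ) ∞ (fun y => A y i j) U)
    (hB : ∀ i j, ContMDiffOn (𝓡 n) 𝓘(ℝ, ℝ) ∞ (fun y => B y i j) U) (i j : Fin 4) :
    φ (mlieBracket (𝓡 n) (∑ k, (fun z => A z k i) • s k) (∑ l, (fun z => B z l j) • s l) y) =
      ((A y).transpose * Matrix.of (fun k l => φ (mlieBracket (𝓡 n) (s k) (s l) y)) * B y) i j := by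
  rw [map_mlieBracket_sum_left hU hy φ (fun k _ => hA k i) (fun k _ => hs k) fun k _ => hφ k,
    Matrix.mul_assoc]
  simp only [map_mlieBracket_sum_right hU hy φ (fun k _ => hB k j) (fun k _ => hs k)
    fun k _ => hφ k, Matrix.mul_apply, Matrix.of_apply, smul_eq_mul, Matrix.transpose_apply]
  refine Finset.sum_congr rfl fun k _ => congrArg _ (Finset.sum_congr rfl fun l _ => ?_)
  exact mul_comm (B y l j) _

section Six

variable {M : Type*} [TopologicalSpace M]
  [ChartedSpace (EuclideanSpace ℝ (Fin 6)) M] [IsManifold (𝓡 6) ∞ M]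

set_option maxHeartbeats 1000000 in
/-- A hyperbolic distribution has adapted pairs around every point: they are columns of the Pfaffian
adjugates of the two degenerate forms in the pencil of the components of the Levi form. -/
theorem IsHyperbolic.exists_isAdapted {H : Subbundle 6 4 M} (hH : IsHyperbolic H) (x : M) :
    ∃ (U : Set M) (p m : Fin 2 → VField 6 M), x ∈ U ∧ IsAdapted H p m U := by
  obtain ⟨O, s, f, hf, hO, hxO, hs, hfs, ha, hc⟩ := hH.exists_frame x
  let w (r : Fin 6) (y : M) : Matrix (Fin 4) (Fin 4) ℝ :=
    Matrix.of fun i j => hf.coeff r y (mlieBracket (𝓡 6) (s i) (s j) y)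
  have hw : ∀ r i j, ContMDiffOn (𝓡 6) 𝓘(ℝ, ℝ) ∞ (fun y => w r y i j) O := fun r i j =>
    IsFrame.contMDiffOn_coeff hO hf ((hs i).smooth.mlieBracket hO (hs j).smooth) r
  have hskew : ∀ r y i j, w r y i j = -w r y j i := by
    intro r y i j
    simp only [w, Matrix.of_apply]
    rw [mlieBracket_swap_apply, map_neg]
  obtain ⟨U, hUO, hU, hxU, hUa, hUc⟩ : ∃ U ⊆ O, IsOpen U ∧ x ∈ U ∧
      (∀ y ∈ U, 0 < pfaffian (w 4 y)) ∧ ∀ y ∈ U, pfaffian (w 5 y) < 0 := by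
    have h1 := (contMDiffOn_pfaffian (hw 4)).continuousOn.isOpen_inter_preimage hO
      (isOpen_Ioi (a := (0 : ℝ)))
    have h2 := (contMDiffOn_pfaffian (hw 5)).continuousOn.isOpen_inter_preimage hO
      (isOpen_Iio (a := (0 : ℝ)))
    exact ⟨_, fun y hy => hy.1.1, h1.inter h2, ⟨⟨hxO, ha⟩, ⟨hxO, hc⟩⟩, fun y hy => hy.1.2,
      fun y hy => hy.2.2⟩
  have hD : ∀ y ∈ U, 0 < pfPolar (w 4 y) (w 5 y) ^ 2 - 4 * pfaffian (w 4 y) * pfaffian (w 5 y) := by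
    intro y hy
    nlinarith [sq_nonneg (pfPolar (w 4 y) (w 5 y)), mul_pos (hUa y hy) (neg_pos.2 (hUc y hy))]
  have hwU : ∀ r i j, ContMDiffOn (𝓡 6) 𝓘(ℝ, ℝ) ∞ (fun y => w r y i j) U := fun r i j =>
    (hw r i j).mono hUO
  have hsU : ∀ i, IsSection H U (s i) := fun i => (hs i).mono hUO
  -- for `ε = 1, -1` the degenerate forms of the pencil, which are `ψ ε ∘ L` in the frame `s`
  let W (ε : ℝ) (y : M) : Matrix (Fin 4) (Fin 4) ℝ := isotropic ε (w 4 y) (w 5 y)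
  have hW : ∀ ε i j, ContMDiffOn (𝓡 6) 𝓘(ℝ, ℝ) ∞ (fun y => W ε y i j) U := fun ε =>
    contMDiffOn_isotropic ε (hwU 4) (hwU 5) hD
  have hWs : ∀ ε y i j, W ε y i j = -W ε y j i := fun ε y =>
    isotropic_skew ε (hskew 4 y) (hskew 5 y)
  have hWp : ∀ ε : ℝ, ε ^ 2 = 1 → ∀ y ∈ U, pfaffian (W ε y) = 0 := fun ε hε y hy =>
    pfaffian_isotropic hε (hD y hy).le
  have hp1 := hWp 1 (by norm_num)
  have hm1 := hWp (-1) (by norm_num)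
  have hpol : ∀ y ∈ U, pfPolar (W 1 y) (W (-1) y) ≠ 0 := by
    intro y hy
    simp only [W]
    rw [pfPolar_isotropic (hD y hy).le]
    exact mul_ne_zero (mul_ne_zero (by norm_num) (hUa y hy).ne') (hD y hy).ne'
  have hfk : ∀ y ∈ U, ∀ (r : Fin 6) (k : Fin 4),
      hf.coeff r y (s k y) = if Fin.castAdd 2 k = r then 1 else 0 := by
    intro y hy r k
    rw [← hfs, hf.coeff_apply_of_mem (hUO hy), ← hf.toBasisAt_coe (hUO hy), Basis.repr_self,
      Finsupp.single_apply]
  let ψ (ε : ℝ) (y : M) : TangentSpace (𝓡 6) y →ₗ[ℝ] ℝ :=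
    (-pfPolar (w 4 y) (w 5 y) +
        ε * √(pfPolar (w 4 y) (w 5 y) ^ 2 - 4 * pfaffian (w 4 y) * pfaffian (w 5 y))) •
      hf.coeff 4 y + (2 * pfaffian (w 4 y)) • hf.coeff 5 y
  have hψs : ∀ ε, ∀ y ∈ U, ∀ k, ψ ε y (s k y) = 0 := by
    intro ε y hy k
    have h4 : Fin.castAdd 2 k ≠ (4 : Fin 6) := by fin_cases k <;> decide
    have h5 : Fin.castAdd 2 k ≠ (5 : Fin 6) := by fin_cases k <;> decide
    simp [ψ, hfk y hy, h4, h5]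
  have hψW : ∀ ε y, Matrix.of (fun k l => ψ ε y (mlieBracket (𝓡 6) (s k) (s l) y)) = W ε y := by
    intro ε y
    ext k l
    simp [ψ, W, isotropic, w]
  -- sections of the kernels of the two degenerate forms
  let S (ε : ℝ) (i : Fin 4) : VField 6 M := ∑ k, (fun z => pfAdj (W ε z) k i) • s k
  have hS : ∀ ε i y, S ε i y = ∑ k, pfAdj (W ε y) k i • s k y := fun ε i y =>
    Finset.sum_apply _ _ _
  have hadj : ∀ ε i j, ContMDiffOn (𝓡 6) 𝓘(ℝ, ℝ) ∞ (fun y => pfAdj (W ε y) i j) U := fun ε =>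
    contMDiffOn_pfAdj (hW ε)
  have hSsec : ∀ ε i, IsSection H U (S ε i) := by
    intro ε i
    refine ⟨SmoothOn.sum fun k _ => SmoothOn.smul (hadj ε k i) (hsU k).smooth, fun y hy => ?_⟩
    rw [hS]
    exact Submodule.sum_mem _ fun k _ => Submodule.smul_mem _ _ ((hsU k).mem y hy)
  have hbr : ∀ ε δ δ' : ℝ, ∀ y ∈ U, ∀ i j, ψ ε y (mlieBracket (𝓡 6) (S δ i) (S δ' j) y) =
      ((pfAdj (W δ y)).transpose * W ε y * pfAdj (W δ' y)) i j := by
    intro ε δ δ' y hy i j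
    rw [← hψW]
    exact map_mlieBracket_sum_sum hU hy (ψ ε y) (fun i => (hsU i).smooth) (hψs ε y hy)
      (hadj δ) (hadj δ') i j
  have hψS : ∀ ε δ, ∀ y ∈ U, ∀ i, ψ ε y (S δ i y) = 0 := by
    intro ε δ y hy i
    rw [hS, map_sum]
    exact Finset.sum_eq_zero fun k _ => by rw [map_smul, hψs ε y hy, smul_zero]
  have hmem : ∀ y ∈ U, ∀ t, ψ 1 y t = 0 → ψ (-1) y t = 0 → t ∈ H.fiber y := by
    intro y hy t h1 h2
    have hr := Real.sqrt_pos.2 (hD y hy)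
    simp only [ψ, LinearMap.add_apply, LinearMap.smul_apply, smul_eq_mul] at h1 h2
    have h4 : hf.coeff 4 y t = 0 := by
      refine (mul_eq_zero.1 ?_).resolve_left hr.ne'
      linarith
    have h5 : hf.coeff 5 y t = 0 := by
      rw [h4, mul_zero, zero_add] at h1
      exact (mul_eq_zero.1 h1).resolve_left (mul_pos two_pos (hUa y hy)).ne'
    rw [← IsFrame.sum_coeff hf (hUO hy) t, Fin.sum_univ_six, h4, h5, zero_smul, zero_smul,
      add_zero, add_zero]
    have hfm : ∀ k : Fin 4, f (Fin.castAdd 2 k) y ∈ H.fiber y := fun k => by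
      rw [hfs]; exact (hsU k).mem y hy
    exact add_mem (add_mem (add_mem (Submodule.smul_mem _ _ (hfm 0))
      (Submodule.smul_mem _ _ (hfm 1))) (Submodule.smul_mem _ _ (hfm 2)))
      (Submodule.smul_mem _ _ (hfm 3))
  have hpm : ∀ i j, ∀ y ∈ U, mlieBracket (𝓡 6) (S (-1) i) (S 1 j) y ∈ H.fiber y := by
    intro i j y hy
    refine hmem y hy _ ?_ ?_
    · rw [hbr _ _ _ y hy, mul_assoc, mul_pfAdj (hWs 1 y) (hp1 y hy)]; simp
    · rw [hbr _ _ _ y hy, transpose_pfAdj_mul (hWs (-1) y) (hm1 y hy)]; simp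
  obtain ⟨i₀, i₁, hi⟩ := exists_pfAdj_ne_zero (w := W (-1) x) (w' := W 1 x)
    (by rw [pfPolar_comm]; exact hpol x hxU)
  obtain ⟨j₀, j₁, hj⟩ := exists_pfAdj_ne_zero (hpol x hxU)
  let p : Fin 2 → VField 6 M := ![S (-1) i₀, S (-1) i₁]
  let m : Fin 2 → VField 6 M := ![S 1 j₀, S 1 j₁]
  have hp : ∀ i, IsSection H U (p i) := by intro i; fin_cases i <;> exact hSsec _ _
  have hm : ∀ i, IsSection H U (m i) := by intro i; fin_cases i <;> exact hSsec _ _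
  have hsm : ∀ i, SmoothOn (bracketFrame p m i) U := by
    intro i
    fin_cases i
    exacts [(hp 0).smooth, (hp 1).smooth, (hp 0).smooth.mlieBracket hU (hp 1).smooth,
      (hm 0).smooth, (hm 1).smooth, (hm 0).smooth.mlieBracket hU (hm 1).smooth]
  -- functionals `W ε (·, S δ j)` on the span of the fields `s`
  let A (ε δ : ℝ) (j : Fin 4) : TangentSpace (𝓡 6) x →ₗ[ℝ] ℝ :=
    ∑ k, (W ε x * pfAdj (W δ x)) k j • hf.coeff (Fin.castAdd 2 k) x
  have hA : ∀ ε δ δ' i j, A ε δ j (S δ' i x) =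
      ((pfAdj (W δ' x)).transpose * W ε x * pfAdj (W δ x)) i j := by
    intro ε δ δ' i j
    have h1 : ∀ k : Fin 4, hf.coeff (Fin.castAdd 2 k) x (S δ' i x) = pfAdj (W δ' x) k i := by
      intro k
      rw [hS, map_sum, Finset.sum_eq_single k]
      · rw [map_smul, hfk x hxU, if_pos rfl, smul_eq_mul, mul_one]
      · intro l _ hl
        rw [map_smul, hfk x hxU, if_neg fun h => hl (Fin.castAdd_inj.1 h), smul_zero]
      · simp
    simp only [A, LinearMap.sum_apply, LinearMap.smul_apply, h1, smul_eq_mul]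
    rw [Matrix.mul_assoc, Matrix.mul_apply]
    exact Finset.sum_congr rfl fun k _ => mul_comm _ _
  have e1 := transpose_pfAdj_mul_mul (hWs (-1) x) (hWs 1 x) (hm1 x hxU)
  have e2 := transpose_pfAdj_mul_mul (hWs 1 x) (hWs (-1) x) (hp1 x hxU)
  have e3 := transpose_pfAdj_mul (hWs (-1) x) (hm1 x hxU)
  have e4 := transpose_pfAdj_mul (hWs 1 x) (hp1 x hxU)
  have c1 := hpol x hxU
  have c2 : pfPolar (W (-1) x) (W 1 x) ≠ 0 := by rw [pfPolar_comm]; exact c1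
  have hdiag : ∀ (δ : ℝ) (i : Fin 4), pfAdj (W δ x) i i = 0 := by
    intro δ i
    fin_cases i <;> rfl
  have hanti : ∀ (δ : ℝ) (i j : Fin 4), pfAdj (W δ x) i j = -pfAdj (W δ x) j i := by
    intro δ i j
    have := congrFun (congrFun (pfAdj_transpose (W δ x)) j) i
    simpa using this
  have hind : LinearIndependent ℝ fun i => bracketFrame p m i x := by
    rw [Fintype.linearIndependent_iff]
    intro g hg
    rw [Fin.sum_univ_six] at hg
    simp only [bracketFrame, p, m] at hg
    change g 0 • S (-1) i₀ x + g 1 • S (-1) i₁ x +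
      g 2 • mlieBracket (𝓡 6) (S (-1) i₀) (S (-1) i₁) x + g 3 • S 1 j₀ x + g 4 • S 1 j₁ x +
      g 5 • mlieBracket (𝓡 6) (S 1 j₀) (S 1 j₁) x = 0 at hg
    have g2 : g 2 = 0 := by
      have := congrArg (ψ 1 x) hg
      simp only [map_add, map_smul, hψS _ _ x hxU, hbr _ _ _ x hxU, e1, e4] at this
      simpa [c1, hi] using this
    have g5 : g 5 = 0 := by
      have := congrArg (ψ (-1) x) hg
      simp only [map_add, map_smul, hψS _ _ x hxU, hbr _ _ _ x hxU, e2, e3] at this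
      simpa [c2, hj] using this
    rw [g2, g5, zero_smul, zero_smul, add_zero, add_zero] at hg
    have g0 : g 0 = 0 := by
      have := congrArg (A 1 (-1) i₁) hg
      simp only [map_add, map_smul, hA, e1, e4] at this
      simpa [c1, hi, hdiag] using this
    have g1 : g 1 = 0 := by
      have := congrArg (A 1 (-1) i₀) hg
      simp only [map_add, map_smul, hA, e1, e4] at this
      simpa [c1, hi, hdiag, hanti (-1) i₁ i₀] using this
    have g3 : g 3 = 0 := by
      have := congrArg (A (-1) 1 j₁) hg
      simp only [map_add, map_smul, hA, e2, e3] at this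
      simpa [c2, hj, hdiag] using this
    have g4 : g 4 = 0 := by
      have := congrArg (A (-1) 1 j₀) hg
      simp only [map_add, map_smul, hA, e2, e3] at this
      simpa [c2, hj, hdiag, hanti 1 j₁ j₀] using this
    intro i
    fin_cases i
    exacts [g0, g1, g2, g3, g4, g5]
  obtain ⟨V, hVU, hV, hxV, hfr⟩ := exists_isFrame hU hxU hsm hind
  refine ⟨V, p, m, hxV, hV, fun i => (hp i).mono hVU, fun i => (hm i).mono hVU, ?_, hfr⟩
  intro i j y hy
  fin_cases i <;> fin_cases j <;> exact hpm _ _ y (hVU hy)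

end Six

/-! ### Linear algebra of the splitting at a point -/

section Levi

variable {T : Type*} [AddCommGroup T] [Module ℝ T] {H : Submodule ℝ T}
  {L : H →ₗ[ℝ] H →ₗ[ℝ] T ⧸ H}

/-- A basis of `H` consisting of bases of two `L`-orthogonal planes on whose second exterior
powers `L` takes linearly independent values. -/
structure IsLeviFrame (L : H →ₗ[ℝ] H →ₗ[ℝ] T ⧸ H) (a b : Fin 2 → H) : Prop where
  levi_eq_zero : ∀ i j, L (a i) (b j) = 0
  span_eq_top : Submodule.span ℝ (Set.range a) ⊔ Submodule.span ℝ (Set.range b) = ⊤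
  indep : LinearIndependent ℝ ![L (a 0) (a 1), L (b 0) (b 1)]
  indep_left : LinearIndependent ℝ a
  indep_right : LinearIndependent ℝ b

theorem mem_span_range_two {W : Type*} [AddCommGroup W] [Module ℝ W] {a : Fin 2 → W} {v : W} :
    v ∈ Submodule.span ℝ (Set.range a) ↔ ∃ c d : ℝ, v = c • a 0 + d • a 1 := by
  rw [Submodule.mem_span_range_iff_exists_fun]
  constructor
  · rintro ⟨c, rfl⟩
    exact ⟨c 0, c 1, by rw [Fin.sum_univ_two]⟩
  · rintro ⟨c, d, rfl⟩
    exact ⟨![c, d], by simp [Fin.sum_univ_two]⟩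

theorem IsLeviFrame.symm (hL : ∀ v, L v v = 0) {a b : Fin 2 → H} (h : IsLeviFrame L a b) :
    IsLeviFrame L b a where
  levi_eq_zero i j := by rw [← LinearMap.IsAlt.neg hL, h.levi_eq_zero, neg_zero]
  span_eq_top := by rw [sup_comm]; exact h.span_eq_top
  indep := by
    have := LinearIndependent.pair_symm_iff.1 h.indep
    exact this
  indep_left := h.indep_right
  indep_right := h.indep_left

theorem IsLeviFrame.exists_coeff {a b : Fin 2 → H} (h : IsLeviFrame L a b) (v : H) :
    ∃ c d c' d' : ℝ, v = (c • a 0 + d • a 1) + (c' • b 0 + d' • b 1) := by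
  have hv : v ∈ Submodule.span ℝ (Set.range a) ⊔ Submodule.span ℝ (Set.range b) := by
    rw [h.span_eq_top]; trivial
  obtain ⟨y, hy, z, hz, rfl⟩ := Submodule.mem_sup.1 hv
  obtain ⟨c, d, rfl⟩ := mem_span_range_two.1 hy
  obtain ⟨c', d', rfl⟩ := mem_span_range_two.1 hz
  exact ⟨c, d, c', d', rfl⟩

/-- `L` on a plane is the determinant times a fixed vector. -/
theorem levi_comb (hL : ∀ v, L v v = 0) (a : Fin 2 → H) (c d c' d' : ℝ) :
    L (c • a 0 + d • a 1) (c' • a 0 + d' • a 1) = (c * d' - d * c') • L (a 0) (a 1) := by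
  have h : L (a 1) (a 0) = -L (a 0) (a 1) := (LinearMap.IsAlt.neg hL _ _).symm
  simp only [map_add, map_smul, LinearMap.add_apply, LinearMap.smul_apply, hL, h]
  module

theorem IsLeviFrame.levi_cross {a b : Fin 2 → H} (h : IsLeviFrame L a b) {v w : H}
    (hv : v ∈ Submodule.span ℝ (Set.range a)) (hw : w ∈ Submodule.span ℝ (Set.range b)) :
    L v w = 0 := by
  obtain ⟨c, d, rfl⟩ := mem_span_range_two.1 hv
  obtain ⟨c', d', rfl⟩ := mem_span_range_two.1 hw
  simp [h.levi_eq_zero]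

/-- A vector `v` of one plane of a Levi frame has `L(v, H)` of dimension at most one, whereas this
dimension is two for a vector with components in both planes of another Levi frame. -/
theorem IsLeviFrame.span_le (hL : ∀ v, L v v = 0) {a b a' b' : Fin 2 → H}
    (h : IsLeviFrame L a b) (h' : IsLeviFrame L a' b') :
    Submodule.span ℝ (Set.range a') ≤ Submodule.span ℝ (Set.range a) ∨
      Submodule.span ℝ (Set.range a') ≤ Submodule.span ℝ (Set.range b) := by
  -- a functional for which the form `ψ ∘ L` has kernel `span a'`
  obtain ⟨ψ, hψ0, hψ1⟩ : ∃ ψ : T ⧸ H →ₗ[ℝ] ℝ, ψ (L (a' 0) (a' 1)) = 0 ∧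
      ψ (L (b' 0) (b' 1)) ≠ 0 := by
    have hnot : L (b' 0) (b' 1) ∉ Submodule.span ℝ {L (a' 0) (a' 1)} := by
      intro hmem
      obtain ⟨c, hc⟩ := Submodule.mem_span_singleton.1 hmem
      have := LinearIndependent.pair_iff.1 h'.indep c (-1) (by rw [hc]; simp)
      simp at this
    obtain ⟨ψ, h1, h2⟩ := Submodule.exists_dual_map_eq_bot_of_notMem hnot inferInstance
    refine ⟨ψ, ?_, h1⟩
    have : ψ (L (a' 0) (a' 1)) ∈ Submodule.map ψ (Submodule.span ℝ {L (a' 0) (a' 1)}) :=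
      Submodule.mem_map_of_mem (Submodule.mem_span_singleton_self _)
    rwa [h2, Submodule.mem_bot] at this
  have hker : ∀ v ∈ Submodule.span ℝ (Set.range a'), ∀ w, ψ (L v w) = 0 := by
    intro v hv w
    obtain ⟨c, d, c', d', rfl⟩ := h'.exists_coeff w
    have hw : c' • b' 0 + d' • b' 1 ∈ Submodule.span ℝ (Set.range b') :=
      mem_span_range_two.2 ⟨_, _, rfl⟩
    rw [map_add, h'.levi_cross hv hw, add_zero]
    obtain ⟨e, f, rfl⟩ := mem_span_range_two.1 hv
    rw [levi_comb hL, map_smul, hψ0, smul_zero]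
  have hab : ψ (L (a 0) (a 1)) ≠ 0 ∨ ψ (L (b 0) (b 1)) ≠ 0 := by
    by_contra! h0
    refine hψ1 ?_
    obtain ⟨c, d, e, f, hv⟩ := h.exists_coeff (b' 0)
    obtain ⟨c', d', e', f', hw⟩ := h.exists_coeff (b' 1)
    have hs1 : ∀ r s : ℝ, r • a 0 + s • a 1 ∈ Submodule.span ℝ (Set.range a) := fun r s =>
      mem_span_range_two.2 ⟨_, _, rfl⟩
    have hs2 : ∀ r s : ℝ, r • b 0 + s • b 1 ∈ Submodule.span ℝ (Set.range b) := fun r s =>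
      mem_span_range_two.2 ⟨_, _, rfl⟩
    rw [hv, hw]
    simp only [map_add (L _) (_ + _) (_ + _), map_add L (_ + _) (_ + _), LinearMap.add_apply]
    rw [h.levi_cross (hs1 _ _) (hs2 _ _), (h.symm hL).levi_cross (hs2 _ _) (hs1 _ _),
      levi_comb hL, levi_comb hL]
    simp [h0.1, h0.2]
  rcases hab with hx | hy
  · right
    intro v hv
    obtain ⟨c, d, c', d', hvc⟩ := h.exists_coeff v
    have h1 := hker v hv (a 1)
    have h2 := hker v hv (a 0)
    have e1 : L (a 1) (a 0) = -L (a 0) (a 1) := (LinearMap.IsAlt.neg hL _ _).symm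
    simp only [hvc, map_add, map_smul, LinearMap.add_apply, LinearMap.smul_apply, hL,
      (h.symm hL).levi_eq_zero, e1, smul_zero, add_zero, zero_add, map_neg,
      smul_eq_mul, mul_neg, neg_eq_zero] at h1 h2
    rw [hvc, (mul_eq_zero.1 h1).resolve_right hx, (mul_eq_zero.1 h2).resolve_right hx]
    exact mem_span_range_two.2 ⟨c', d', by simp⟩
  · left
    intro v hv
    obtain ⟨c, d, c', d', hvc⟩ := h.exists_coeff v
    have h1 := hker v hv (b 1)
    have h2 := hker v hv (b 0)
    have e1 : L (b 1) (b 0) = -L (b 0) (b 1) := (LinearMap.IsAlt.neg hL _ _).symm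
    simp only [hvc, map_add, map_smul, LinearMap.add_apply, LinearMap.smul_apply, hL,
      h.levi_eq_zero, e1, smul_zero, add_zero, zero_add, map_neg,
      smul_eq_mul, mul_neg, neg_eq_zero] at h1 h2
    rw [hvc, (mul_eq_zero.1 h1).resolve_right hy, (mul_eq_zero.1 h2).resolve_right hy]
    exact mem_span_range_two.2 ⟨c, d, by simp⟩

theorem span_range_eq_of_le {W : Type*} [AddCommGroup W] [Module ℝ W] {a b : Fin 2 → W}
    (ha : LinearIndependent ℝ a) (hb : LinearIndependent ℝ b)
    (h : Submodule.span ℝ (Set.range a) ≤ Submodule.span ℝ (Set.range b)) :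
    Submodule.span ℝ (Set.range a) = Submodule.span ℝ (Set.range b) := by
  have : FiniteDimensional ℝ (Submodule.span ℝ (Set.range b)) :=
    FiniteDimensional.span_of_finite ℝ (Set.finite_range b)
  exact Submodule.eq_of_le_of_finrank_eq h (by
    rw [finrank_span_eq_card ha, finrank_span_eq_card hb])

/-- The unordered pair of planes of a Levi frame is unique. -/
theorem IsLeviFrame.unique (hL : ∀ v, L v v = 0) {a b a' b' : Fin 2 → H}
    (h : IsLeviFrame L a b) (h' : IsLeviFrame L a' b') :
    (Submodule.span ℝ (Set.range a') = Submodule.span ℝ (Set.range a) ∧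
      Submodule.span ℝ (Set.range b') = Submodule.span ℝ (Set.range b)) ∨
    (Submodule.span ℝ (Set.range a') = Submodule.span ℝ (Set.range b) ∧
      Submodule.span ℝ (Set.range b') = Submodule.span ℝ (Set.range a)) := by
  have key : ∀ c d : Fin 2 → H, IsLeviFrame L c d → Submodule.span ℝ (Set.range c) ≠ ⊤ := by
    intro c d hcd htop
    have : L (d 0) (d 1) = 0 :=
      hcd.levi_cross (by rw [htop]; trivial) (Submodule.subset_span ⟨1, rfl⟩)
    exact hcd.indep.ne_zero 1 this
  have ht := h'.span_eq_top
  rcases h.span_le hL h' with h1 | h1 <;> rcases h.span_le hL (h'.symm hL) with h2 | h2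
  · exact absurd (top_le_iff.1 (ht ▸ sup_le h1 h2)) (key a b h)
  · exact Or.inl ⟨span_range_eq_of_le h'.indep_left h.indep_left h1,
      span_range_eq_of_le h'.indep_right h.indep_right h2⟩
  · exact Or.inr ⟨span_range_eq_of_le h'.indep_left h.indep_right h1,
      span_range_eq_of_le h'.indep_right h.indep_left h2⟩
  · exact absurd (top_le_iff.1 (ht ▸ sup_le h1 h2)) (key b a (h.symm hL))

end Levi

section Orientation

variable {V : Type*} [AddCommGroup V] [Module ℝ V] {o : Orientation ℝ V (Fin 6)}

theorem IsPositive.linearIndependent {v : Fin 6 → V} (h : IsPositive o v) :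
    LinearIndependent ℝ v := by
  obtain ⟨b, rfl, -⟩ := h
  exact b.linearIndependent

/-- Exchanging two blocks of three vectors reverses the orientation. -/
theorem det_swap_blocks (b : Basis (Fin 6) ℝ V) (a₀ a₁ a₂ b₀ b₁ b₂ : V) :
    b.det ![b₀, b₁, b₂, a₀, a₁, a₂] = -b.det ![a₀, a₁, a₂, b₀, b₁, b₂] := by
  let σ : Equiv.Perm (Fin 6) := finRotate 6 ^ 3
  have hσ : Equiv.Perm.sign σ = -1 := by decide
  have h := b.det.map_perm ![a₀, a₁, a₂, b₀, b₁, b₂] σ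
  have e : ![a₀, a₁, a₂, b₀, b₁, b₂] ∘ σ = ![b₀, b₁, b₂, a₀, a₁, a₂] := by
    ext i
    fin_cases i <;> rfl
  rw [← e, h, hσ]
  simp

theorem IsPositive.not_swap {a₀ a₁ a₂ b₀ b₁ b₂ : V} (h : IsPositive o ![a₀, a₁, a₂, b₀, b₁, b₂]) :
    ¬IsPositive o ![b₀, b₁, b₂, a₀, a₁, a₂] := by
  obtain ⟨b, hb, -⟩ := id h
  rw [isPositive_iff_det h b, det_swap_blocks b a₀ a₁ a₂ b₀ b₁ b₂, ← hb, b.det_self]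
  norm_num

theorem isPositive_or_swap {e : Fin 6 → V} (he : IsPositive o e) {a₀ a₁ a₂ b₀ b₁ b₂ : V}
    (h : LinearIndependent ℝ ![a₀, a₁, a₂, b₀, b₁, b₂]) :
    IsPositive o ![a₀, a₁, a₂, b₀, b₁, b₂] ∨ IsPositive o ![b₀, b₁, b₂, a₀, a₁, a₂] := by
  obtain ⟨b, rfl, -⟩ := id he
  rw [isPositive_iff_det he b, isPositive_iff_det he b, det_swap_blocks b a₀ a₁ a₂ b₀ b₁ b₂, b.det_self, one_mul,
    one_mul, neg_pos, or_comm, ← ne_iff_lt_or_gt]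
  have : FiniteDimensional ℝ V := Module.Basis.finiteDimensional_of_finite b
  exact ((b.is_basis_iff_det).1 ⟨h, h.span_eq_top_of_card_eq_finrank' (by
    rw [Module.finrank_eq_card_basis b])⟩).ne_zero

/-- Changing the bases of two planes changes the orientation of the induced frame by a square. -/
theorem IsPositive.change {a₀ a₁ a₂ b₀ b₁ b₂ h h' : V}
    (hpos : IsPositive o ![a₀, a₁, a₂, b₀, b₁, b₂]) {c d e f c' d' e' f' : ℝ}
    (hA : c * f - d * e ≠ 0) (hB : c' * f' - d' * e' ≠ 0)
    (hh : ∃ r s r' s' : ℝ, h = r • a₀ + s • a₁ + (r' • b₀ + s' • b₁))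
    (hh' : ∃ r s r' s' : ℝ, h' = r • a₀ + s • a₁ + (r' • b₀ + s' • b₁)) :
    IsPositive o ![c • a₀ + d • a₁, e • a₀ + f • a₁, (c * f - d * e) • a₂ + h,
      c' • b₀ + d' • b₁, e' • b₀ + f' • b₁, (c' * f' - d' * e') • b₂ + h'] := by
  obtain ⟨r, s, r', s', rfl⟩ := hh
  obtain ⟨u, v, u', v', rfl⟩ := hh'
  obtain ⟨b, hb, -⟩ := id hpos
  rw [isPositive_iff_det hpos b, ← hb, b.det_self, one_mul, b.det_apply]
  have e0 : a₀ = b 0 := by rw [hb]; rfl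
  have e1 : a₁ = b 1 := by rw [hb]; rfl
  have e2 : a₂ = b 2 := by rw [hb]; rfl
  have e3 : b₀ = b 3 := by rw [hb]; rfl
  have e4 : b₁ = b 4 := by rw [hb]; rfl
  have e5 : b₂ = b 5 := by rw [hb]; rfl
  have hM : b.toMatrix ![c • a₀ + d • a₁, e • a₀ + f • a₁,
      (c * f - d * e) • a₂ + (r • a₀ + s • a₁ + (r' • b₀ + s' • b₁)),
      c' • b₀ + d' • b₁, e' • b₀ + f' • b₁,
      (c' * f' - d' * e') • b₂ + (u • a₀ + v • a₁ + (u' • b₀ + v' • b₁))] =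
      !![c, e, r, 0, 0, u;
        d, f, s, 0, 0, v;
        0, 0, c * f - d * e, 0, 0, 0;
        0, 0, r', c', e', u';
        0, 0, s', d', f', v';
        0, 0, 0, 0, 0, c' * f' - d' * e'] := by
    rw [e0, e1, e2, e3, e4, e5]
    ext i j
    fin_cases j <;> fin_cases i <;>
      simp [Basis.toMatrix_apply]
  rw [hM]
  -- after permuting rows and columns the matrix is block triangular
  have hdet : Matrix.det !![c, e, r, 0, 0, u;
        d, f, s, 0, 0, v;
        0, 0, c * f - d * e, 0, 0, 0;
        0, 0, r', c', e', u';
        0, 0, s', d', f', v';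
        0, 0, 0, 0, 0, c' * f' - d' * e'] =
      (c * f - d * e) ^ 2 * (c' * f' - d' * e') ^ 2 := by
    rw [Matrix.det_succ_row _ 5]
    simp [Fin.sum_univ_succ, Matrix.det_succ_row_zero, Fin.succAbove]
    ring
  rw [hdet]
  positivity

end Orientation

/-! ### The canonical splitting -/

section LeviForm

variable {n k : ℕ} {M : Type*} [TopologicalSpace M]
  [ChartedSpace (EuclideanSpace ℝ (Fin n)) M] [IsManifold (𝓡 n) ∞ M]

theorem leviForm_self (H : Subbundle n k M) (x : M) (v : H.fiber x) : leviForm H x v v = 0 := by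
  obtain ⟨ξ, hξ, hv⟩ := exists_isSection_eq H x v
  have h := leviForm_apply H (isOpen_frameNhd H x) hξ hξ (mem_frameNhd H x)
  have hv' : (⟨ξ x, hξ.mem x (mem_frameNhd H x)⟩ : H.fiber x) = v := Subtype.ext hv
  rw [hv'] at h
  rw [h, mlieBracket_self]
  simp

end LeviForm

section Six

variable {M : Type*} [TopologicalSpace M]
  [ChartedSpace (EuclideanSpace ℝ (Fin 6)) M] [IsManifold (𝓡 6) ∞ M]
  {H : Subbundle 6 4 M} {p m p' m' : Fin 2 → VField 6 M} {U U' : Set M} {y : M}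

omit [IsManifold (𝓡 6) ∞ M] in
theorem bracketFrame_apply (p m : Fin 2 → VField 6 M) (y : M) :
    (fun i => bracketFrame p m i y) = ![p 0 y, p 1 y, mlieBracket (𝓡 6) (p 0) (p 1) y,
      m 0 y, m 1 y, mlieBracket (𝓡 6) (m 0) (m 1) y] := by
  funext i
  fin_cases i <;> rfl

theorem IsAdapted.mono (h : IsAdapted H p m U) (hU' : IsOpen U') (hU : U' ⊆ U) :
    IsAdapted H p m U' where
  isOpen := hU'
  left i := (h.left i).mono hU
  right i := (h.right i).mono hU
  bracket_mem i j y hy := h.bracket_mem i j y (hU hy)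
  isFrame := IsLocalFrameOn.mono h.isFrame hU

theorem IsAdapted.symm (h : IsAdapted H p m U) : IsAdapted H m p U where
  isOpen := h.isOpen
  left := h.right
  right := h.left
  bracket_mem i j y hy := by
    rw [mlieBracket_swap_apply]
    exact neg_mem (h.bracket_mem j i y hy)
  isFrame := by
    -- rotation by three places exchanges the two halves of the frame
    let σ : Equiv.Perm (Fin 6) := finRotate 6 ^ 3
    have e : ∀ i, bracketFrame m p i = bracketFrame p m (σ i) := by
      intro i
      fin_cases i <;> rfl
    refine ⟨fun {y} hy => ?_, fun {y} hy => ?_, fun i => ?_⟩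
    · simp only [e]
      exact (h.isFrame.linearIndependent hy).comp σ σ.injective
    · simp only [e]
      have : Set.range (fun i => bracketFrame p m (σ i) y) =
          Set.range (fun i => bracketFrame p m i y) :=
        σ.surjective.range_comp (fun i => bracketFrame p m i y)
      rw [this]
      exact h.isFrame.generating hy
    · rw [e]
      exact h.isFrame.contMDiffOn _

/-- The values of an adapted pair form a Levi frame. That they span `H` follows by counting
dimensions. -/
theorem IsAdapted.isLeviFrame (h : IsAdapted H p m U) (hy : y ∈ U) :
    IsLeviFrame (leviForm H y) (fun i => ⟨p i y, (h.left i).mem y hy⟩)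
      (fun i => ⟨m i y, (h.right i).mem y hy⟩) := by
  have hind := h.isFrame.linearIndependent hy
  have hp : LinearIndependent ℝ (fun i : Fin 2 => (⟨p i y, (h.left i).mem y hy⟩ : H.fiber y)) := by
    refine LinearIndependent.of_comp (H.fiber y).subtype ?_
    have := hind.comp (![0, 1] : Fin 2 → Fin 6) (by decide)
    convert! this using 1
    funext i
    fin_cases i <;> rfl
  have hm : LinearIndependent ℝ (fun i : Fin 2 => (⟨m i y, (h.right i).mem y hy⟩ : H.fiber y)) := by
    refine LinearIndependent.of_comp (H.fiber y).subtype ?_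
    have := hind.comp (![3, 4] : Fin 2 → Fin 6) (by decide)
    convert! this using 1
    funext i
    fin_cases i <;> rfl
  have hspan : Submodule.span ℝ (Set.range fun i : Fin 2 =>
        (⟨p i y, (h.left i).mem y hy⟩ : H.fiber y)) ⊔
      Submodule.span ℝ (Set.range fun i : Fin 2 =>
        (⟨m i y, (h.right i).mem y hy⟩ : H.fiber y)) = ⊤ := by
    let v : Fin 4 → H.fiber y := ![⟨p 0 y, (h.left 0).mem y hy⟩, ⟨p 1 y, (h.left 1).mem y hy⟩,
      ⟨m 0 y, (h.right 0).mem y hy⟩, ⟨m 1 y, (h.right 1).mem y hy⟩]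
    have hv : LinearIndependent ℝ v := by
      refine LinearIndependent.of_comp (H.fiber y).subtype ?_
      have := hind.comp (![0, 1, 3, 4] : Fin 4 → Fin 6) (by decide)
      convert! this using 1
      funext i
      fin_cases i <;> rfl
    have : FiniteDimensional ℝ (H.fiber y) :=
      Module.Basis.finiteDimensional_of_finite (fiberBasis H y)
    have htop := hv.span_eq_top_of_card_eq_finrank' (by
      rw [Module.finrank_eq_card_basis (fiberBasis H y)])
    rw [eq_top_iff, ← htop, Submodule.span_le]
    rintro _ ⟨i, rfl⟩
    fin_cases i
    exacts [Submodule.mem_sup_left (Submodule.subset_span ⟨0, rfl⟩),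
      Submodule.mem_sup_left (Submodule.subset_span ⟨1, rfl⟩),
      Submodule.mem_sup_right (Submodule.subset_span ⟨0, rfl⟩),
      Submodule.mem_sup_right (Submodule.subset_span ⟨1, rfl⟩)]
  refine ⟨fun i j => ?_, hspan, ?_, hp, hm⟩
  · rw [leviForm_apply H h.isOpen (h.left i) (h.right j) hy, Submodule.mkQ_apply,
      Submodule.Quotient.mk_eq_zero]
    exact h.bracket_mem i j y hy
  · rw [leviForm_apply H h.isOpen (h.left 0) (h.left 1) hy,
      leviForm_apply H h.isOpen (h.right 0) (h.right 1) hy, LinearIndependent.pair_iff]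
    intro s t hst
    rw [← map_smul, ← map_smul, ← map_add, Submodule.mkQ_apply,
      Submodule.Quotient.mk_eq_zero] at hst
    have hmem : (⟨_, hst⟩ : H.fiber y) ∈ (⊤ : Submodule ℝ (H.fiber y)) := trivial
    rw [← hspan] at hmem
    obtain ⟨a, ha, b, hb, hab⟩ := Submodule.mem_sup.1 hmem
    obtain ⟨c, d, rfl⟩ := mem_span_range_two.1 ha
    obtain ⟨e, f, rfl⟩ := mem_span_range_two.1 hb
    have hab' := congrArg Subtype.val hab
    simp only [Submodule.coe_add, Submodule.coe_smul] at hab'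
    have h0 := Fintype.linearIndependent_iff.1 hind ![c, d, -s, e, f, -t] (by
      rw [Fin.sum_univ_six]
      change c • p 0 y + d • p 1 y + (-s) • mlieBracket (𝓡 6) (p 0) (p 1) y + e • m 0 y +
        f • m 1 y + (-t) • mlieBracket (𝓡 6) (m 0) (m 1) y = 0
      rw [neg_smul, neg_smul, ← sub_eq_zero.2 hab']
      abel)
    exact ⟨neg_eq_zero.1 (h0 2), neg_eq_zero.1 (h0 5)⟩

/-- The span at `y` of a pair of fields. -/
def planeAt (p : Fin 2 → VField 6 M) (y : M) : Submodule ℝ (TangentSpace (𝓡 6) y) :=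
  Submodule.span ℝ (Set.range fun i => p i y)

omit [IsManifold (𝓡 6) ∞ M] in
theorem mem_planeAt {v : TangentSpace (𝓡 6) y} :
    v ∈ planeAt p y ↔ ∃ c d : ℝ, v = c • p 0 y + d • p 1 y :=
  mem_span_range_two

theorem planeAt_eq_map (h : ∀ i, p i y ∈ H.fiber y) : planeAt p y =
    (Submodule.span ℝ (Set.range fun i => (⟨p i y, h i⟩ : H.fiber y))).map (H.fiber y).subtype := by
  rw [Submodule.map_span, ← Set.range_comp]
  rfl

theorem planeAt_congr {p' : Fin 2 → VField 6 M} (h : ∀ i, p i y ∈ H.fiber y)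
    (h' : ∀ i, p' i y ∈ H.fiber y) : planeAt p y = planeAt p' y ↔
      Submodule.span ℝ (Set.range fun i => (⟨p i y, h i⟩ : H.fiber y)) =
        Submodule.span ℝ (Set.range fun i => (⟨p' i y, h' i⟩ : H.fiber y)) := by
  rw [planeAt_eq_map h, planeAt_eq_map h']
  exact (Submodule.map_injective_of_injective (H.fiber y).injective_subtype).eq_iff

/-- Positivity of the frame of an adapted pair passes to all sections of its two planes. -/
theorem IsAdapted.isPositive (h : IsAdapted H p m U)
    {o : Orientation ℝ (TangentSpace (𝓡 6) y) (Fin 6)}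
    (hy : y ∈ U) (hpos : IsPositive o fun i => bracketFrame p m i y) {ξ₁ ξ₂ η₁ η₂ : VField 6 M}
    {V : Set M} (hV : IsOpen V) (hyV : y ∈ V) (hξ₁ : IsSection H V ξ₁) (hξ₂ : IsSection H V ξ₂)
    (hη₁ : IsSection H V η₁) (hη₂ : IsSection H V η₂)
    (hp₁ : ξ₁ y ∈ planeAt p y) (hp₂ : ξ₂ y ∈ planeAt p y)
    (hm₁ : η₁ y ∈ planeAt m y) (hm₂ : η₂ y ∈ planeAt m y)
    (hξ : LinearIndependent ℝ ![ξ₁ y, ξ₂ y]) (hη : LinearIndependent ℝ ![η₁ y, η₂ y]) :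
    IsPositive o ![ξ₁ y, ξ₂ y, mlieBracket (𝓡 6) ξ₁ ξ₂ y, η₁ y, η₂ y,
      mlieBracket (𝓡 6) η₁ η₂ y] := by
  have hL := h.isLeviFrame hy
  rw [bracketFrame_apply] at hpos
  have hdet : ∀ (q : Fin 2 → VField 6 M) (hq : ∀ i, IsSection H U (q i)) (ζ₁ ζ₂ : VField 6 M),
      IsSection H V ζ₁ → IsSection H V ζ₂ → ζ₁ y ∈ planeAt q y → ζ₂ y ∈ planeAt q y →
      LinearIndependent ℝ ![ζ₁ y, ζ₂ y] → ∃ c d e f : ℝ, c * f - d * e ≠ 0 ∧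
        ζ₁ y = c • q 0 y + d • q 1 y ∧ ζ₂ y = e • q 0 y + f • q 1 y ∧
        mlieBracket (𝓡 6) ζ₁ ζ₂ y - (c * f - d * e) • mlieBracket (𝓡 6) (q 0) (q 1) y ∈
          H.fiber y := by
    intro q hq ζ₁ ζ₂ h₁ h₂ hq₁ hq₂ hζ
    obtain ⟨c, d, hcd⟩ := mem_planeAt.1 hq₁
    obtain ⟨e, f, hef⟩ := mem_planeAt.1 hq₂
    refine ⟨c, d, e, f, ?_, hcd, hef, ?_⟩
    · intro h0
      rw [LinearIndependent.pair_iff] at hζ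
      have h1 := hζ f (-d) (by
        rw [hcd, hef, show f • (c • q 0 y + d • q 1 y) + (-d) • (e • q 0 y + f • q 1 y) =
          (c * f - d * e) • q 0 y by module, h0, zero_smul])
      have h2 := hζ e (-c) (by
        rw [hcd, hef, show e • (c • q 0 y + d • q 1 y) + (-c) • (e • q 0 y + f • q 1 y) =
          -((c * f - d * e) • q 1 y) by module, h0, zero_smul, neg_zero])
      have hc : c = 0 := by linarith [h2.2]
      have hd : d = 0 := by linarith [h1.2]
      have := hζ 1 0 (by rw [hcd, hc, hd]; simp)
      exact one_ne_zero this.1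
    · rw [← Submodule.Quotient.mk_eq_zero, ← Submodule.mkQ_apply, map_sub, map_smul,
        ← leviForm_apply H hV h₁ h₂ hyV, ← leviForm_apply H h.isOpen (hq 0) (hq 1) hy, sub_eq_zero,
        ← levi_comb (leviForm_self H y)
          (fun i => (⟨q i y, (hq i).mem y hy⟩ : H.fiber y)) c d e f]
      congr 1
      · congr 1
        exact Subtype.ext hcd
      · exact Subtype.ext hef
  have hmem : ∀ v ∈ H.fiber y, ∃ r s r' s' : ℝ, v = r • p 0 y + s • p 1 y +
      (r' • m 0 y + s' • m 1 y) := by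
    intro v hv
    obtain ⟨r, s, r', s', hv'⟩ := hL.exists_coeff ⟨v, hv⟩
    exact ⟨r, s, r', s', congrArg Subtype.val hv'⟩
  obtain ⟨c, d, e, f, hA, hcd, hef, hh⟩ := hdet p h.left ξ₁ ξ₂ hξ₁ hξ₂ hp₁ hp₂ hξ
  obtain ⟨c', d', e', f', hB, hcd', hef', hh'⟩ := hdet m h.right η₁ η₂ hη₁ hη₂ hm₁ hm₂ hη
  have := hpos.change hA hB (hmem _ hh) (hmem _ hh')
  rwa [add_sub_cancel, add_sub_cancel, ← hcd, ← hef, ← hcd', ← hef'] at this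

/-- Two positive adapted pairs span the same ordered pair of planes. -/
theorem IsAdapted.planeAt_eq (h : IsAdapted H p m U) (h' : IsAdapted H p' m' U') (hy : y ∈ U)
    (hy' : y ∈ U') {o : Orientation ℝ (TangentSpace (𝓡 6) y) (Fin 6)}
    (hpos : IsPositive o fun i => bracketFrame p m i y)
    (hpos' : IsPositive o fun i => bracketFrame p' m' i y) :
    planeAt p' y = planeAt p y ∧ planeAt m' y = planeAt m y := by
  rcases (h.isLeviFrame hy).unique (leviForm_self H y) (h'.isLeviFrame hy') with h1 | h1
  · exact ⟨(planeAt_congr _ _).2 h1.1, (planeAt_congr _ _).2 h1.2⟩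
  · exfalso
    have e1 := (planeAt_congr (fun i => (h'.left i).mem y hy') _).2 h1.1
    have e2 := (planeAt_congr (fun i => (h'.right i).mem y hy') _).2 h1.2
    have hmem : ∀ (q : Fin 2 → VField 6 M) i, q i y ∈ planeAt q y := fun q i =>
      Submodule.subset_span ⟨i, rfl⟩
    have hl : ∀ {q r : Fin 2 → VField 6 M}, IsAdapted H q r U' →
        LinearIndependent ℝ ![q 0 y, q 1 y] := by
      intro q r hq
      have := (hq.isFrame.linearIndependent hy').comp (![0, 1] : Fin 2 → Fin 6) (by decide)
      convert! this using 1
      funext i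
      fin_cases i <;> rfl
    have := h.isPositive hy hpos h'.isOpen hy' (h'.right 0) (h'.right 1) (h'.left 0) (h'.left 1)
      (e2 ▸ hmem m' 0) (e2 ▸ hmem m' 1) (e1 ▸ hmem p' 0) (e1 ▸ hmem p' 1) (hl h'.symm) (hl h')
    rw [bracketFrame_apply] at hpos'
    exact hpos'.not_swap this

/-- Around every point there is a positively oriented adapted pair. -/
theorem IsHyperbolic.exists_isPositive (hH : IsHyperbolic H) (o : MfdOrientation 6 M) (x : M) :
    ∃ (U : Set M) (p m : Fin 2 → VField 6 M), x ∈ U ∧ IsAdapted H p m U ∧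
      ∀ y ∈ U, IsPositive (o.orient y) fun i => bracketFrame p m i y := by
  obtain ⟨U, p, m, hx, h⟩ := hH.exists_isAdapted x
  have key : ∀ p m : Fin 2 → VField 6 M, IsAdapted H p m U →
      IsPositive (o.orient x) (fun i => bracketFrame p m i x) →
      ∃ (U : Set M) (p m : Fin 2 → VField 6 M), x ∈ U ∧ IsAdapted H p m U ∧
        ∀ y ∈ U, IsPositive (o.orient y) fun i => bracketFrame p m i y := by
    intro p m h hpos
    obtain ⟨V, hVU, hV, hxV, hpos'⟩ :=
      CodimTwo.exists_isPositive o h.isOpen hx h.isFrame.contMDiffOn hpos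
    exact ⟨V, p, m, hxV, h.mono hV hVU, hpos'⟩
  obtain ⟨O, -, hxO, s, -, hs⟩ := o.exists_frame x
  have hind := h.isFrame.linearIndependent hx
  rw [show (fun i => bracketFrame p m i x) = _ from bracketFrame_apply p m x] at hind
  rcases isPositive_or_swap (hs x hxO) hind with h1 | h1
  · exact key p m h (by rw [bracketFrame_apply]; exact h1)
  · exact key m p h.symm (by rw [bracketFrame_apply]; exact h1)

/-- `Hp` and `Hm` are locally spanned by adapted pairs. This is what a canonical splitting amounts
to when its order is disregarded. -/
def IsSplitting (H : Subbundle 6 4 M) (Hp Hm : Subbundle 6 2 M) : Prop :=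
  ∀ x, ∃ (U : Set M) (p m : Fin 2 → VField 6 M), x ∈ U ∧ IsAdapted H p m U ∧
    (∀ y ∈ U, Hp.fiber y = planeAt p y) ∧ ∀ y ∈ U, Hm.fiber y = planeAt m y

theorem IsSplitting.symm {Hp Hm : Subbundle 6 2 M} (h : IsSplitting H Hp Hm) :
    IsSplitting H Hm Hp := fun x =>
  let ⟨U, p, m, hx, ha, h1, h2⟩ := h x
  ⟨U, m, p, hx, ha.symm, h2, h1⟩

theorem IsAdapted.sup_planeAt (h : IsAdapted H p m U) (hy : y ∈ U) :
    planeAt p y ⊔ planeAt m y = H.fiber y := by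
  rw [planeAt_eq_map (fun i => (h.left i).mem y hy), planeAt_eq_map (fun i => (h.right i).mem y hy),
    ← Submodule.map_sup, (h.isLeviFrame hy).span_eq_top, Submodule.map_top, Submodule.range_subtype]

theorem IsAdapted.eq_zero_of_comb (h : IsAdapted H p m U) (hy : y ∈ U) {c : Fin 6 → ℝ}
    (hc : c 0 • p 0 y + c 1 • p 1 y + c 2 • mlieBracket (𝓡 6) (p 0) (p 1) y +
      (c 3 • m 0 y + c 4 • m 1 y + c 5 • mlieBracket (𝓡 6) (m 0) (m 1) y) = 0) : c = 0 := by
  funext i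
  refine Fintype.linearIndependent_iff.1 (h.isFrame.linearIndependent hy) c ?_ i
  rw [Fin.sum_univ_six, ← hc]
  simp only [add_assoc]
  rfl

theorem IsAdapted.disjoint_planeAt (h : IsAdapted H p m U) (hy : y ∈ U) :
    Disjoint (planeAt p y) (planeAt m y) := by
  rw [Submodule.disjoint_def]
  intro v hv hv'
  obtain ⟨c, d, rfl⟩ := mem_planeAt.1 hv
  obtain ⟨e, f, hef⟩ := mem_planeAt.1 hv'
  have h0 := h.eq_zero_of_comb hy (c := ![c, d, 0, -e, -f, 0]) (by
    change c • p 0 y + d • p 1 y + (0 : ℝ) • _ + ((-e) • m 0 y + (-f) • m 1 y + (0 : ℝ) • _) = 0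
    rw [hef]
    module)
  have hc : c = 0 := congrFun h0 0
  have hd : d = 0 := congrFun h0 1
  rw [hc, hd, zero_smul, zero_smul, add_zero]

/-- Subbundles locally spanned by positive adapted pairs form a canonical splitting. -/
theorem isCanonicalSplitting_of_adapted {o : MfdOrientation 6 M} {Hp Hm : Subbundle 6 2 M}
    (h : ∀ x, ∃ (U : Set M) (p m : Fin 2 → VField 6 M), x ∈ U ∧ IsAdapted H p m U ∧
      (∀ y ∈ U, Hp.fiber y = planeAt p y) ∧ (∀ y ∈ U, Hm.fiber y = planeAt m y) ∧
      ∀ y ∈ U, IsPositive (o.orient y) fun i => bracketFrame p m i y) :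
    IsCanonicalSplitting o H Hp Hm := by
  have hsup : ∀ x, Hp.fiber x ⊔ Hm.fiber x = H.fiber x := by
    intro x
    obtain ⟨U, p, m, hx, ha, h1, h2, -⟩ := h x
    rw [h1 x hx, h2 x hx, ha.sup_planeAt hx]
  have hsp : ∀ {U ξ}, IsSection Hp U ξ → IsSection H U ξ := fun hξ =>
    ⟨hξ.smooth, fun y hy => hsup y ▸ Submodule.mem_sup_left (hξ.mem y hy)⟩
  have hsm : ∀ {U ξ}, IsSection Hm U ξ → IsSection H U ξ := fun hξ =>
    ⟨hξ.smooth, fun y hy => hsup y ▸ Submodule.mem_sup_right (hξ.mem y hy)⟩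
  refine ⟨hsup, fun x => ?_, ?_, ?_⟩
  · obtain ⟨U, p, m, hx, ha, h1, h2, -⟩ := h x
    rw [h1 x hx, h2 x hx]
    exact ha.disjoint_planeAt hx
  · intro V hV ξ η hξ hη x hxV
    obtain ⟨U, p, m, hx, ha, h1, h2, -⟩ := h x
    rw [← Submodule.Quotient.mk_eq_zero, ← Submodule.mkQ_apply,
      ← leviForm_apply H hV (hsp hξ) (hsm hη) hxV]
    refine (ha.isLeviFrame hx).levi_cross ?_ ?_
    · have hmem := hξ.mem x hxV
      rw [h1 x hx, planeAt_eq_map fun i => (ha.left i).mem x hx] at hmem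
      obtain ⟨v, hv, hv'⟩ := hmem
      rwa [show (⟨ξ x, _⟩ : H.fiber x) = v from Subtype.ext hv'.symm]
    · have hmem := hη.mem x hxV
      rw [h2 x hx, planeAt_eq_map fun i => (ha.right i).mem x hx] at hmem
      obtain ⟨v, hv, hv'⟩ := hmem
      rwa [show (⟨η x, _⟩ : H.fiber x) = v from Subtype.ext hv'.symm]
  · intro V hV ξ₁ ξ₂ η₁ η₂ hξ₁ hξ₂ hη₁ hη₂ x hxV hξ hη
    obtain ⟨U, p, m, hx, ha, h1, h2, hpos⟩ := h x
    exact ha.isPositive hx (hpos x hx) hV hxV (hsp hξ₁) (hsp hξ₂) (hsm hη₁) (hsm hη₂)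
      (h1 x hx ▸ hξ₁.mem x hxV) (h1 x hx ▸ hξ₂.mem x hxV) (h2 x hx ▸ hη₁.mem x hxV)
      (h2 x hx ▸ hη₂.mem x hxV) hξ hη

theorem isSection_frame {n k : ℕ} {M : Type*} [TopologicalSpace M]
    [ChartedSpace (EuclideanSpace ℝ (Fin n)) M] [IsManifold (𝓡 n) ∞ M]
    (D : Subbundle n k M) (x : M) (i : Fin k) : IsSection D (frameNhd D x) (frame D x i) :=
  ⟨frame_smooth D x i, fun y hy => by
    rw [← (frame_spec D x y hy).2]; exact Submodule.subset_span ⟨i, rfl⟩⟩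

/-- Local frames of a canonical splitting form adapted pairs. -/
theorem IsCanonicalSplitting.exists_isAdapted {o : MfdOrientation 6 M} {Kp Km : Subbundle 6 2 M}
    (h : IsCanonicalSplitting o H Kp Km) (x : M) :
    ∃ (U : Set M) (p m : Fin 2 → VField 6 M), x ∈ U ∧ IsAdapted H p m U ∧
      (∀ y ∈ U, Kp.fiber y = planeAt p y) ∧ (∀ y ∈ U, Km.fiber y = planeAt m y) ∧
      ∀ y ∈ U, IsPositive (o.orient y) fun i => bracketFrame p m i y := by
  let U := frameNhd Kp x ∩ frameNhd Km x
  have hU : IsOpen U := (isOpen_frameNhd Kp x).inter (isOpen_frameNhd Km x)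
  have hp : ∀ i, IsSection Kp U (frame Kp x i) := fun i =>
    (isSection_frame Kp x i).mono Set.inter_subset_left
  have hm : ∀ i, IsSection Km U (frame Km x i) := fun i =>
    (isSection_frame Km x i).mono Set.inter_subset_right
  have hsm : ∀ i, SmoothOn (bracketFrame (frame Kp x) (frame Km x) i) U := by
    intro i
    fin_cases i
    exacts [(hp 0).smooth, (hp 1).smooth, (hp 0).smooth.mlieBracket hU (hp 1).smooth,
      (hm 0).smooth, (hm 1).smooth, (hm 0).smooth.mlieBracket hU (hm 1).smooth]
  have hpair : ∀ {y : M} {q : Fin 2 → VField 6 M}, LinearIndependent ℝ (fun i => q i y) →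
      LinearIndependent ℝ ![q 0 y, q 1 y] := by
    intro y q hq
    convert! hq using 1
    funext i
    fin_cases i <;> rfl
  have hpos : ∀ y ∈ U, IsPositive (o.orient y)
      fun i => bracketFrame (frame Kp x) (frame Km x) i y := by
    intro y hy
    rw [bracketFrame_apply]
    exact h.positive U hU _ _ _ _ (hp 0) (hp 1) (hm 0) (hm 1) y hy
      (hpair (frame_spec Kp x y hy.1).1) (hpair (frame_spec Km x y hy.2).1)
  refine ⟨U, frame Kp x, frame Km x, ⟨mem_frameNhd Kp x, mem_frameNhd Km x⟩, ⟨hU, fun i => ?_,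
    fun i => ?_, fun i j y hy => h.bracket_mem U hU _ _ (hp i) (hm j) y hy, ⟨fun {y} hy =>
    (hpos y hy).linearIndependent, fun {y} hy => ?_, hsm⟩⟩, fun y hy =>
    (frame_spec Kp x y hy.1).2.symm, fun y hy => (frame_spec Km x y hy.2).2.symm, hpos⟩
  · exact ⟨(hp i).smooth, fun y hy => h.sup_eq y ▸ Submodule.mem_sup_left ((hp i).mem y hy)⟩
  · exact ⟨(hm i).smooth, fun y hy => h.sup_eq y ▸ Submodule.mem_sup_right ((hm i).mem y hy)⟩
  · obtain ⟨b, hb, -⟩ := hpos y hy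
    rw [← hb, b.span_eq]

/-- The planes of positive adapted pairs agree on overlaps, so they glue to global subbundles. -/
theorem IsHyperbolic.exists_isCanonicalSplitting (hH : IsHyperbolic H) (o : MfdOrientation 6 M) :
    ∃ Hp Hm : Subbundle 6 2 M, IsCanonicalSplitting o H Hp Hm := by
  choose U p m hx ha hpos using hH.exists_isPositive o
  have heq : ∀ x, ∀ y ∈ U x, planeAt (p y) y = planeAt (p x) y ∧
      planeAt (m y) y = planeAt (m x) y := fun x y hy =>
    (ha x).planeAt_eq (ha y) hy (hx y) (hpos x y hy) (hpos y y (hx y))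
  have hpair : ∀ {q r : Fin 2 → VField 6 M} {U : Set M} {y : M}, IsAdapted H q r U → y ∈ U →
      LinearIndependent ℝ (fun i => q i y) := by
    intro q r U y hq hy
    have := (hq.isFrame.linearIndependent hy).comp (![0, 1] : Fin 2 → Fin 6) (by decide)
    convert! this using 1
    funext i
    fin_cases i <;> rfl
  refine ⟨⟨fun y => planeAt (p y) y, fun x => ⟨U x, (ha x).isOpen, hx x, p x,
    fun i => ((ha x).left i).smooth, fun y hy => ⟨hpair (ha x) hy, (heq x y hy).1.symm⟩⟩⟩,
    ⟨fun y => planeAt (m y) y, fun x => ⟨U x, (ha x).isOpen, hx x, m x,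
    fun i => ((ha x).right i).smooth, fun y hy => ⟨hpair (ha x).symm hy, (heq x y hy).2.symm⟩⟩⟩,
    isCanonicalSplitting_of_adapted fun x => ⟨U x, p x, m x, hx x, ha x,
      fun y hy => (heq x y hy).1, fun y hy => (heq x y hy).2, hpos x⟩⟩

theorem IsCanonicalSplitting.unique {o : MfdOrientation 6 M} {Hp Hm Kp Km : Subbundle 6 2 M}
    (h : IsCanonicalSplitting o H Hp Hm) (h' : IsCanonicalSplitting o H Kp Km) :
    Kp = Hp ∧ Km = Hm := by
  have key : ∀ x, Kp.fiber x = Hp.fiber x ∧ Km.fiber x = Hm.fiber x := by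
    intro x
    obtain ⟨U, p, m, hx, ha, h1, h2, hpos⟩ := h.exists_isAdapted x
    obtain ⟨U', p', m', hx', ha', h1', h2', hpos'⟩ := h'.exists_isAdapted x
    rw [h1 x hx, h2 x hx, h1' x hx', h2' x hx']
    exact ha.planeAt_eq ha' hx hx' (hpos x hx) (hpos' x hx')
  exact ⟨Subbundle.ext (funext fun x => (key x).1), Subbundle.ext (funext fun x => (key x).2)⟩

theorem IsCanonicalSplitting.isSplitting {o : MfdOrientation 6 M} {Hp Hm : Subbundle 6 2 M}
    (h : IsCanonicalSplitting o H Hp Hm) : IsSplitting H Hp Hm := fun x =>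
  let ⟨U, p, m, hx, ha, h1, h2, _⟩ := h.exists_isAdapted x
  ⟨U, p, m, hx, ha, h1, h2⟩

end Six

/-! ### Brackets of sections spanned by part of a frame -/

section FrameSpan

variable {n k l : ℕ} {M : Type*} [TopologicalSpace M]
  [ChartedSpace (EuclideanSpace ℝ (Fin n)) M] [IsManifold (𝓡 n) ∞ M]
  {f : Fin n → VField n M} {U : Set M} {y : M} {s : Finset (Fin n)} {ξ : VField n M}

/-- The span at `y` of the fields `f i` with `i ∈ s`. -/
def frameSpan (f : Fin n → VField n M) (s : Finset (Fin n)) (y : M) :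
    Submodule ℝ (TangentSpace (𝓡 n) y) :=
  Submodule.span ℝ ((fun i => f i y) '' s)

omit [IsManifold (𝓡 n) ∞ M] in
theorem apply_mem_frameSpan {i : Fin n} (hi : i ∈ s) : f i y ∈ frameSpan f s y :=
  Submodule.subset_span ⟨i, hi, rfl⟩

omit [IsManifold (𝓡 n) ∞ M] in
theorem frameSpan_mono {s t : Finset (Fin n)} (h : s ⊆ t) : frameSpan f s y ≤ frameSpan f t y :=
  Submodule.span_mono (Set.image_mono (Finset.coe_subset.2 h))

omit [IsManifold (𝓡 n) ∞ M] in
theorem frameSpan_union (s t : Finset (Fin n)) :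
    frameSpan f (s ∪ t) y = frameSpan f s y ⊔ frameSpan f t y := by
  rw [frameSpan, Finset.coe_union, Set.image_union, Submodule.span_union]
  rfl

theorem IsFrame.coeff_apply (hf : IsFrame f U) (hy : y ∈ U) (v : TangentSpace (𝓡 n) y) (i : Fin n) :
    hf.coeff i y v = (hf.toBasisAt hy).repr v i := by
  simp [IsLocalFrameOn.coeff, hy]

theorem IsFrame.coeff_self (hf : IsFrame f U) (hy : y ∈ U) (i j : Fin n) :
    hf.coeff i y (f j y) = if j = i then 1 else 0 := by
  rw [hf.coeff_apply hy, ← hf.toBasisAt_coe hy, Basis.repr_self, Finsupp.single_apply]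

theorem IsFrame.mem_frameSpan (hf : IsFrame f U) (hy : y ∈ U) {v : TangentSpace (𝓡 n) y} :
    v ∈ frameSpan f s y ↔ ∀ i ∉ s, hf.coeff i y v = 0 := by
  have h : (fun i => f i y) = hf.toBasisAt hy := by
    funext i
    rw [hf.toBasisAt_coe]
  rw [frameSpan, h, Basis.mem_span_image]
  simp only [hf.coeff_apply hy]
  constructor
  · intro hs i hi
    by_contra h0
    exact hi (hs (Finsupp.mem_support_iff.2 h0))
  · intro hs i hi
    by_contra h0
    exact Finsupp.mem_support_iff.1 hi (hs i h0)

theorem IsFrame.sum_coeff_of_mem (hf : IsFrame f U) (hy : y ∈ U) {v : TangentSpace (𝓡 n) y}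
    (hv : v ∈ frameSpan f s y) : ∑ i ∈ s, hf.coeff i y v • f i y = v := by
  conv_rhs => rw [← IsFrame.sum_coeff hf hy v]
  refine Finset.sum_subset (Finset.subset_univ s) fun i _ hi => ?_
  rw [(hf.mem_frameSpan hy).1 hv i hi, zero_smul]

/-- The projection of a field to the span of part of a frame. -/
def frameProj (hf : IsFrame f U) (s : Finset (Fin n)) (ξ : VField n M) : VField n M :=
  ∑ i ∈ s, (fun z => hf.coeff i z (ξ z)) • f i

theorem frameProj_apply (hf : IsFrame f U) (s : Finset (Fin n)) (ξ : VField n M) (y : M) :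
    frameProj hf s ξ y = ∑ i ∈ s, hf.coeff i y (ξ y) • f i y :=
  Finset.sum_apply _ _ _

theorem frameProj_mem (hf : IsFrame f U) (s : Finset (Fin n)) (ξ : VField n M) (y : M) :
    frameProj hf s ξ y ∈ frameSpan f s y := by
  rw [frameProj_apply]
  exact Submodule.sum_mem _ fun i hi => Submodule.smul_mem _ _ (apply_mem_frameSpan hi)

theorem smoothOn_frameProj (hU : IsOpen U) (hf : IsFrame f U) (s : Finset (Fin n))
    (hξ : SmoothOn ξ U) : SmoothOn (frameProj hf s ξ) U :=
  SmoothOn.sum fun i _ => SmoothOn.smul (IsFrame.contMDiffOn_coeff hU hf hξ i) (hf.contMDiffOn i)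

/-- The bracket with a section of the span of part of a frame, modulo that part. -/
theorem IsFrame.map_mlieBracket_left {W : Type*} [AddCommGroup W] [Module ℝ W] (hU : IsOpen U)
    (hf : IsFrame f U) (hy : y ∈ U) (φ : TangentSpace (𝓡 n) y →ₗ[ℝ] W) (hξ : SmoothOn ξ U)
    (hs : ∀ z ∈ U, ξ z ∈ frameSpan f s z) (hφ : ∀ i ∈ s, φ (f i y) = 0) (η : VField n M) :
    φ (mlieBracket (𝓡 n) ξ η y) =
      ∑ i ∈ s, hf.coeff i y (ξ y) • φ (mlieBracket (𝓡 n) (f i) η y) := by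
  have h := map_mlieBracket_sum_left hU hy φ (s := s) (f := fun i z => hf.coeff i z (ξ z)) (a := f)
    (fun i _ => IsFrame.contMDiffOn_coeff hU hf hξ i) (fun i _ => hf.contMDiffOn i) hφ η
  rw [← h]
  refine congrArg φ (mlieBracket_congr_of_eqOn hU hy (fun z hz => ?_) fun z _ => rfl)
  rw [Finset.sum_apply]
  exact (hf.sum_coeff_of_mem hz (hs z hz)).symm

theorem IsFrame.mlieBracket_mem_left (hU : IsOpen U) (hf : IsFrame f U) (hy : y ∈ U)
    {G : Submodule ℝ (TangentSpace (𝓡 n) y)} (hξ : SmoothOn ξ U)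
    (hs : ∀ z ∈ U, ξ z ∈ frameSpan f s z) (hG : frameSpan f s y ≤ G) {η : VField n M}
    (h : ∀ i ∈ s, mlieBracket (𝓡 n) (f i) η y ∈ G) : mlieBracket (𝓡 n) ξ η y ∈ G := by
  rw [← Submodule.Quotient.mk_eq_zero, ← Submodule.mkQ_apply,
    hf.map_mlieBracket_left hU hy G.mkQ hξ hs fun i hi =>
      (Submodule.Quotient.mk_eq_zero _).2 (hG (apply_mem_frameSpan hi))]
  refine Finset.sum_eq_zero fun i hi => ?_
  rw [Submodule.mkQ_apply, (Submodule.Quotient.mk_eq_zero _).2 (h i hi), smul_zero]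

theorem IsFrame.mlieBracket_mem_right (hU : IsOpen U) (hf : IsFrame f U) (hy : y ∈ U)
    {G : Submodule ℝ (TangentSpace (𝓡 n) y)} (hξ : SmoothOn ξ U)
    (hs : ∀ z ∈ U, ξ z ∈ frameSpan f s z) (hG : frameSpan f s y ≤ G) {η : VField n M}
    (h : ∀ i ∈ s, mlieBracket (𝓡 n) η (f i) y ∈ G) : mlieBracket (𝓡 n) η ξ y ∈ G := by
  rw [mlieBracket_swap_apply]
  refine neg_mem (hf.mlieBracket_mem_left hU hy hξ hs hG fun i hi => ?_)
  rw [mlieBracket_swap_apply]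
  exact neg_mem (h i hi)

end FrameSpan

/-! ### The span of the brackets of sections -/

section BracketFiber

variable {n k l : ℕ} {M : Type*} [TopologicalSpace M]
  [ChartedSpace (EuclideanSpace ℝ (Fin n)) M] [IsManifold (𝓡 n) ∞ M]

/-- A nonzero tangent vector has nonzero derivative on some local function. -/
theorem exists_mvfderiv_ne_zero {y : M} {v : TangentSpace (𝓡 n) y} (hv : v ≠ 0) :
    ∃ (U : Set M) (f : M → ℝ), IsOpen U ∧ y ∈ U ∧ ContMDiffOn (𝓡 n) 𝓘(ℝ, ℝ) ∞ f U ∧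
      mvfderiv (𝓡 n) f y v ≠ 0 := by
  set A := mfderiv (𝓡 n) 𝓘(ℝ, EuclideanSpace ℝ (Fin n)) (extChartAt (𝓡 n) y) y with hA
  have hw : A v ≠ 0 := by
    have hinv := isInvertible_mfderiv_extChartAt (I := 𝓡 n) (mem_extChartAt_source (I := 𝓡 n) y)
    obtain ⟨e, he⟩ := hinv
    intro h0
    apply hv
    have h1 : e v = 0 := by
      have := congrArg (fun B => B v) he
      exact this.trans h0
    exact (map_eq_zero_iff e e.injective).1 h1
  have hdual : ∀ w : EuclideanSpace ℝ (Fin n), w ≠ 0 →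
      ∃ g : EuclideanSpace ℝ (Fin n) →L[ℝ] ℝ, g w ≠ 0 := fun w hw =>
    ⟨innerSL ℝ w, by rw [innerSL_apply_apply]; exact inner_self_ne_zero.2 hw⟩
  obtain ⟨g, hg⟩ := hdual (A v) hw
  have hsm := contMDiffOn_extChartAt (I := 𝓡 n) (n := ∞) (x := y)
  refine ⟨(chartAt (EuclideanSpace ℝ (Fin n)) y).source, g ∘ extChartAt (𝓡 n) y,
    (chartAt _ y).open_source, mem_chart_source _ y, g.contMDiff.comp_contMDiffOn hsm, ?_⟩
  rw [mvfderiv_comp_apply y g.mdifferentiableAt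
    ((contMDiffAt_extChartAt (I := 𝓡 n) (n := ∞)).mdifferentiableAt (by simp))]
  have h2 : mvfderiv 𝓘(ℝ, EuclideanSpace ℝ (Fin n)) g (extChartAt (𝓡 n) y y) =
      g := by
    rw [mvfderiv, ContinuousLinearMap.mfderiv_eq]
    rfl
  rw [h2]
  exact hg

/-- `[D, D]` contains `D`, by the Leibniz rule `[η, f ξ] = df(η) ξ + f [η, ξ]` for a function `f`
with `df(η) ≠ 0`. -/
theorem apply_mem_bracketFiber {D : Subbundle n k M} {U : Set M} {y : M} (hU : IsOpen U)
    (hy : y ∈ U) {ξ η : VField n M} (hξ : IsSection D U ξ) (hη : IsSection D U η)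
    (h0 : η y ≠ 0) : ξ y ∈ bracketFiber D y := by
  obtain ⟨V, f, hV, hyV, hf, hd⟩ := exists_mvfderiv_ne_zero h0
  have hW : IsOpen (U ∩ V) := hU.inter hV
  have hyW : y ∈ U ∩ V := ⟨hy, hyV⟩
  have h1 := hξ.mono (V := U ∩ V) Set.inter_subset_left
  have h2 := hη.mono (V := U ∩ V) Set.inter_subset_left
  have hf' := hf.mono (t := U ∩ V) Set.inter_subset_right
  have h3 : IsSection D (U ∩ V) (f • ξ) := ⟨h1.smooth.smul hf', fun z hz =>
    Submodule.smul_mem _ _ (h1.mem z hz)⟩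
  have hb1 : mlieBracket (𝓡 n) η ξ y ∈ bracketFiber D y :=
    Submodule.subset_span ⟨_, hW, hyW, _, _, h2, h1, rfl⟩
  have hb2 : mlieBracket (𝓡 n) η (f • ξ) y ∈ bracketFiber D y :=
    Submodule.subset_span ⟨_, hW, hyW, _, _, h2, h3, rfl⟩
  rw [mlieBracket_smul_right ((hf'.contMDiffAt (hW.mem_nhds hyW)).mdifferentiableAt (by simp))
    (h1.smooth.mdifferentiableAt hW hyW)] at hb2
  have := sub_mem hb2 (Submodule.smul_mem _ (f y) hb1)
  rw [add_sub_cancel_right] at this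
  exact (Submodule.smul_mem_iff _ hd).1 this

theorem mlieBracket_mem_bracketFiber {D : Subbundle n k M} {U : Set M} {y : M} (hU : IsOpen U)
    (hy : y ∈ U) {ξ η : VField n M} (hξ : IsSection D U ξ) (hη : IsSection D U η) :
    mlieBracket (𝓡 n) ξ η y ∈ bracketFiber D y :=
  Submodule.subset_span ⟨U, hU, hy, ξ, η, hξ, hη, rfl⟩

/-- The range of the Levi form on `D` is the image of `[D, D]`. -/
theorem leviRange_eq_map {H : Subbundle n k M} {D : Subbundle n l M}
    (hD : ∀ x, D.fiber x ≤ H.fiber x) (x : M) :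
    leviRange H D x = (bracketFiber D x).map (H.fiber x).mkQ := by
  have hsec : ∀ {U ξ}, IsSection D U ξ → IsSection H U ξ := fun h =>
    ⟨h.smooth, fun y hy => hD y (h.mem y hy)⟩
  apply le_antisymm
  · refine Submodule.span_le.2 ?_
    rintro _ ⟨v, w, hv, hw, rfl⟩
    obtain ⟨ξ, hξ, hξv⟩ := exists_isSection_eq D x ⟨v, hv⟩
    obtain ⟨η, hη, hηw⟩ := exists_isSection_eq D x ⟨w, hw⟩
    have hx := mem_frameNhd D x
    refine ⟨_, mlieBracket_mem_bracketFiber (isOpen_frameNhd D x) hx hξ hη, ?_⟩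
    rw [← leviForm_apply H (isOpen_frameNhd D x) (hsec hξ) (hsec hη) hx]
    congr 1
    · congr 1
      exact Subtype.ext hξv
    · exact Subtype.ext hηw
  · rw [bracketFiber, Submodule.map_span, Submodule.span_le]
    rintro _ ⟨_, ⟨U, hU, hx, ξ, η, hξ, hη, rfl⟩, rfl⟩
    refine Submodule.subset_span ⟨⟨ξ x, (hsec hξ).mem x hx⟩, ⟨η x, (hsec hη).mem x hx⟩,
      hξ.mem x hx, hη.mem x hx, leviForm_apply H hU (hsec hξ) (hsec hη) hx⟩

end BracketFiber

section Six

variable {M : Type*} [TopologicalSpace M]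
  [ChartedSpace (EuclideanSpace ℝ (Fin 6)) M] [IsManifold (𝓡 6) ∞ M]
  {H : Subbundle 6 4 M} {p m : Fin 2 → VField 6 M} {U : Set M} {y : M}
  {Hp Hm : Subbundle 6 2 M}

omit [IsManifold (𝓡 6) ∞ M] in
theorem planeAt_eq_frameSpan_left (p m : Fin 2 → VField 6 M) (y : M) :
    planeAt p y = frameSpan (bracketFrame p m) {0, 1} y := by
  simp only [frameSpan, Finset.coe_pair, Set.image_pair]
  rw [planeAt]
  congr 1
  ext v
  simp only [Set.mem_range, Fin.exists_fin_two, Set.mem_insert_iff, Set.mem_singleton_iff,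
    eq_comm (b := v)]
  rfl

omit [IsManifold (𝓡 6) ∞ M] in
theorem planeAt_eq_frameSpan_right (p m : Fin 2 → VField 6 M) (y : M) :
    planeAt m y = frameSpan (bracketFrame p m) {3, 4} y := by
  simp only [frameSpan, Finset.coe_pair, Set.image_pair]
  rw [planeAt]
  congr 1
  ext v
  simp only [Set.mem_range, Fin.exists_fin_two, Set.mem_insert_iff, Set.mem_singleton_iff,
    eq_comm (b := v)]
  rfl

omit [IsManifold (𝓡 6) ∞ M] in
theorem frameSpan_bracketFrame_swap (p m : Fin 2 → VField 6 M) (y : M) :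
    frameSpan (bracketFrame m p) {0, 1, 2} y = frameSpan (bracketFrame p m) {3, 4, 5} y := by
  simp only [frameSpan, Finset.coe_insert, Finset.coe_singleton, Set.image_insert_eq,
    Set.image_singleton]
  rfl

theorem IsAdapted.fiber_eq (h : IsAdapted H p m U) (hy : y ∈ U) :
    H.fiber y = frameSpan (bracketFrame p m) {0, 1, 3, 4} y := by
  rw [← h.sup_planeAt hy, planeAt_eq_frameSpan_left p m, planeAt_eq_frameSpan_right p m,
    ← frameSpan_union]
  rfl

theorem IsAdapted.bracketFiber_left (h : IsAdapted H p m U)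
    (hp : ∀ y ∈ U, Hp.fiber y = planeAt p y) (hy : y ∈ U) :
    bracketFiber Hp y = frameSpan (bracketFrame p m) {0, 1, 2} y := by
  have hsec : ∀ i, IsSection Hp U (p i) := fun i => ⟨(h.left i).smooth, fun z hz => by
    rw [hp z hz]; exact Submodule.subset_span ⟨i, rfl⟩⟩
  have hne : ∀ i, p i y ≠ 0 := by
    have h0 := (h.isFrame.linearIndependent hy).ne_zero
    intro i
    fin_cases i
    exacts [h0 0, h0 1]
  apply le_antisymm
  · refine Submodule.span_le.2 ?_
    rintro _ ⟨V, hV, hyV, ξ, η, hξ, hη, rfl⟩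
    have hW : IsOpen (U ∩ V) := h.isOpen.inter hV
    have hyW : y ∈ U ∩ V := ⟨hy, hyV⟩
    have ha := h.mono hW Set.inter_subset_left
    have hspan : ∀ {ζ}, IsSection Hp V ζ → ∀ z ∈ U ∩ V, ζ z ∈
        frameSpan (bracketFrame p m) {0, 1} z := by
      intro ζ hζ z hz
      rw [← planeAt_eq_frameSpan_left, ← hp z hz.1]
      exact hζ.mem z hz.2
    have hle : frameSpan (bracketFrame p m) {0, 1} y ≤ frameSpan (bracketFrame p m) {0, 1, 2} y :=
      frameSpan_mono (by decide)
    refine IsFrame.mlieBracket_mem_left hW ha.isFrame hyW (hξ.smooth.mono Set.inter_subset_right)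
      (hspan hξ) hle fun i hi => IsFrame.mlieBracket_mem_right hW ha.isFrame hyW
        (hη.smooth.mono Set.inter_subset_right) (hspan hη) hle fun j hj => ?_
    have h2 : mlieBracket (𝓡 6) (p 0) (p 1) y ∈ frameSpan (bracketFrame p m) {0, 1, 2} y :=
      apply_mem_frameSpan (i := 2) (by decide)
    simp only [Finset.mem_insert, Finset.mem_singleton] at hi hj
    rcases hi with rfl | rfl <;> rcases hj with rfl | rfl
    · simp
    · exact h2
    · rw [mlieBracket_swap_apply]
      exact neg_mem h2
    · simp
  · refine Submodule.span_le.2 ?_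
    rintro _ ⟨i, hi, rfl⟩
    simp only [Finset.coe_insert, Finset.coe_singleton, Set.mem_insert_iff,
      Set.mem_singleton_iff] at hi
    rcases hi with rfl | rfl | rfl
    · exact apply_mem_bracketFiber h.isOpen hy (hsec 0) (hsec 0) (hne 0)
    · exact apply_mem_bracketFiber h.isOpen hy (hsec 1) (hsec 1) (hne 1)
    · exact mlieBracket_mem_bracketFiber h.isOpen hy (hsec 0) (hsec 1)

theorem IsAdapted.bracketFiber_right (h : IsAdapted H p m U)
    (hm : ∀ y ∈ U, Hm.fiber y = planeAt m y) (hy : y ∈ U) :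
    bracketFiber Hm y = frameSpan (bracketFrame p m) {3, 4, 5} y := by
  rw [h.symm.bracketFiber_left hm hy, frameSpan_bracketFrame_swap]

/-- `[Hp, Hp]` is a smooth subbundle of rank three. -/
theorem IsSplitting.exists_subbundle (h : IsSplitting H Hp Hm) :
    ∃ Tp : Subbundle 6 3 M, ∀ x, Tp.fiber x = bracketFiber Hp x := by
  refine ⟨⟨fun x => bracketFiber Hp x, fun x => ?_⟩, fun x => rfl⟩
  obtain ⟨U, p, m, hx, ha, hp, hm⟩ := h x
  refine ⟨U, ha.isOpen, hx, fun i => bracketFrame p m (Fin.castAdd 3 i),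
    fun i => ha.isFrame.contMDiffOn _, fun y hy =>
    ⟨(ha.isFrame.linearIndependent hy).comp _ (Fin.castAdd_injective 3 3), ?_⟩⟩
  rw [ha.bracketFiber_left hp hy, frameSpan]
  congr 1
  ext v
  simp only [Set.mem_range, Set.mem_image]
  constructor
  · rintro ⟨i, rfl⟩
    exact ⟨Fin.castAdd 3 i, by fin_cases i <;> decide, rfl⟩
  · rintro ⟨i, hi, rfl⟩
    simp only [Finset.coe_insert, Finset.coe_singleton, Set.mem_insert_iff,
      Set.mem_singleton_iff] at hi
    rcases hi with rfl | rfl | rfl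
    exacts [⟨0, rfl⟩, ⟨1, rfl⟩, ⟨2, rfl⟩]

theorem IsSplitting.isCompl (h : IsSplitting H Hp Hm) (x : M) :
    IsCompl (bracketFiber Hp x) (bracketFiber Hm x) := by
  obtain ⟨U, p, m, hx, ha, hp, hm⟩ := h x
  rw [ha.bracketFiber_left hp hx, ha.bracketFiber_right hm hx]
  constructor
  · rw [Submodule.disjoint_def]
    intro v hv hv'
    rw [IsFrame.mem_frameSpan ha.isFrame hx] at hv hv'
    rw [← IsFrame.sum_coeff ha.isFrame hx v]
    refine Finset.sum_eq_zero fun i _ => ?_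
    have : ha.isFrame.coeff i x v = 0 := by
      fin_cases i
      exacts [hv' 0 (by decide), hv' 1 (by decide), hv' 2 (by decide), hv 3 (by decide),
        hv 4 (by decide), hv 5 (by decide)]
    rw [this, zero_smul]
  · rw [codisjoint_iff, ← frameSpan_union, eq_top_iff]
    intro v _
    rw [IsFrame.mem_frameSpan ha.isFrame hx]
    intro i hi
    exact absurd (by fin_cases i <;> decide) hi

theorem IsSplitting.sup_eq (h : IsSplitting H Hp Hm) (x : M) :
    Hp.fiber x ⊔ Hm.fiber x = H.fiber x := by
  obtain ⟨U, p, m, hx, ha, hp, hm⟩ := h x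
  rw [hp x hx, hm x hx, ha.sup_planeAt hx]

theorem IsSplitting.le_bracketFiber (h : IsSplitting H Hp Hm) (x : M) :
    Hp.fiber x ≤ bracketFiber Hp x := by
  obtain ⟨U, p, m, hx, ha, hp, hm⟩ := h x
  rw [hp x hx, ha.bracketFiber_left hp hx, planeAt_eq_frameSpan_left p m]
  exact frameSpan_mono (by decide)

end Six

/-! ### Bilinear forms induced by the bracket -/

section BracketForm

variable {n k l : ℕ} {M : Type*} [TopologicalSpace M]
  [ChartedSpace (EuclideanSpace ℝ (Fin n)) M] [IsManifold (𝓡 n) ∞ M]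

/-- Modulo `D₁` and `D₂`, the bracket of a section of `D₁` and a section of `D₂` is bilinear
in their values. -/
theorem exists_bracketForm (D₁ : Subbundle n k M) (D₂ : Subbundle n l M) (x : M) {W : Type*}
    [AddCommGroup W] [Module ℝ W] (φ : TangentSpace (𝓡 n) x →ₗ[ℝ] W)
    (h₁ : D₁.fiber x ≤ LinearMap.ker φ) (h₂ : D₂.fiber x ≤ LinearMap.ker φ) :
    ∃ B : D₁.fiber x →ₗ[ℝ] D₂.fiber x →ₗ[ℝ] W, ∀ U : Set M, IsOpen U → ∀ ξ η : VField n M,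
      ∀ (hξ : IsSection D₁ U ξ) (hη : IsSection D₂ U η) (hx : x ∈ U),
        B ⟨ξ x, hξ.mem x hx⟩ ⟨η x, hη.mem x hx⟩ = φ (mlieBracket (𝓡 n) ξ η x) := by
  have hφ : ∀ {r : ℕ} (D : Subbundle n r M), D.fiber x ≤ LinearMap.ker φ →
      ∀ (U : Set M), IsOpen U → ∀ (hx : x ∈ U) (ξ η : VField n M) (hξ : IsSection D U ξ),
        φ (mlieBracket (𝓡 n) ξ η x) = ∑ i, (fiberBasis D x).repr ⟨ξ x, hξ.mem x hx⟩ i •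
          φ (mlieBracket (𝓡 n) (frame D x i) η x) := by
    intro r D hD U hU hx ξ η hξ
    have := congrArg ((D.fiber x).liftQ φ hD) (mkQ_bracket_left D x hU hx hξ η)
    simpa only [map_sum, map_smul, Submodule.mkQ_apply, Submodule.liftQ_apply] using this
  refine ⟨(fiberBasis D₁ x).constr ℝ fun i => (fiberBasis D₂ x).constr ℝ fun j =>
    φ (mlieBracket (𝓡 n) (frame D₁ x i) (frame D₂ x j) x), fun U hU ξ η hξ hη hx => ?_⟩
  rw [hφ D₁ h₁ U hU hx ξ η hξ]
  simp only [Basis.constr_apply_fintype, LinearMap.sum_apply, LinearMap.smul_apply,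
    Basis.equivFun_apply]
  refine Finset.sum_congr rfl fun i _ => ?_
  congr 1
  rw [mlieBracket_swap_apply, map_neg, hφ D₂ h₂ U hU hx η (frame D₁ x i) hη,
    ← Finset.sum_neg_distrib]
  refine Finset.sum_congr rfl fun j _ => ?_
  rw [mlieBracket_swap_apply (V := frame D₂ x j), map_neg, smul_neg, neg_neg]

end BracketForm

section Six

variable {M : Type*} [TopologicalSpace M]
  [ChartedSpace (EuclideanSpace ℝ (Fin 6)) M] [IsManifold (𝓡 6) ∞ M]
  {H : Subbundle 6 4 M} {Hp Hm : Subbundle 6 2 M} {Tp Tm : Subbundle 6 3 M}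

/-! ### The splitting of the quotient -/

theorem IsSplitting.left_le (h : IsSplitting H Hp Hm) (x : M) : Hp.fiber x ≤ H.fiber x := by
  rw [← h.sup_eq x]
  exact le_sup_left

theorem IsSplitting.right_le (h : IsSplitting H Hp Hm) (x : M) : Hm.fiber x ≤ H.fiber x :=
  h.symm.left_le x

/-- `T₊ ∩ H = H₊`. -/
theorem IsSplitting.mem_of_mem (h : IsSplitting H Hp Hm) {x : M} {v : TangentSpace (𝓡 6) x}
    (hv : v ∈ bracketFiber Hp x) (hH : v ∈ H.fiber x) : v ∈ Hp.fiber x := by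
  rw [← h.sup_eq x] at hH
  obtain ⟨a, ha, b, hb, rfl⟩ := Submodule.mem_sup.1 hH
  have h1 : b ∈ bracketFiber Hp x := by
    have := sub_mem hv (h.le_bracketFiber x ha)
    rwa [add_sub_cancel_left] at this
  have h2 := (Submodule.disjoint_def.1 (h.isCompl x).disjoint) b h1 (h.symm.le_bracketFiber x hb)
  rwa [h2, add_zero]

theorem IsSplitting.isCompl_leviRange (h : IsSplitting H Hp Hm) (x : M) :
    IsCompl (leviRange H Hp x) (leviRange H Hm x) := by
  rw [leviRange_eq_map h.left_le, leviRange_eq_map h.right_le]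
  constructor
  · rw [Submodule.disjoint_def]
    rintro _ ⟨a, ha, rfl⟩ ⟨b, hb, hab⟩
    have hba : b - a ∈ H.fiber x := by
      rw [← Submodule.Quotient.mk_eq_zero, ← Submodule.mkQ_apply, map_sub, hab, sub_self]
    rw [← h.sup_eq x] at hba
    obtain ⟨c, hc, d, hd, hcd⟩ := Submodule.mem_sup.1 hba
    have h0 : a + c = b - d := by rw [eq_sub_iff_add_eq, add_assoc, hcd, add_sub_cancel]
    have h1 : a + c = 0 := Submodule.disjoint_def.1 (h.isCompl x).disjoint _
      (add_mem ha (h.le_bracketFiber x hc))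
      (h0 ▸ sub_mem hb (h.symm.le_bracketFiber x hd))
    rw [Submodule.mkQ_apply, Submodule.Quotient.mk_eq_zero, eq_neg_of_add_eq_zero_left h1]
    exact neg_mem (h.left_le x hc)
  · rw [codisjoint_iff, ← Submodule.map_sup, (h.isCompl x).sup_eq_top, Submodule.map_top,
      Submodule.range_mkQ]

theorem exists_proj_of_isCompl {W : Type*} [AddCommGroup W] [Module ℝ W] {A B : Submodule ℝ W}
    (h : IsCompl A B) : ∃ P : W →ₗ[ℝ] A, (∀ b ∈ B, P b = 0) ∧ ∀ a ∈ A, (P a : W) = a :=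
  ⟨A.projectionOnto B h, fun _ hb => (Submodule.projectionOnto_apply_eq_zero_iff h).2 hb,
    fun a ha => congrArg Subtype.val (Submodule.projectionOnto_apply_left h ⟨a, ha⟩)⟩

/-- The projection of `TM` to `Q₋` with kernel `T₊ ⊕ H₋`. -/
theorem IsSplitting.exists_proj (h : IsSplitting H Hp Hm) (x : M) :
    ∃ π : TangentSpace (𝓡 6) x →ₗ[ℝ] leviRange H Hm x, (∀ v ∈ bracketFiber Hp x, π v = 0) ∧
      ∀ v ∈ bracketFiber Hm x, (π v : QFiber H x) = (H.fiber x).mkQ v := by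
  obtain ⟨P, hP, hP'⟩ := exists_proj_of_isCompl (h.isCompl_leviRange x).symm
  refine ⟨P ∘ₗ (H.fiber x).mkQ, fun v hv => hP _ ?_, fun v hv => hP' _ ?_⟩
  · rw [leviRange_eq_map h.left_le]
    exact Submodule.mem_map_of_mem hv
  · rw [leviRange_eq_map h.right_le]
    exact Submodule.mem_map_of_mem hv

theorem IsSplitting.isQuotientAt (h : IsSplitting H Hp Hm)
    (hTp : ∀ x, Tp.fiber x = bracketFiber Hp x) (x : M) :
    IsQuotientAt H Tp Hp x (leviRange H Hp x) := by
  have hmem : ∀ v : Tp.fiber x,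
      ((H.fiber x).mkQ ∘ₗ (Tp.fiber x).subtype) v ∈ leviRange H Hp x := by
    intro v
    rw [leviRange_eq_map h.left_le, ← hTp x]
    exact Submodule.mem_map_of_mem v.2
  let g : Tp.fiber x →ₗ[ℝ] leviRange H Hp x :=
    LinearMap.codRestrict _ ((H.fiber x).mkQ ∘ₗ (Tp.fiber x).subtype) hmem
  have hg : ∀ v, (g v : QFiber H x) = (H.fiber x).mkQ v := fun v => rfl
  have hsurj : Function.Surjective g := by
    rintro ⟨q, hq⟩
    rw [leviRange_eq_map h.left_le, ← hTp x] at hq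
    obtain ⟨v, hv, rfl⟩ := hq
    exact ⟨⟨v, hv⟩, Subtype.ext rfl⟩
  have hker : (Hp.fiber x).submoduleOf (Tp.fiber x) = LinearMap.ker g := by
    ext v
    rw [LinearMap.mem_ker, ← Subtype.coe_inj, hg, Submodule.mkQ_apply, ZeroMemClass.coe_zero,
      Submodule.Quotient.mk_eq_zero]
    exact ⟨fun hv => h.left_le x hv, fun hv => h.mem_of_mem (hTp x ▸ v.2) hv⟩
  exact ⟨(Submodule.quotEquivOfEq _ _ hker).trans (g.quotKerEquivOfSurjective hsurj),
    fun v => hg v⟩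

/-! ### The obstruction to integrability -/

/-- The Frobenius integrability criterion: if `[T₊, H₊] ⊆ T₊ ⊕ H₋`, then `T₊` is involutive. By the
Jacobi identity the `H₋`-component `κ` of `[T₊, H₊]` satisfies `[κ, H₋] ⊆ T₊ ⊕ H₋`, hence lies in
the kernel of the Levi form on `H₋`, which is zero. -/
theorem IsSplitting.involutive_of_mem (h : IsSplitting H Hp Hm)
    (hTp : ∀ x, Tp.fiber x = bracketFiber Hp x)
    (hF : ∀ U : Set M, IsOpen U → ∀ ξ η : VField 6 M, IsSection Tp U ξ → IsSection Hp U η →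
      ∀ x ∈ U, mlieBracket (𝓡 6) ξ η x ∈ Tp.fiber x ⊔ Hm.fiber x) :
    Involutive Tp := by
  intro V hV ξ η hξ hη x hxV
  obtain ⟨U, p, m, hxU, ha, hp, hm⟩ := h x
  have hU := ha.isOpen
  set f := bracketFrame p m with hf
  have hfr : IsFrame f U := ha.isFrame
  have hfs : ∀ i, SmoothOn (f i) U := hfr.contMDiffOn
  have hT : ∀ y ∈ U, Tp.fiber y = frameSpan f {0, 1, 2} y := fun y hy => by
    rw [hTp y, ha.bracketFiber_left hp hy]
  have hP : ∀ y ∈ U, Hp.fiber y = frameSpan f {0, 1} y := fun y hy => by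
    rw [hp y hy, planeAt_eq_frameSpan_left p m]
  have hTF : ∀ y ∈ U, Tp.fiber y ⊔ Hm.fiber y = frameSpan f {0, 1, 2, 3, 4} y := fun y hy => by
    rw [hT y hy, hm y hy, planeAt_eq_frameSpan_right p m, ← frameSpan_union]
    rfl
  have hTsec : ∀ i ∈ ({0, 1, 2} : Finset (Fin 6)), IsSection Tp U (f i) := fun i hi =>
    ⟨hfs i, fun y hy => by rw [hT y hy]; exact apply_mem_frameSpan hi⟩
  have hPsec : ∀ i ∈ ({0, 1} : Finset (Fin 6)), IsSection Hp U (f i) := fun i hi =>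
    ⟨hfs i, fun y hy => by rw [hP y hy]; exact apply_mem_frameSpan hi⟩
  have hTP : ∀ i ∈ ({0, 1, 2} : Finset (Fin 6)), ∀ j ∈ ({0, 1} : Finset (Fin 6)), ∀ y ∈ U,
      mlieBracket (𝓡 6) (f i) (f j) y ∈ frameSpan f {0, 1, 2, 3, 4} y := fun i hi j hj y hy => by
    rw [← hTF y hy]
    exact hF U hU _ _ (hTsec i hi) (hPsec j hj) y hy
  have hPM : ∀ i ∈ ({0, 1} : Finset (Fin 6)), ∀ j ∈ ({3, 4} : Finset (Fin 6)), ∀ y ∈ U,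
      mlieBracket (𝓡 6) (f i) (f j) y ∈ frameSpan f {0, 1, 3, 4} y := fun i hi j hj y hy => by
    rw [← ha.fiber_eq hy]
    simp only [Finset.mem_insert, Finset.mem_singleton] at hi hj
    rcases hi with rfl | rfl <;> rcases hj with rfl | rfl <;> exact ha.bracket_mem _ _ y hy
  have hHF : ∀ y, frameSpan f {0, 1, 3, 4} y ≤ frameSpan f {0, 1, 2, 3, 4} y := fun y =>
    frameSpan_mono (by decide)
  have hPH : ∀ i ∈ ({0, 1} : Finset (Fin 6)), ∀ j ∈ ({0, 1, 3, 4} : Finset (Fin 6)), ∀ y ∈ U,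
      mlieBracket (𝓡 6) (f i) (f j) y ∈ frameSpan f {0, 1, 2, 3, 4} y := by
    intro i hi j hj y hy
    have hj' : j ∈ ({0, 1} : Finset (Fin 6)) ∨ j ∈ ({3, 4} : Finset (Fin 6)) := by
      revert j; decide
    rcases hj' with hj' | hj'
    · exact hTP i ((by decide : ({0, 1} : Finset (Fin 6)) ⊆ {0, 1, 2}) hi) j hj' y hy
    · exact hHF y (hPM i hi j hj' y hy)
  -- `[[p₀, p₁], m]` by the Jacobi identity
  have hTM : ∀ j ∈ ({3, 4} : Finset (Fin 6)), ∀ y ∈ U,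
      mlieBracket (𝓡 6) (f 2) (f j) y ∈ frameSpan f {0, 1, 2, 3, 4} y := by
    intro j hj y hy
    have hJ := leibniz_mlieBracket hU hy (hfs 0) (hfs 1) (hfs j)
    have h2 : mlieBracket (𝓡 6) (f 0) (f 1) = f 2 := rfl
    rw [h2] at hJ
    rw [← sub_eq_iff_eq_add.2 hJ]
    refine sub_mem ?_ ?_
    · exact IsFrame.mlieBracket_mem_right hU hfr hy ((hfs 1).mlieBracket hU (hfs j))
        (hPM 1 (by decide) j hj) (hHF y) fun i hi => hPH 0 (by decide) i hi y hy
    · exact IsFrame.mlieBracket_mem_right hU hfr hy ((hfs 0).mlieBracket hU (hfs j))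
        (hPM 0 (by decide) j hj) (hHF y) fun i hi => hPH 1 (by decide) i hi y hy
  have hTT : ∀ i ∈ ({0, 1, 2} : Finset (Fin 6)), ∀ j ∈ ({0, 1, 2, 3, 4} : Finset (Fin 6)),
      ∀ y ∈ U, mlieBracket (𝓡 6) (f i) (f j) y ∈ frameSpan f {0, 1, 2, 3, 4} y := by
    intro i hi j hj y hy
    have hj' : j ∈ ({0, 1} : Finset (Fin 6)) ∨ j = 2 ∨ j ∈ ({3, 4} : Finset (Fin 6)) := by
      revert j; decide
    have hi' : i ∈ ({0, 1} : Finset (Fin 6)) ∨ i = 2 := by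
      revert i; decide
    rcases hj' with hj' | rfl | hj'
    · exact hTP i hi j hj' y hy
    · rcases hi' with hi' | rfl
      · rw [mlieBracket_swap_apply]
        exact neg_mem (hTP 2 (by decide) i hi' y hy)
      · simp
    · rcases hi' with hi' | rfl
      · exact hHF y (hPM i hi' j hj' y hy)
      · exact hTM j hj' y hy
  -- the double bracket `[[t, p], m]`, where `t = [p₀, p₁]`
  have hdouble : ∀ j ∈ ({0, 1} : Finset (Fin 6)), ∀ i ∈ ({3, 4} : Finset (Fin 6)), ∀ y ∈ U,
      mlieBracket (𝓡 6) (mlieBracket (𝓡 6) (f 2) (f j)) (f i) y ∈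
        frameSpan f {0, 1, 2, 3, 4} y := by
    intro j hj i hi y hy
    have hJ := leibniz_mlieBracket hU hy (hfs 2) (hfs j) (hfs i)
    rw [← sub_eq_iff_eq_add.2 hJ]
    refine sub_mem ?_ ?_
    · exact IsFrame.mlieBracket_mem_right hU hfr hy ((hfs j).mlieBracket hU (hfs i))
        (fun z hz => hHF z (hPM j hj i hi z hz)) le_rfl fun k hk => hTT 2 (by decide) k hk y hy
    · exact IsFrame.mlieBracket_mem_right hU hfr hy ((hfs 2).mlieBracket hU (hfs i))
        (hTM i hi) le_rfl fun k hk => hTT j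
          ((by decide : ({0, 1} : Finset (Fin 6)) ⊆ {0, 1, 2}) hj) k hk y hy
  have hcomp : ∀ j ∈ ({0, 1} : Finset (Fin 6)), ∀ y ∈ U,
      mlieBracket (𝓡 6) (f 2) (f j) y ∈ frameSpan f {0, 1, 2} y := by
    intro j hj y hy
    -- the coefficient of `[m₀, m₁]` vanishes exactly on `T₊ ⊕ H₋`
    have hφ : ∀ v ∈ frameSpan f {0, 1, 2, 3, 4} y, hfr.coeff 5 y v = 0 := fun v hv =>
      (hfr.mem_frameSpan hy).1 hv 5 (by decide)
    have hexp : ∀ i ∈ ({3, 4} : Finset (Fin 6)),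
        hfr.coeff 3 y (mlieBracket (𝓡 6) (f 2) (f j) y) *
            hfr.coeff 5 y (mlieBracket (𝓡 6) (f 3) (f i) y) +
          hfr.coeff 4 y (mlieBracket (𝓡 6) (f 2) (f j) y) *
            hfr.coeff 5 y (mlieBracket (𝓡 6) (f 4) (f i) y) = 0 := by
      intro i hi
      have h1 := IsFrame.map_mlieBracket_left hU hfr hy (hfr.coeff 5 y)
        ((hfs 2).mlieBracket hU (hfs j)) (hTP 2 (by decide) j hj)
        (fun k hk => hφ _ (apply_mem_frameSpan hk)) (f i)
      rw [hφ _ (hdouble j hj i hi y hy)] at h1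
      have hi' : i ∈ ({0, 1, 2, 3, 4} : Finset (Fin 6)) :=
        (by decide : ({3, 4} : Finset (Fin 6)) ⊆ {0, 1, 2, 3, 4}) hi
      have hz : ∀ k ∈ ({0, 1, 2} : Finset (Fin 6)),
          hfr.coeff 5 y (mlieBracket (𝓡 6) (f k) (f i) y) = 0 := fun k hk =>
        hφ _ (hTT k hk i hi' y hy)
      rw [Finset.sum_insert (by decide), Finset.sum_insert (by decide),
        Finset.sum_insert (by decide), Finset.sum_insert (by decide), Finset.sum_singleton,
        hz 0 (by decide), hz 1 (by decide), hz 2 (by decide), smul_zero, smul_zero, smul_zero,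
        zero_add, zero_add, zero_add, smul_eq_mul, smul_eq_mul] at h1
      exact h1.symm
    have h5 : hfr.coeff 5 y (mlieBracket (𝓡 6) (f 3) (f 4) y) = 1 := by
      have := hfr.coeff_self hy 5 5
      rwa [if_pos rfl] at this
    have e4 := hexp 4 (by decide)
    have e3 := hexp 3 (by decide)
    rw [h5, mlieBracket_self, Pi.zero_apply, map_zero, mul_one, mul_zero, add_zero] at e4
    rw [e4, zero_mul, zero_add, mlieBracket_swap_apply (V := f 4) (W := f 3), map_neg, h5, mul_neg, mul_one,
      neg_eq_zero] at e3
    rw [hfr.mem_frameSpan hy]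
    intro i hi
    have hi' : i = 3 ∨ i = 4 ∨ i = 5 := by revert i; decide
    rcases hi' with rfl | rfl | rfl
    exacts [e4, e3, hφ _ (hTP 2 (by decide) j hj y hy)]
  have hW : IsOpen (U ∩ V) := hU.inter hV
  have hxW : x ∈ U ∩ V := ⟨hxU, hxV⟩
  have hfW : IsFrame f (U ∩ V) := IsLocalFrameOn.mono hfr Set.inter_subset_left
  have hspan : ∀ {ζ}, IsSection Tp V ζ → ∀ z ∈ U ∩ V, ζ z ∈ frameSpan f {0, 1, 2} z := by
    intro ζ hζ z hz
    rw [← hT z hz.1]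
    exact hζ.mem z hz.2
  rw [hT x hxU]
  refine IsFrame.mlieBracket_mem_left hW hfW hxW (hξ.smooth.mono Set.inter_subset_right)
    (hspan hξ) le_rfl fun i hi => IsFrame.mlieBracket_mem_right hW hfW hxW
      (hη.smooth.mono Set.inter_subset_right) (hspan hη) le_rfl fun j hj => ?_
  have h01 : mlieBracket (𝓡 6) (f 0) (f 1) x ∈ frameSpan f {0, 1, 2} x :=
    apply_mem_frameSpan (i := 2) (by decide)
  have h20 := hcomp 0 (by decide) x hxU
  have h21 := hcomp 1 (by decide) x hxU
  simp only [Finset.mem_insert, Finset.mem_singleton] at hi hj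
  rcases hi with rfl | rfl | rfl <;> rcases hj with rfl | rfl | rfl <;>
    first
      | assumption
      | (rw [mlieBracket_self]; exact zero_mem _)
      | (rw [mlieBracket_swap_apply]; exact neg_mem ‹_›)

/-- The tensor induced by the bracket `T₊ × H₊ → TM / (T₊ ⊕ H₋) ≅ Q₋`, obtained by factoring the form
`B : T₊ × H₊ → Q₋` through `T₊ / H₊ ≅ Q₊`; it measures the failure of `T₊` to be involutive. -/
theorem IsSplitting.exists_tensor (h : IsSplitting H Hp Hm)
    (hTp : ∀ x, Tp.fiber x = bracketFiber Hp x) (hTm : ∀ x, Tm.fiber x = bracketFiber Hm x) :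
    ∃ S : TensorFamily H Hp Hm, IsInduced H Tp Hp Hm S ∧
      (∀ S' : TensorFamily H Hp Hm, IsInduced H Tp Hp Hm S' → S' = S) ∧
      IsSmoothTensor H Tp Tm Hp Hm S ∧ (Involutive Tp ↔ ∀ x, S x = 0) := by
  have hQp : ∀ x, leviRange H Hp x = (Tp.fiber x).map (H.fiber x).mkQ := fun x => by
    rw [leviRange_eq_map h.left_le, hTp x]
  have hTm' : ∀ x, (Tp.fiber x ⊔ Hm.fiber x).map (H.fiber x).mkQ = leviRange H Hp x := by
    intro x
    have h0 : (Hm.fiber x).map (H.fiber x).mkQ = ⊥ := by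
      rw [← LinearMap.le_ker_iff_map, Submodule.ker_mkQ]
      exact h.right_le x
    rw [Submodule.map_sup, h0, sup_bot_eq, hQp x]
  have hle : ∀ x, Hp.fiber x ≤ Tp.fiber x := fun x => hTp x ▸ h.le_bracketFiber x
  have hsec : ∀ {U ξ}, IsSection Hp U ξ → IsSection Tp U ξ := fun hξ =>
    ⟨hξ.smooth, fun y hy => hle y (hξ.mem y hy)⟩
  choose π hπT' hπm' using h.exists_proj
  have hπT : ∀ x, ∀ v ∈ Tp.fiber x, π x v = 0 := fun x v hv => hπT' x v (hTp x ▸ hv)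
  have hπm : ∀ x, ∀ v ∈ Tm.fiber x, (π x v : QFiber H x) = (H.fiber x).mkQ v := fun x v hv =>
    hπm' x v (hTm x ▸ hv)
  have hdec : ∀ x (v : TangentSpace (𝓡 6) x), ∃ a ∈ Tp.fiber x, ∃ b ∈ Tm.fiber x, a + b = v := by
    intro x v
    have : v ∈ Tp.fiber x ⊔ Tm.fiber x := by
      rw [hTp x, hTm x, (h.isCompl x).sup_eq_top]
      trivial
    exact Submodule.mem_sup.1 this
  -- the bracket followed by the projection to `Q₋`, as a bilinear form on `T₊ × H₊`
  choose B hB using fun x => exists_bracketForm Tp Hp x (π x) (fun v hv => hπT x v hv)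
    (fun v hv => hπT x v (hle x hv))
  have hBH : ∀ x (v : Tp.fiber x) (w : Hp.fiber x), (v : TangentSpace (𝓡 6) x) ∈ H.fiber x →
      B x v w = 0 := by
    intro x v w hv
    have hv' : (v : TangentSpace (𝓡 6) x) ∈ Hp.fiber x := h.mem_of_mem (hTp x ▸ v.2) hv
    obtain ⟨ξ, hξ, hξv⟩ := exists_isSection_eq Hp x ⟨v, hv'⟩
    obtain ⟨η, hη, hηw⟩ := exists_isSection_eq Hp x w
    have hx := mem_frameNhd Hp x
    have h1 := hB x _ (isOpen_frameNhd Hp x) ξ η (hsec hξ) hη hx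
    rw [hπT x _ (hTp x ▸ mlieBracket_mem_bracketFiber (isOpen_frameNhd Hp x) hx hξ hη)] at h1
    have e1 : (⟨ξ x, (hsec hξ).mem x hx⟩ : Tp.fiber x) = v := Subtype.ext hξv
    have e2 : (⟨η x, hη.mem x hx⟩ : Hp.fiber x) = w := Subtype.ext hηw
    rwa [e1, e2] at h1
  -- a linear choice of representatives in `T₊`, on which the value of `B` does not depend
  have hσ : ∀ x, ∃ σ : leviRange H Hp x →ₗ[ℝ] Tp.fiber x,
      ∀ q, (H.fiber x).mkQ (σ q : TangentSpace (𝓡 6) x) = q := by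
    intro x
    obtain ⟨e, he⟩ := h.isQuotientAt hTp x
    obtain ⟨r, hr⟩ := ((Hp.fiber x).submoduleOf (Tp.fiber x)).mkQ.exists_rightInverse_of_surjective
      (Submodule.range_mkQ _)
    refine ⟨r ∘ₗ e.symm.toLinearMap, fun q => ?_⟩
    rw [← he]
    have h1 : Submodule.Quotient.mk (r (e.symm q)) = e.symm q := LinearMap.congr_fun hr (e.symm q)
    simp only [LinearMap.comp_apply, LinearEquiv.coe_coe]
    rw [h1, e.apply_symm_apply]
  choose σ hσ using hσ
  let S : TensorFamily H Hp Hm := fun x => B x ∘ₗ σ x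
  have hS : ∀ U : Set M, IsOpen U → ∀ ξ η : VField 6 M, IsSection Tp U ξ → IsSection Hp U η →
      ∀ x ∈ U, ∀ (q : leviRange H Hp x) (w : Hp.fiber x),
        (q : QFiber H x) = (H.fiber x).mkQ (ξ x) → (w : TangentSpace (𝓡 6) x) = η x →
        S x q w = π x (mlieBracket (𝓡 6) ξ η x) := by
    intro U hU ξ η hξ hη x hx q w hq hw
    rw [← hB x U hU ξ η hξ hη hx]
    have e2 : (⟨η x, hη.mem x hx⟩ : Hp.fiber x) = w := Subtype.ext hw.symm
    rw [e2, ← sub_eq_zero]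
    have h1 : S x q w - B x ⟨ξ x, hξ.mem x hx⟩ w = B x (σ x q - ⟨ξ x, hξ.mem x hx⟩) w := by
      rw [map_sub]
      rfl
    rw [h1]
    refine hBH x _ w ?_
    rw [← Submodule.Quotient.mk_eq_zero, ← Submodule.mkQ_apply, Submodule.coe_sub, map_sub, hσ,
      hq, sub_self]
  have hind : IsInduced H Tp Hp Hm S := by
    intro U hU ξ η hξ hη x hx q w hq hw
    rw [hTm' x, hS U hU ξ η hξ hη x hx q w hq hw]
    obtain ⟨a, ha, b, hb, hab⟩ := hdec x (mlieBracket (𝓡 6) ξ η x)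
    rw [← hab, map_add (π x), hπT x a ha, zero_add, hπm x b hb, map_add, add_sub_cancel_right,
      hQp x]
    exact Submodule.mem_map_of_mem ha
  refine ⟨S, hind, fun S' hS' => ?_, ?_, ?_⟩
  · funext x
    ext q w
    obtain ⟨ξ, hξ, hξq⟩ := exists_isSection_eq Tp x (σ x q)
    obtain ⟨η, hη, hηw⟩ := exists_isSection_eq Hp x w
    have hU := (isOpen_frameNhd Tp x).inter (isOpen_frameNhd Hp x)
    have hx : x ∈ frameNhd Tp x ∩ frameNhd Hp x := ⟨mem_frameNhd Tp x, mem_frameNhd Hp x⟩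
    have hξ' := hξ.mono (V := frameNhd Tp x ∩ frameNhd Hp x) Set.inter_subset_left
    have hη' := hη.mono (V := frameNhd Tp x ∩ frameNhd Hp x) Set.inter_subset_right
    have hq : (q : QFiber H x) = (H.fiber x).mkQ (ξ x) := by rw [hξq, hσ]
    have h1 := hS' _ hU ξ η hξ' hη' x hx q w hq hηw.symm
    have h2 := hind _ hU ξ η hξ' hη' x hx q w hq hηw.symm
    rw [hTm' x] at h1 h2
    have h3 := sub_mem h2 h1
    rw [sub_sub_sub_cancel_left] at h3
    exact sub_eq_zero.1 (Submodule.disjoint_def.1 (h.isCompl_leviRange x).disjoint _ h3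
      (sub_mem (S' x q w).2 (S x q w).2))
  · intro U hU ξ η hξ hη x hx
    obtain ⟨O, p, m, hxO, ha, hp, hm⟩ := h x
    have hV : IsOpen (U ∩ O) := hU.inter ha.isOpen
    have hfr : IsFrame (bracketFrame p m) (U ∩ O) :=
      IsLocalFrameOn.mono ha.isFrame Set.inter_subset_right
    have hsm : SmoothOn (mlieBracket (𝓡 6) ξ η) (U ∩ O) :=
      (hξ.smooth.mono Set.inter_subset_left).mlieBracket hV
        (hη.smooth.mono Set.inter_subset_left)
    have hmem : ∀ y ∈ U ∩ O, frameProj hfr {3, 4, 5} (mlieBracket (𝓡 6) ξ η) y ∈ Tm.fiber y := by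
      intro y hy
      rw [hTm y, ha.bracketFiber_right hm hy.2]
      exact frameProj_mem _ _ _ _
    refine ⟨U ∩ O, hV, ⟨hx, hxO⟩, Set.inter_subset_left,
      frameProj hfr {3, 4, 5} (mlieBracket (𝓡 6) ξ η),
      ⟨smoothOn_frameProj hV hfr _ hsm, hmem⟩, fun y hy q w hq hw => ?_⟩
    rw [hS U hU ξ η hξ hη y hy.1 q w hq hw, ← hπm y _ (hmem y hy), ← sub_eq_zero,
      ← Submodule.coe_sub, ← map_sub, hπT y, ZeroMemClass.coe_zero]
    rw [hTp y, ha.bracketFiber_left hp hy.2]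
    have hsum : mlieBracket (𝓡 6) ξ η y - frameProj hfr {3, 4, 5} (mlieBracket (𝓡 6) ξ η) y =
        frameProj hfr {0, 1, 2} (mlieBracket (𝓡 6) ξ η) y := by
      rw [sub_eq_iff_eq_add, frameProj_apply, frameProj_apply, ← Finset.sum_union (by decide)]
      exact (IsFrame.sum_coeff hfr hy _).symm
    rw [hsum]
    exact frameProj_mem _ _ _ _
  · constructor
    · intro hinv x
      ext q w
      obtain ⟨ξ, hξ, hξq⟩ := exists_isSection_eq Tp x (σ x q)
      obtain ⟨η, hη, hηw⟩ := exists_isSection_eq Hp x w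
      have hU := (isOpen_frameNhd Tp x).inter (isOpen_frameNhd Hp x)
      have hx : x ∈ frameNhd Tp x ∩ frameNhd Hp x := ⟨mem_frameNhd Tp x, mem_frameNhd Hp x⟩
      have hξ' := hξ.mono (V := frameNhd Tp x ∩ frameNhd Hp x) Set.inter_subset_left
      have hη' := hη.mono (V := frameNhd Tp x ∩ frameNhd Hp x) Set.inter_subset_right
      have hq : (q : QFiber H x) = (H.fiber x).mkQ (ξ x) := by rw [hξq, hσ]
      rw [hS _ hU ξ η hξ' hη' x hx q w hq hηw.symm,
        hπT x _ (hinv _ hU ξ η hξ' (hsec hη') x hx)]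
      rfl
    · intro h0
      refine h.involutive_of_mem hTp fun U hU ξ η hξ hη x hx => ?_
      have hq : (H.fiber x).mkQ (ξ x) ∈ leviRange H Hp x := by
        rw [hQp x]
        exact Submodule.mem_map_of_mem (hξ.mem x hx)
      have h1 := hind U hU ξ η hξ hη x hx ⟨_, hq⟩ ⟨η x, hη.mem x hx⟩ rfl rfl
      rw [h0 x] at h1
      simp only [LinearMap.zero_apply, ZeroMemClass.coe_zero, sub_zero] at h1
      obtain ⟨v, hv, hvb⟩ := h1
      have hd : mlieBracket (𝓡 6) ξ η x - v ∈ H.fiber x := by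
        rw [← Submodule.Quotient.mk_eq_zero, ← Submodule.mkQ_apply, map_sub, hvb, sub_self]
      have hH : H.fiber x ≤ Tp.fiber x ⊔ Hm.fiber x := by
        rw [← h.sup_eq x]
        exact sup_le_sup_right (hle x) _
      have := add_mem (hH hd) hv
      rwa [sub_add_cancel] at this

end Six

end CodimTwo

end

theorem mainTheorem3 {M : Type*} [TopologicalSpace M] [T2Space M] [SecondCountableTopology M]
    [ConnectedSpace M] [ChartedSpace (EuclideanSpace ℝ (Fin 6)) M] [IsManifold (𝓡 6) ∞ M]
    (o : MfdOrientation 6 M) (H : Subbundle 6 4 M) (hH : IsHyperbolic H) :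
    ∃ Hp Hm : Subbundle 6 2 M,
      -- existence and uniqueness of the canonical splitting `H = H₊ ⊕ H₋`
      IsCanonicalSplitting o H Hp Hm ∧
      (∀ Kp Km : Subbundle 6 2 M, IsCanonicalSplitting o H Kp Km → Kp = Hp ∧ Km = Hm) ∧
      -- `Q = Q₊ ⊕ Q₋`
      (∀ x, IsCompl (leviRange H Hp x) (leviRange H Hm x)) ∧
      -- the subbundles `T₊M = [H₊, H₊]` and `T₋M = [H₋, H₋]`, with `TM = T₊M ⊕ T₋M`
      ∃ Tp Tm : Subbundle 6 3 M,
        (∀ x, Tp.fiber x = bracketFiber Hp x) ∧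
        (∀ x, Tm.fiber x = bracketFiber Hm x) ∧
        (∀ x, IsCompl (Tp.fiber x) (Tm.fiber x)) ∧
        -- `Q₊ = T₊M / H₊` and `Q₋ = T₋M / H₋`
        (∀ x, Hp.fiber x ≤ Tp.fiber x ∧ IsQuotientAt H Tp Hp x (leviRange H Hp x)) ∧
        (∀ x, Hm.fiber x ≤ Tm.fiber x ∧ IsQuotientAt H Tm Hm x (leviRange H Hm x)) ∧
        -- the tensor `S₊` is well defined and is the obstruction to integrability of `T₊M`
        (∃ Sp : TensorFamily H Hp Hm,
          IsInduced H Tp Hp Hm Sp ∧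
          (∀ S' : TensorFamily H Hp Hm, IsInduced H Tp Hp Hm S' → S' = Sp) ∧
          IsSmoothTensor H Tp Tm Hp Hm Sp ∧
          (Involutive Tp ↔ ∀ x, Sp x = 0)) ∧
        -- the tensor `S₋` is well defined and is the obstruction to integrability of `T₋M`
        (∃ Sm : TensorFamily H Hm Hp,
          IsInduced H Tm Hm Hp Sm ∧
          (∀ S' : TensorFamily H Hm Hp, IsInduced H Tm Hm Hp S' → S' = Sm) ∧
          IsSmoothTensor H Tm Tp Hm Hp Sm ∧
          (Involutive Tm ↔ ∀ x, Sm x = 0)) := by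
  obtain ⟨Hp, Hm, hc⟩ := hH.exists_isCanonicalSplitting o
  have hs := hc.isSplitting
  obtain ⟨Tp, hTp⟩ := hs.exists_subbundle
  obtain ⟨Tm, hTm⟩ := hs.symm.exists_subbundle
  exact ⟨Hp, Hm, hc, fun Kp Km hK => hc.unique hK, hs.isCompl_leviRange, Tp, Tm, hTp, hTm,
    fun x => by rw [hTp x, hTm x]; exact hs.isCompl x,
    fun x => ⟨hTp x ▸ hs.le_bracketFiber x, hs.isQuotientAt hTp x⟩,
    fun x => ⟨hTm x ▸ hs.symm.le_bracketFiber x, hs.symm.isQuotientAt hTm x⟩,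
    hs.exists_tensor hTp hTm, hs.symm.exists_tensor hTm hTp⟩
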